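/- Work over $\mathbb{K}=\mathbb{R}$ or $\mathbb{C}$ (smooth, respectively holomorphic, finite-dimensional manifolds). On a manifold $X$ with a closed $3$-form $\eta$, equip $TX\oplus T^*X$ with the pairing $\langle(v,\alpha),(w,\beta)\rangle=\alpha(w)+\beta(v)$ and the bracket $[\![(v,\alpha),(w,\beta)]\!]_\eta=([v,w],\mathcal{L}_v\beta-\iota_w d\alpha+\eta(v,w,\cdot))$. An $\eta$-twisted Dirac structure is a smooth Lagrangian subbundle $L_X$ whose (local) sections are closed under this bracket. A generalized reduction level of $(X,L_X,\eta)$ is a triple $(S,\gamma,\varphi)$ of an (immersed) submanifold $\imath:S\hookrightarrow X$, a $2$-form $\gamma\in\Omega^2(S)$ and a smooth map of constant rank $\varphi:S\to Z$ to a (twisted) Dirac manifold $(Z,L_Z)$ such that, pointwise on $S$, $\varphi_*(\tau_{-\gamma}\imath^*L_X)=L_Z$, where $\imath^*L=\{(v,\imath^*\alpha)\mid(\imath_*v,\alpha)\in L\}$, $\tau_{-\gamma}L=\{(v,\alpha-\gamma(v,\cdot))\mid(v,\alpha)\in L\}$ and $\varphi_*L=\{(\varphi_*v,\beta)\mid(v,\varphi^*\beta)\in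 L\}$; the distribution $A_{S,\gamma,\varphi}=\{(v,\alpha)\in L_X\mid v\in TS,\ \varphi_*v=0,\ \imath^*\alpha=\gamma(v,\cdot)\}$ has constant rank; and the tangent parts of its elements lie in $\ker(\imath^*\eta+d\gamma)$. Then $A_{S,\gamma,\varphi}$, with the anchor $(v,\alpha)\mapsto v$ and the bracket induced by $[\![\cdot,\cdot]\!]_\eta$, is called the stabilizer subalgebroid. When $\gamma=0$ we write $(S,\varphi)$ and $A_{S,\varphi}$. Let $G$ be a Lie group whose Lie algebra $\mathfrak{g}$ carries an invariant, nondegenerate, symmetric bilinear form $(\cdot,\cdot)$. Its Cartan--Dirac structure is $$L_G=\{(\xi^L-\xi^R,\sigma(\xi))\mid\xi\in\mathfrak{g}\},\qquad \sigma(\xi)=\tfrac12(\xi^L+\xi^R)^\vee,$$ where $\xi^L,\xi^R$ are the left- and right-invariant vector fields of $\xi$ and $\vee:TG\cong T^*G$ is induced by the form; it is twisted by $-\eta_G$, where $\eta_G$ is the bi-invariant $3$-form given on $\mathfrak{g}$ by $\tfrac12(x,[y,z])$. Let $\mathfrak{h}\subset\mathfrak{g}$ be a Lie subalgebra which is reducible,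 i.e. its annihilator $\mathfrak{h}^\perp$ is also a Lie subalgebra. Let $H$ and $H^\perp$ be the connected (immersed) Lie subgroups of $G$ which integrate $\mathfrak{h}$ and $\mathfrak{h}^\perp$, suppose that $H\cap H^\perp$ is closed in the Lie group $H$, so that $\overline H=H/(H\cap H^\perp)$ is a Lie group, and let $\varphi:H\to\overline H$ be the quotient map. Then the form on $\mathfrak{h}$ descends to an invariant, nondegenerate, symmetric bilinear form on the Lie algebra of $\overline H$. With $\overline H$ equipped with the corresponding Cartan--Dirac structure, $(H,\varphi)$ is a generalized reduction level of $(G,L_G)$. Moreover, $\xi\mapsto\xi^L-\xi^R$ is an action of the Lie algebra $\mathfrak{h}^\perp$ on $H$, and $(h,\xi)\mapsto(\xi^L-\xi^R,\sigma(\xi))_h$ is an isomorphism of Lie algebroids from the action Lie algebroid $H\rtimes\mathfrak{h}^\perp$ onto the stabilizer subalgebroid $A_{H,\varphi}$. -/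

import Mathlib

open scoped Manifold ContDiff
open VectorField

noncomputable section

/-! ## Linear Dirac geometry -/

namespace DiracGeometry

section Linear

set_option linter.unusedSectionVars false

variable {𝕜 V W : Type*} [NontriviallyNormedField 𝕜]
  [AddCommGroup V] [Module 𝕜 V] [TopologicalSpace V] [IsTopologicalAddGroup V]
  [ContinuousSMul 𝕜 V]
  [AddCommGroup W] [Module 𝕜 W] [TopologicalSpace W] [IsTopologicalAddGroup W]
  [ContinuousSMul 𝕜 W]

/-- The symmetric pairing `⟨(v, α), (w, β)⟩ = α(w) + β(v)` on `V ⊕ V*`. -/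
def pairing (a b : V × (V →L[𝕜] 𝕜)) : 𝕜 := a.2 b.1 + b.2 a.1

/-- `L ⊆ V ⊕ V*` is Lagrangian: it equals its own orthogonal for the pairing. -/
def IsLagrangian (L : Submodule 𝕜 (V × (V →L[𝕜] 𝕜))) : Prop :=
  ∀ a, a ∈ L ↔ ∀ b ∈ L, pairing a b = 0

/-- The covector `γ(v, ·)`. -/
def contract₂ (γ : V [⋀^Fin 2]→L[𝕜] 𝕜) (v : V) : V →L[𝕜] 𝕜 where
  toFun w := γ ![v, w]
  map_add' w w' := by
    have h := γ.map_update_add ![v, w] 1 w w'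
    have e : ∀ x, Function.update ![v, w] 1 x = ![v, x] := by
      intro x; ext i; fin_cases i <;> rfl
    simpa only [e] using h
  map_smul' c w := by
    have h := γ.map_update_smul ![v, w] 1 c w
    have e : ∀ x, Function.update ![v, w] 1 x = ![v, x] := by
      intro x; ext i; fin_cases i <;> rfl
    simpa only [e, RingHom.id_apply] using h
  cont := by
    refine γ.cont.comp (continuous_pi fun i => ?_)
    fin_cases i
    · exact continuous_const
    · exact continuous_id

/-- The covector `η(v, w, ·)`. -/
def contract₃ (η : V [⋀^Fin 3]→L[𝕜] 𝕜) (v w : V) : V →L[𝕜] 𝕜 where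
  toFun u := η ![v, w, u]
  map_add' u u' := by
    have h := η.map_update_add ![v, w, u] 2 u u'
    have e : ∀ x, Function.update ![v, w, u] 2 x = ![v, w, x] := by
      intro x; ext i; fin_cases i <;> rfl
    simpa only [e] using h
  map_smul' c u := by
    have h := η.map_update_smul ![v, w, u] 2 c u
    have e : ∀ x, Function.update ![v, w, u] 2 x = ![v, w, x] := by
      intro x; ext i; fin_cases i <;> rfl
    simpa only [e, RingHom.id_apply] using h
  cont := by
    refine η.cont.comp (continuous_pi fun i => ?_)
    fin_cases i
    · exact continuous_const
    · exact continuous_const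
    · exact continuous_id

theorem contract₂_add (γ : V [⋀^Fin 2]→L[𝕜] 𝕜) (v v' : V) :
    contract₂ γ (v + v') = contract₂ γ v + contract₂ γ v' := by
  ext w
  have h := γ.map_update_add ![v, w] 0 v v'
  have e : ∀ x, Function.update ![v, w] 0 x = ![x, w] := by
    intro x; ext i; fin_cases i <;> rfl
  rw [e, e, e] at h
  exact h

theorem contract₂_smul (γ : V [⋀^Fin 2]→L[𝕜] 𝕜) (c : 𝕜) (v : V) :
    contract₂ γ (c • v) = c • contract₂ γ v := by
  ext w
  have h := γ.map_update_smul ![v, w] 0 c v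
  have e : ∀ x, Function.update ![v, w] 0 x = ![x, w] := by
    intro x; ext i; fin_cases i <;> rfl
  rw [e, e] at h
  exact h

/-- The flat map `γ♭ : V → V*`, `v ↦ γ(v, ·)`. -/
def flat (γ : V [⋀^Fin 2]→L[𝕜] 𝕜) : V →ₗ[𝕜] (V →L[𝕜] 𝕜) where
  toFun := contract₂ γ
  map_add' := contract₂_add γ
  map_smul' := contract₂_smul γ

/-- The pullback `{(v, f*α) | (f v, α) ∈ L}`. -/
def pullback (f : V →L[𝕜] W) (L : Submodule 𝕜 (W × (W →L[𝕜] 𝕜))) :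
    Submodule 𝕜 (V × (V →L[𝕜] 𝕜)) where
  carrier := {p | ∃ α : W →L[𝕜] 𝕜, p.2 = α.comp f ∧ (f p.1, α) ∈ L}
  add_mem' := by
    rintro p q ⟨α, hα, hp⟩ ⟨β, hβ, hq⟩
    refine ⟨α + β, by rw [Prod.snd_add, hα, hβ, ContinuousLinearMap.add_comp], ?_⟩
    simpa using L.add_mem hp hq
  zero_mem' := ⟨0, by simp, by
    have h : ((0, 0) : W × (W →L[𝕜] 𝕜)) ∈ L := L.zero_mem
    simpa only [map_zero, Prod.fst_zero, Prod.snd_zero, ContinuousLinearMap.zero_comp] using h⟩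
  smul_mem' := by
    rintro c p ⟨α, hα, hp⟩
    refine ⟨c • α, by rw [Prod.smul_snd, hα, ContinuousLinearMap.smul_comp], ?_⟩
    simpa using L.smul_mem c hp

/-- The pushforward `{(f v, β) | (v, f*β) ∈ L}`. -/
def pushforward (f : V →L[𝕜] W) (L : Submodule 𝕜 (V × (V →L[𝕜] 𝕜))) :
    Submodule 𝕜 (W × (W →L[𝕜] 𝕜)) where
  carrier := {p | ∃ v : V, f v = p.1 ∧ (v, p.2.comp f) ∈ L}
  add_mem' := by
    rintro p q ⟨v, hv, hp⟩ ⟨w, hw, hq⟩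
    refine ⟨v + w, by simp [hv, hw], ?_⟩
    simpa [ContinuousLinearMap.add_comp] using L.add_mem hp hq
  zero_mem' := ⟨0, by simp, by
    have h : ((0, 0) : V × (V →L[𝕜] 𝕜)) ∈ L := L.zero_mem
    simpa only [map_zero, Prod.fst_zero, Prod.snd_zero, ContinuousLinearMap.zero_comp] using h⟩
  smul_mem' := by
    rintro c p ⟨v, hv, hp⟩
    refine ⟨c • v, by simp [hv], ?_⟩
    simpa [ContinuousLinearMap.smul_comp] using L.smul_mem c hp

/-- The gauge transformation `τ_γ L = {(v, α + γ♭ v) | (v, α) ∈ L}`. -/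
def gauge (γ : V [⋀^Fin 2]→L[𝕜] 𝕜) (L : Submodule 𝕜 (V × (V →L[𝕜] 𝕜))) :
    Submodule 𝕜 (V × (V →L[𝕜] 𝕜)) where
  carrier := {p | (p.1, p.2 - flat γ p.1) ∈ L}
  add_mem' := by
    intro p q hp hq
    have h := L.add_mem hp hq
    simp only [Prod.mk_add_mk] at h
    simpa [add_sub_add_comm] using h
  zero_mem' := by
    have h : ((0, 0) : V × (V →L[𝕜] 𝕜)) ∈ L := L.zero_mem
    simpa only [Set.mem_ofPred_eq, map_zero, Prod.fst_zero, Prod.snd_zero, sub_zero] using h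
  smul_mem' := by
    intro c p hp
    have h := L.smul_mem c hp
    simp only [Prod.smul_mk] at h
    simpa [smul_sub] using h

end Linear

/-! ## Differential forms and the Dorfman bracket on manifolds

Manifolds are real or complex, finite-dimensional and without boundary, modelled on a
vector space `E`; smooth means `C^∞` over the base field (holomorphic over `ℂ`). -/

section Manifold

variable {𝕜 : Type*} [RCLike 𝕜]
  {E : Type*} [NormedAddCommGroup E] [NormedSpace 𝕜 E]
  {M : Type*} [TopologicalSpace M] [ChartedSpace E M]

variable (𝕜 E) in
/-- The cotangent space of `M` at `x`. -/
abbrev Cotangent (x : M) : Type _ := TangentSpace 𝓘(𝕜, E) x →L[𝕜] 𝕜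

variable (𝕜 E) in
/-- The fibre `T_x M ⊕ T_x^* M` of the generalized tangent bundle. -/
abbrev GenTangent (x : M) : Type _ := TangentSpace 𝓘(𝕜, E) x × Cotangent 𝕜 E x

variable (𝕜 E M) in
/-- (Not necessarily smooth) differential `k`-forms on `M`. -/
abbrev FormField (k : ℕ) : Type _ := ∀ x : M, TangentSpace 𝓘(𝕜, E) x [⋀^Fin k]→L[𝕜] 𝕜

/-- The expression of a form in the preferred chart at `x₀`: its pullback to the model space
along the inverse of the chart. -/
def chartForm {k : ℕ} (θ : FormField 𝕜 E M k) (x₀ : M) : E → E [⋀^Fin k]→L[𝕜] 𝕜 :=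
  fun y => (θ ((chartAt E x₀).symm y)).compContinuousLinearMap
    (mfderiv 𝓘(𝕜, E) 𝓘(𝕜, E) (chartAt E x₀).symm y)

/-- Smooth differential forms. -/
def IsSmoothForm {k : ℕ} (θ : FormField 𝕜 E M k) : Prop :=
  ∀ x₀ : M, ContDiffOn 𝕜 ∞ (chartForm θ x₀) (chartAt E x₀).target

/-- The exterior derivative, computed at `x` in the preferred chart at `x`. -/
def extDerivForm {k : ℕ} (θ : FormField 𝕜 E M k) : FormField 𝕜 E M (k + 1) :=
  fun x => (extDeriv (chartForm θ x) (chartAt E x x)).compContinuousLinearMap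
    (mfderiv 𝓘(𝕜, E) 𝓘(𝕜, E) (chartAt E x) x)

/-- A field of covectors seen as a differential form of degree one. -/
def oneForm (α : ∀ x : M, Cotangent 𝕜 E x) : FormField 𝕜 E M 1 :=
  fun x => ContinuousAlternatingMap.ofSubsingleton 𝕜 (TangentSpace 𝓘(𝕜, E) x) 𝕜 0 (α x)

variable [IsManifold 𝓘(𝕜, E) ∞ M]

/-- Smoothness over the open set `U` of a section `(v, α)` of `TM ⊕ T^*M`. -/
def IsSmoothSectionOn (e : ∀ x : M, GenTangent 𝕜 E x) (U : Set M) : Prop :=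
  ContMDiffOn 𝓘(𝕜, E) 𝓘(𝕜, E).tangent ∞
    (fun x => (⟨x, (e x).1⟩ : TangentBundle 𝓘(𝕜, E) M)) U ∧
  ∀ x₀ : M, ContDiffOn 𝕜 ∞ (chartForm (oneForm fun x => (e x).2) x₀)
    ((chartAt E x₀).target ∩ (chartAt E x₀).symm ⁻¹' U)

/-- The `η`-twisted Dorfman bracket
`⟦(v, α), (w, β)⟧ = ([v, w], 𝓛_v β - ι_w dα + η(v, w, ·))`,
where `𝓛_v β = d(β(v)) + ι_v dβ`. -/
def dorfman (η : FormField 𝕜 E M 3) (e₁ e₂ : ∀ x : M, GenTangent 𝕜 E x) (x : M) :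
    GenTangent 𝕜 E x :=
  (mlieBracket 𝓘(𝕜, E) (fun y => (e₁ y).1) (fun y => (e₂ y).1) x,
    (show Cotangent 𝕜 E x from mfderiv 𝓘(𝕜, E) 𝓘(𝕜, 𝕜) (fun y => (e₂ y).2 (e₁ y).1) x)
      + contract₂ (extDerivForm (oneForm fun y => (e₂ y).2) x) (e₁ x).1
      - contract₂ (extDerivForm (oneForm fun y => (e₁ y).2) x) (e₂ x).1
      + contract₃ (η x) (e₁ x).1 (e₂ x).1)

/-- `L` is a smooth vector subbundle of `TM ⊕ T^*M`: it has local smooth frames. -/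
def IsSmoothSubbundle (L : ∀ x : M, Submodule 𝕜 (GenTangent 𝕜 E x)) : Prop :=
  ∀ x₀ : M, ∃ U : Set M, IsOpen U ∧ x₀ ∈ U ∧
    ∃ (r : ℕ) (e : Fin r → ∀ x : M, GenTangent 𝕜 E x),
      (∀ i, IsSmoothSectionOn (e i) U) ∧
      ∀ x ∈ U, LinearIndependent 𝕜 (fun i => e i x) ∧
        Submodule.span 𝕜 (Set.range fun i => e i x) = L x

/-- `(M, L)` is an `η`-twisted Dirac manifold. -/
structure IsDirac (η : FormField 𝕜 E M 3) (L : ∀ x : M, Submodule 𝕜 (GenTangent 𝕜 E x)) :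
    Prop where
  smooth_twist : IsSmoothForm η
  closed_twist : ∀ x, extDerivForm η x = 0
  subbundle : IsSmoothSubbundle L
  lagrangian : ∀ x, IsLagrangian (L x)
  involutive : ∀ (U : Set M), IsOpen U → ∀ e₁ e₂ : ∀ x : M, GenTangent 𝕜 E x,
    IsSmoothSectionOn e₁ U → IsSmoothSectionOn e₂ U →
    (∀ x ∈ U, e₁ x ∈ L x) → (∀ x ∈ U, e₂ x ∈ L x) → ∀ x ∈ U, dorfman η e₁ e₂ x ∈ L x

end Manifold

/-! ## Generalized reduction levels -/

section ReductionLevel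

variable {𝕜 : Type*} [RCLike 𝕜]
  {EX : Type*} [NormedAddCommGroup EX] [NormedSpace 𝕜 EX]
  {X : Type*} [TopologicalSpace X] [ChartedSpace EX X] [IsManifold 𝓘(𝕜, EX) ∞ X]
  {ES : Type*} [NormedAddCommGroup ES] [NormedSpace 𝕜 ES]
  {S : Type*} [TopologicalSpace S] [ChartedSpace ES S] [IsManifold 𝓘(𝕜, ES) ∞ S]
  {EZ : Type*} [NormedAddCommGroup EZ] [NormedSpace 𝕜 EZ]
  {Z : Type*} [TopologicalSpace Z] [ChartedSpace EZ Z] [IsManifold 𝓘(𝕜, EZ) ∞ Z]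

variable (𝕜 EX ES) in
/-- The manifold `S` is an (immersed) submanifold of `X` through `ι`. -/
structure IsSubmanifold (ι : S → X) : Prop where
  smooth : ContMDiff 𝓘(𝕜, ES) 𝓘(𝕜, EX) ∞ ι
  injective : Function.Injective ι
  immersion : ∀ s, Function.Injective (mfderiv 𝓘(𝕜, ES) 𝓘(𝕜, EX) ι s)

/-- The distribution
`A_{S,γ,φ} = {(v, α) ∈ L_X | v ∈ TS, v ∈ ker φ_*, ι^*α = γ♭(v)}` along `ι : S → X`. -/
def stabilizer (L : ∀ x : X, Submodule 𝕜 (GenTangent 𝕜 EX x)) (ι : S → X)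
    (γ : FormField 𝕜 ES S 2) (φ : S → Z) (s : S) : Submodule 𝕜 (GenTangent 𝕜 EX (ι s)) where
  carrier := {p | p ∈ L (ι s) ∧ ∃ u : TangentSpace 𝓘(𝕜, ES) s,
    mfderiv 𝓘(𝕜, ES) 𝓘(𝕜, EX) ι s u = p.1 ∧
    mfderiv 𝓘(𝕜, ES) 𝓘(𝕜, EZ) φ s u = 0 ∧
    p.2.comp (mfderiv 𝓘(𝕜, ES) 𝓘(𝕜, EX) ι s) = flat (γ s) u}
  add_mem' := by
    rintro p q ⟨hp, u, h1, h2, h3⟩ ⟨hq, u', h1', h2', h3'⟩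
    refine ⟨add_mem hp hq, u + u', ?_, ?_, ?_⟩
    · rw [map_add, h1, h1', Prod.fst_add]
    · rw [map_add, h2, h2', add_zero]
    · rw [Prod.snd_add, ContinuousLinearMap.add_comp, h3, h3', map_add]
  zero_mem' := ⟨zero_mem _, 0, by simp, by simp, by simp⟩
  smul_mem' := by
    rintro c p ⟨hp, u, h1, h2, h3⟩
    refine ⟨Submodule.smul_mem _ c hp, c • u, ?_, ?_, ?_⟩
    · rw [map_smul, h1, Prod.smul_fst]
    · rw [map_smul, h2, smul_zero]
    · rw [Prod.smul_snd, ContinuousLinearMap.smul_comp, h3, map_smul]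

/-- `(S, γ, φ)` is a generalized reduction level of the `ηX`-twisted Dirac manifold `(X, LX)`
relative to the `ηZ`-twisted Dirac manifold `(Z, LZ)`. -/
structure IsGeneralizedReductionLevel
    (ηX : FormField 𝕜 EX X 3) (LX : ∀ x : X, Submodule 𝕜 (GenTangent 𝕜 EX x))
    (ι : S → X) (γ : FormField 𝕜 ES S 2) (φ : S → Z)
    (ηZ : FormField 𝕜 EZ Z 3) (LZ : ∀ z : Z, Submodule 𝕜 (GenTangent 𝕜 EZ z)) : Prop where
  dirac_source : IsDirac ηX LX
  dirac_target : IsDirac ηZ LZ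
  submanifold : IsSubmanifold 𝕜 EX ES ι
  smooth_form : IsSmoothForm γ
  smooth_map : ContMDiff 𝓘(𝕜, ES) 𝓘(𝕜, EZ) ∞ φ
  constant_rank_map : ∃ r : ℕ, ∀ s,
    Module.finrank 𝕜 (LinearMap.range (mfderiv 𝓘(𝕜, ES) 𝓘(𝕜, EZ) φ s).toLinearMap) = r
  /-- `φ_*(τ_{-γ} ι^* L_X) = L_Z`. -/
  push : ∀ s, pushforward (mfderiv 𝓘(𝕜, ES) 𝓘(𝕜, EZ) φ s)
    (gauge (-γ s) (pullback (mfderiv 𝓘(𝕜, ES) 𝓘(𝕜, EX) ι s) (LX (ι s)))) = LZ (φ s)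
  /-- `A_{S,γ,φ}` has constant rank. -/
  constant_rank : ∃ r : ℕ, ∀ s, Module.finrank 𝕜 (stabilizer (EZ := EZ) LX ι γ φ s) = r
  /-- The tangent part of `A_{S,γ,φ}` lies in `ker (ι^* η + dγ)`. -/
  kernel : ∀ s (u : TangentSpace 𝓘(𝕜, ES) s) (α : Cotangent 𝕜 EX (ι s)),
    (mfderiv 𝓘(𝕜, ES) 𝓘(𝕜, EX) ι s u, α) ∈ stabilizer (EZ := EZ) LX ι γ φ s →
    ∀ a b : TangentSpace 𝓘(𝕜, ES) s,
      ((ηX (ι s)).compContinuousLinearMap (mfderiv 𝓘(𝕜, ES) 𝓘(𝕜, EX) ι s)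
        + extDerivForm γ s) ![u, a, b] = 0

end ReductionLevel

end DiracGeometry

/-! ## Lie groups and their Cartan–Dirac structures -/

namespace CartanDirac

open DiracGeometry

/-- Smooth real or complex Lie groups meet the regularity threshold under which their Lie
algebras are defined. -/
instance instLieGroupMinSmoothness {𝕜 : Type*} [RCLike 𝕜] {E : Type*} [NormedAddCommGroup E]
    [NormedSpace 𝕜 E] {G : Type*} [Group G] [TopologicalSpace G] [ChartedSpace E G]
    [LieGroup 𝓘(𝕜, E) ∞ G] : LieGroup 𝓘(𝕜, E) (minSmoothness 𝕜 3) G :=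
  LieGroup.of_le (n := ∞) (by
    rw [minSmoothness_of_isRCLikeNormedField]
    exact ENat.LEInfty.out)

section Group

variable {𝕜 : Type*} [RCLike 𝕜]
  {E : Type*} [NormedAddCommGroup E] [NormedSpace 𝕜 E]
  {G : Type*} [Group G] [TopologicalSpace G] [ChartedSpace E G]

instance instFiniteDimensionalTangentSpace [FiniteDimensional 𝕜 E] (g : G) :
    FiniteDimensional 𝕜 (TangentSpace 𝓘(𝕜, E) g) := inferInstanceAs (FiniteDimensional 𝕜 E)

instance instT2SpaceTangentSpace (g : G) : T2Space (TangentSpace 𝓘(𝕜, E) g) :=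
  inferInstanceAs (T2Space E)

variable (𝕜 E) in
/-- The adjoint action `Ad_g`: the derivative at `1` of conjugation by `g`. -/
def Ad (g : G) : GroupLieAlgebra 𝓘(𝕜, E) G →L[𝕜] GroupLieAlgebra 𝓘(𝕜, E) G :=
  (mfderiv 𝓘(𝕜, E) 𝓘(𝕜, E) (fun x : G => g * x * g⁻¹) 1 : E →L[𝕜] E)

variable (𝕜 E) in
/-- `ξ ↦ ξ^L(g)`, the left-invariant vector field of `ξ` at `g`. -/
def leftVec (g : G) : GroupLieAlgebra 𝓘(𝕜, E) G →L[𝕜] TangentSpace 𝓘(𝕜, E) g :=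
  (mfderiv 𝓘(𝕜, E) 𝓘(𝕜, E) (fun x : G => g * x) 1 : E →L[𝕜] E)

variable (𝕜 E) in
/-- `ξ ↦ ξ^R(g)`, the right-invariant vector field of `ξ` at `g`. -/
def rightVec (g : G) : GroupLieAlgebra 𝓘(𝕜, E) G →L[𝕜] TangentSpace 𝓘(𝕜, E) g :=
  (mfderiv 𝓘(𝕜, E) 𝓘(𝕜, E) (fun x : G => x * g) 1 : E →L[𝕜] E)

variable (𝕜 E) in
/-- The left-invariant Maurer–Cartan form `θ^L` at `g`: left translation by `g⁻¹`. -/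
def maurerCartan (g : G) : TangentSpace 𝓘(𝕜, E) g →L[𝕜] GroupLieAlgebra 𝓘(𝕜, E) G :=
  (mfderiv 𝓘(𝕜, E) 𝓘(𝕜, E) (fun x : G => g⁻¹ * x) g : E →L[𝕜] E)

variable (𝕜 E) in
/-- The derivative at the identity of a map of Lie groups (used for homomorphisms). -/
def lieMap {E' : Type*} [NormedAddCommGroup E'] [NormedSpace 𝕜 E']
    {G' : Type*} [Group G'] [TopologicalSpace G'] [ChartedSpace E' G'] (f : G' → G) :
    GroupLieAlgebra 𝓘(𝕜, E') G' →L[𝕜] GroupLieAlgebra 𝓘(𝕜, E) G :=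
  (mfderiv 𝓘(𝕜, E') 𝓘(𝕜, E) f 1 : E' →L[𝕜] E)

variable (𝕜 E G) in
/-- A nondegenerate symmetric bilinear form on the Lie algebra of `G`, invariant under the adjoint
actions of the Lie algebra and of the group. -/
structure InvariantPairing [CompleteSpace E] [LieGroup 𝓘(𝕜, E) ∞ G] where
  form : LinearMap.BilinForm 𝕜 (GroupLieAlgebra 𝓘(𝕜, E) G)
  symm : ∀ x y, form x y = form y x
  nondegenerate : form.Nondegenerate
  lie_invariant : ∀ x y z, form ⁅x, y⁆ z = form x ⁅y, z⁆
  Ad_invariant : ∀ (g : G) x y, form (Ad 𝕜 E g x) (Ad 𝕜 E g y) = form x y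

variable [FiniteDimensional 𝕜 E] [CompleteSpace E] [LieGroup 𝓘(𝕜, E) ∞ G]

variable (𝕜 E G) in
/-- The Lie bracket as a bilinear map. -/
def bracketMap : GroupLieAlgebra 𝓘(𝕜, E) G →ₗ[𝕜]
    GroupLieAlgebra 𝓘(𝕜, E) G →ₗ[𝕜] GroupLieAlgebra 𝓘(𝕜, E) G :=
  LinearMap.mk₂ 𝕜 (fun x y => ⁅x, y⁆) add_lie smul_lie lie_add (fun c x y => lie_smul c x y)

theorem continuous_trilinear {V : Type*} [NormedAddCommGroup V] [NormedSpace 𝕜 V]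
    [FiniteDimensional 𝕜 V] (f : V →ₗ[𝕜] V →ₗ[𝕜] 𝕜) (b : V →ₗ[𝕜] V →ₗ[𝕜] V) :
    Continuous fun v : Fin 3 → V => f (v 0) (b (v 1) (v 2)) := by
  have h0 : Continuous fun v : Fin 3 → V => v 0 := continuous_apply 0
  have h1 : Continuous fun v : Fin 3 → V => v 1 := continuous_apply 1
  have h2 : Continuous fun v : Fin 3 → V => v 2 := continuous_apply 2
  exact (LinearMap.toContinuousBilinearMap f).continuous₂.comp
    (h0.prodMk ((LinearMap.toContinuousBilinearMap b).continuous₂.comp (h1.prodMk h2)))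

/-- The Cartan `3`-tensor `(x, y, z) ↦ ½ (x, [y, z])` on the Lie algebra. -/
def cartanTensor (B : InvariantPairing 𝕜 E G) :
    GroupLieAlgebra 𝓘(𝕜, E) G [⋀^Fin 3]→L[𝕜] 𝕜 where
  toFun v := (1 / 2 : 𝕜) * B.form (v 0) ⁅v 1, v 2⁆
  map_update_add' := by
    intro inst v i x y
    have : inst = (fun a b => instDecidableEqFin 3 a b) := Subsingleton.elim _ _
    subst this
    fin_cases i <;> simp [Function.update] <;> ring
  map_update_smul' := by
    intro inst v i c x
    have : inst = (fun a b => instDecidableEqFin 3 a b) := Subsingleton.elim _ _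
    subst this
    fin_cases i <;> simp [Function.update] <;> ring
  cont := continuous_const.mul
    (continuous_trilinear (𝕜 := 𝕜) (V := E) B.form (bracketMap 𝕜 E G))
  map_eq_zero_of_eq' := by
    intro v i j hij hne
    have key : ∀ a b, B.form a ⁅a, b⁆ = 0 := fun a b => by
      rw [← B.lie_invariant, lie_self]; simp
    have key' : ∀ a b, B.form a ⁅b, a⁆ = 0 := fun a b => by
      rw [← lie_skew, map_neg, key, neg_zero]
    fin_cases i <;> fin_cases j <;> simp_all

/-- The Cartan `3`-form on `G`. -/
def cartanForm (B : InvariantPairing 𝕜 E G) : FormField 𝕜 E G 3 :=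
  fun g => (cartanTensor B).compContinuousLinearMap (maurerCartan 𝕜 E g)

/-- `x ↦ x^∨`, the identification `T_g G ≅ T_g^* G` given by the invariant pairing. -/
def dualMap (B : InvariantPairing 𝕜 E G) (g : G) :
    TangentSpace 𝓘(𝕜, E) g →ₗ[𝕜] Cotangent 𝕜 E g :=
  (LinearMap.toContinuousLinearMap :
      (TangentSpace 𝓘(𝕜, E) g →ₗ[𝕜] 𝕜) ≃ₗ[𝕜] (TangentSpace 𝓘(𝕜, E) g →L[𝕜] 𝕜)).toLinearMap ∘ₗ
    B.form.compl₁₂ (maurerCartan 𝕜 E g).toLinearMap (maurerCartan 𝕜 E g).toLinearMap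

/-- `σ(ξ) = ½ (ξ^L + ξ^R)^∨` at `g`. -/
def sigma (B : InvariantPairing 𝕜 E G) (g : G) :
    GroupLieAlgebra 𝓘(𝕜, E) G →ₗ[𝕜] Cotangent 𝕜 E g :=
  (1 / 2 : 𝕜) • (dualMap B g ∘ₗ (leftVec 𝕜 E g + rightVec 𝕜 E g).toLinearMap)

/-- `ξ ↦ (ξ^L - ξ^R, σ(ξ))` at `g`. -/
def cartanDiracMap (B : InvariantPairing 𝕜 E G) (g : G) :
    GroupLieAlgebra 𝓘(𝕜, E) G →ₗ[𝕜] GenTangent 𝕜 E g :=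
  (leftVec 𝕜 E g - rightVec 𝕜 E g).toLinearMap.prod (sigma B g)

/-- The Cartan–Dirac structure `L_G = {(ξ^L - ξ^R, σ(ξ))}`. -/
def cartanDirac (B : InvariantPairing 𝕜 E G) (g : G) : Submodule 𝕜 (GenTangent 𝕜 E g) :=
  LinearMap.range (cartanDiracMap B g)

/-- The annihilator `𝔥^⊥` of a subalgebra. -/
def perp (B : InvariantPairing 𝕜 E G) (𝔥 : LieSubalgebra 𝕜 (GroupLieAlgebra 𝓘(𝕜, E) G)) :
    Submodule 𝕜 (GroupLieAlgebra 𝓘(𝕜, E) G) :=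
  B.form.orthogonal 𝔥.toSubmodule

/-- A Lie subalgebra is reducible if its annihilator is a Lie subalgebra. -/
def IsReducible (B : InvariantPairing 𝕜 E G)
    (𝔥 : LieSubalgebra 𝕜 (GroupLieAlgebra 𝓘(𝕜, E) G)) : Prop :=
  ∀ x ∈ perp B 𝔥, ∀ y ∈ perp B 𝔥, ⁅x, y⁆ ∈ perp B 𝔥

/-- The annihilator of a reducible subalgebra as a Lie subalgebra. -/
def perpLie (B : InvariantPairing 𝕜 E G) (𝔥 : LieSubalgebra 𝕜 (GroupLieAlgebra 𝓘(𝕜, E) G))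
    (hred : IsReducible B 𝔥) : LieSubalgebra 𝕜 (GroupLieAlgebra 𝓘(𝕜, E) G) :=
  { perp B 𝔥 with lie_mem' := fun {x y} hx hy => hred x hx y hy }

end Group

section Subgroups

variable {𝕜 : Type*} [RCLike 𝕜]
  {EG : Type*} [NormedAddCommGroup EG] [NormedSpace 𝕜 EG] [CompleteSpace EG]
  {G : Type*} [Group G] [TopologicalSpace G] [ChartedSpace EG G] [LieGroup 𝓘(𝕜, EG) ∞ G]
  {EH : Type*} [NormedAddCommGroup EH] [NormedSpace 𝕜 EH]
  {H : Type*} [Group H] [TopologicalSpace H] [ChartedSpace EH H]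
  {EQ : Type*} [NormedAddCommGroup EQ] [NormedSpace 𝕜 EQ]
  {Q : Type*} [Group Q] [TopologicalSpace Q] [ChartedSpace EQ Q]

/-- The Lie group `H` with `ι : H → G` is the connected Lie subgroup of `G` which
integrates the subalgebra `𝔨`. -/
structure IsIntegratingSubgroup (ι : H →* G)
    (𝔨 : LieSubalgebra 𝕜 (GroupLieAlgebra 𝓘(𝕜, EG) G)) : Prop where
  connected : ConnectedSpace H
  submanifold : IsSubmanifold 𝕜 EG EH ι
  range_lieMap : LinearMap.range (lieMap (E' := EH) 𝕜 EG ι).toLinearMap = 𝔨.toSubmodule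

variable (𝕜 EH EQ) in
/-- The Lie group `Q` with `φ : H → Q` is the quotient Lie group `H / N`. -/
structure IsQuotientLieGroup (φ : H →* Q) (N : Subgroup H) : Prop where
  smooth : ContMDiff 𝓘(𝕜, EH) 𝓘(𝕜, EQ) ∞ φ
  surjective : Function.Surjective φ
  submersion : ∀ h, Function.Surjective (mfderiv 𝓘(𝕜, EH) 𝓘(𝕜, EQ) φ h)
  ker_eq : φ.ker = N

end Subgroups

/-! ## Action Lie algebroids -/

section ActionAlgebroid

variable {𝕜 : Type*} [RCLike 𝕜]
  {EG : Type*} [NormedAddCommGroup EG] [NormedSpace 𝕜 EG] [CompleteSpace EG]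
  {G : Type*} [Group G] [TopologicalSpace G] [ChartedSpace EG G] [LieGroup 𝓘(𝕜, EG) ∞ G]
  {ES : Type*} [NormedAddCommGroup ES] [NormedSpace 𝕜 ES]
  {S : Type*} [TopologicalSpace S] [ChartedSpace ES S] [IsManifold 𝓘(𝕜, ES) ∞ S]
  {EX : Type*} [NormedAddCommGroup EX] [NormedSpace 𝕜 EX]
  {X : Type*} [TopologicalSpace X] [ChartedSpace EX X] [IsManifold 𝓘(𝕜, EX) ∞ X]

/-- `ρ` is a smooth action of the Lie algebra `𝔨` (a subalgebra of the Lie algebra of a Lie group)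
on the manifold `S`: a Lie algebra homomorphism from `𝔨` to the vector fields on `S`. -/
structure IsLieAlgebraAction (𝔨 : LieSubalgebra 𝕜 (GroupLieAlgebra 𝓘(𝕜, EG) G))
    (ρ : ∀ s : S, 𝔨 →ₗ[𝕜] TangentSpace 𝓘(𝕜, ES) s) : Prop where
  smooth : ∀ ξ : 𝔨, ContMDiff 𝓘(𝕜, ES) 𝓘(𝕜, ES).tangent ∞
    (fun s => (⟨s, ρ s ξ⟩ : TangentBundle 𝓘(𝕜, ES) S))
  map_lie : ∀ (ξ ζ : 𝔨) (s : S),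
    mlieBracket 𝓘(𝕜, ES) (fun t => ρ t ξ) (fun t => ρ t ζ) s = ρ s ⁅ξ, ζ⁆

/-- A `𝔨`-valued function on `S`, seen as a function with values in the model vector space of
the ambient Lie algebra. -/
def toModel {𝔨 : LieSubalgebra 𝕜 (GroupLieAlgebra 𝓘(𝕜, EG) G)} (f : S → 𝔨) : S → EG :=
  fun s => ((f s : GroupLieAlgebra 𝓘(𝕜, EG) G) : EG)

/-- The bracket `[f, g]_𝔨 + 𝓛_{ρ(f)} g - 𝓛_{ρ(g)} f` of sections of the action Lie
algebroid `S ⋊ 𝔨`, that is, of `𝔨`-valued functions on `S`. -/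
def actionBracket {𝔨 : LieSubalgebra 𝕜 (GroupLieAlgebra 𝓘(𝕜, EG) G)}
    (ρ : ∀ s : S, 𝔨 →ₗ[𝕜] TangentSpace 𝓘(𝕜, ES) s) (f g : S → 𝔨) (s : S) :
    GroupLieAlgebra 𝓘(𝕜, EG) G :=
  ((⁅f s, g s⁆ : 𝔨) : GroupLieAlgebra 𝓘(𝕜, EG) G)
    + (show GroupLieAlgebra 𝓘(𝕜, EG) G from
        mfderiv 𝓘(𝕜, ES) 𝓘(𝕜, EG) (toModel g) s (ρ s (f s)))
    - (show GroupLieAlgebra 𝓘(𝕜, EG) G from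
        mfderiv 𝓘(𝕜, ES) 𝓘(𝕜, EG) (toModel f) s (ρ s (g s)))

/-- The bundle map `e : S × 𝔨 → (TX ⊕ T^*X)|_S` is an isomorphism of Lie algebroids from the action
Lie algebroid `S ⋊ 𝔨` (with action `ρ`) onto `A ⊆ L|_S`. The anchor of `A` is the projection
to tangent vectors, and the bracket of `A` is induced by the `η`-twisted Dorfman bracket of
sections of `L` which restrict to sections of `A`. -/
structure IsActionAlgebroidIso
    (η : FormField 𝕜 EX X 3) (L : ∀ x : X, Submodule 𝕜 (GenTangent 𝕜 EX x)) (ι : S → X)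
    (A : ∀ s : S, Submodule 𝕜 (GenTangent 𝕜 EX (ι s)))
    (𝔨 : LieSubalgebra 𝕜 (GroupLieAlgebra 𝓘(𝕜, EG) G))
    (ρ : ∀ s : S, 𝔨 →ₗ[𝕜] TangentSpace 𝓘(𝕜, ES) s)
    (e : ∀ s : S, 𝔨 →ₗ[𝕜] GenTangent 𝕜 EX (ι s)) : Prop where
  injective : ∀ s, Function.Injective (e s)
  range_eq : ∀ s, LinearMap.range (e s) = A s
  /-- Constant sections of `S × 𝔨` are sent to (restrictions of) smooth sections of `L`. -/
  smooth : ∀ (ξ : 𝔨) (s₀ : S), ∃ (U : Set X) (V : Set S) (c : ∀ x : X, GenTangent 𝕜 EX x),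
    IsOpen U ∧ IsOpen V ∧ s₀ ∈ V ∧ Set.MapsTo ι V U ∧
    IsSmoothSectionOn c U ∧ (∀ x ∈ U, c x ∈ L x) ∧ ∀ s ∈ V, c (ι s) = e s ξ
  anchor : ∀ (s : S) (ξ : 𝔨), (e s ξ).1 = mfderiv 𝓘(𝕜, ES) 𝓘(𝕜, EX) ι s (ρ s ξ)
  bracket : ∀ (U : Set X) (V : Set S), IsOpen U → IsOpen V → Set.MapsTo ι V U →
    ∀ c₁ c₂ : ∀ x : X, GenTangent 𝕜 EX x, IsSmoothSectionOn c₁ U → IsSmoothSectionOn c₂ U →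
    (∀ x ∈ U, c₁ x ∈ L x) → (∀ x ∈ U, c₂ x ∈ L x) →
    ∀ f₁ f₂ : S → 𝔨, ContMDiffOn 𝓘(𝕜, ES) 𝓘(𝕜, EG) ∞ (toModel f₁) V →
    ContMDiffOn 𝓘(𝕜, ES) 𝓘(𝕜, EG) ∞ (toModel f₂) V →
    (∀ s ∈ V, c₁ (ι s) = e s (f₁ s)) → (∀ s ∈ V, c₂ (ι s) = e s (f₂ s)) →
    ∀ s ∈ V, ∃ ζ : 𝔨, (ζ : GroupLieAlgebra 𝓘(𝕜, EG) G) = actionBracket ρ f₁ f₂ s ∧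
      dorfman η c₁ c₂ (ι s) = e s ζ

end ActionAlgebroid

end CartanDirac

end

/-! Everything is read in the left trivialization. The Maurer–Cartan form identifies `T_g G` with
the Lie algebra `𝔤`, and the pairing then identifies `T_g^* G` with `𝔤` as well. Writing `A =
Ad_{g⁻¹}`, the element of `L_G` with parameter `ξ` becomes `(ξ - Aξ, ½(ξ + Aξ))`. The second entry
plus half the first returns `ξ`, so `L_G` is globally trivialized by `𝔤`. It is isotropic because
`A` is an isometry, and orthogonality to all of it forces this shape (`isLagrangian_cartanDirac`).

Two differential identities carry the calculus on `G`: the structure equation `dθ(u, w) = -[θu, θw]`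
(`fderiv_mcChart_sub`) and `d(Ad_{g⁻¹} x)(g·u) = -[u, Ad_{g⁻¹} x]` (`modelDeriv_adInv_apply`). They
turn the twisted Dorfman bracket of sections of `L_G` into the bracket `[f₁, f₂] + 𝓛 f₂ - 𝓛 f₁` of
their parameters (`dorfman_cartanDiracMap`). This gives the involutivity of `L_G` and, after
restriction to `H`, the bracket of the stabilizer subalgebroid.

The algebraic input is that invariance and reducibility give `[𝔥, 𝔥^⊥] ⊆ 𝔥`
(`lieBr_mem_modelSub_of_perp`). Since `H` is connected, `ξ - Ad_{h⁻¹} ξ` lies in `𝔥 ∩ 𝔥^⊥` for every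
`ξ ∈ 𝔥^⊥`. Hence `ξ^L - ξ^R` is tangent to `H` and is killed by `φ_*`, while `σ(ξ)` vanishes on
`TH`. Conversely, these conditions force `ξ ∈ 𝔥^⊥` (`mem_stabilizer_iff`). The pushed-forward
structure contains the Cartan–Dirac structure of the quotient by naturality, and equals it because
it is isotropic (`pushforward_eq_cartanDirac`).

The analytic input is that the kernel of `φ_*` at the identity is `𝔥 ∩ 𝔥^⊥`
(`modelDeriv_quotient_eq_zero_iff`), although `H^⊥` is only immersed. One inclusion is uniqueness of
integral curves. The other is a countability argument: a connected Lie group is separable, so it has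
no uncountable family of disjoint nonempty open sets. The form then descends to a nondegenerate one,
its radical on `𝔥` being exactly this kernel. -/

noncomputable section

namespace CartanDirac

open DiracGeometry Filter Topology

/-! ### Derivatives in preferred charts -/

section ChartCalculus

variable {𝕜 : Type*} [RCLike 𝕜]
  {E : Type*} [NormedAddCommGroup E] [NormedSpace 𝕜 E]
  {M : Type*} [TopologicalSpace M] [ChartedSpace E M]
  {E' : Type*} [NormedAddCommGroup E'] [NormedSpace 𝕜 E']
  {M' : Type*} [TopologicalSpace M'] [ChartedSpace E' M']
  {E'' : Type*} [NormedAddCommGroup E''] [NormedSpace 𝕜 E'']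
  {M'' : Type*} [TopologicalSpace M''] [ChartedSpace E'' M'']

variable (𝕜 E E') in
/-- The derivative of a map of manifolds, as a linear map of model spaces. -/
def modelDeriv (f : M → M') (x : M) : E →L[𝕜] E' := mfderiv 𝓘(𝕜, E) 𝓘(𝕜, E') f x

theorem modelDeriv_comp {g : M' → M''} {f : M → M'} {x : M}
    (hg : MDifferentiableAt 𝓘(𝕜, E') 𝓘(𝕜, E'') g (f x))
    (hf : MDifferentiableAt 𝓘(𝕜, E) 𝓘(𝕜, E') f x) :
    modelDeriv 𝕜 E E'' (fun z => g (f z)) x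
      = (modelDeriv 𝕜 E' E'' g (f x)).comp (modelDeriv 𝕜 E E' f x) :=
  mfderiv_comp x hg hf

theorem modelDeriv_comp_of_eq {g : M' → M''} {f : M → M'} {x : M} {y : M'}
    (hg : MDifferentiableAt 𝓘(𝕜, E') 𝓘(𝕜, E'') g y)
    (hf : MDifferentiableAt 𝓘(𝕜, E) 𝓘(𝕜, E') f x) (h : f x = y) :
    modelDeriv 𝕜 E E'' (fun z => g (f z)) x
      = (modelDeriv 𝕜 E' E'' g y).comp (modelDeriv 𝕜 E E' f x) := by
  subst h; exact modelDeriv_comp hg hf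

theorem modelDeriv_eq_fderiv (f : E → E') (x : E) : modelDeriv 𝕜 E E' f x = fderiv 𝕜 f x :=
  mfderiv_eq_fderiv

theorem modelDeriv_id (x : M) :
    modelDeriv 𝕜 E E (fun z : M => z) x = ContinuousLinearMap.id 𝕜 E :=
  mfderiv_id

theorem modelDeriv_const (c : M') (x : M) :
    modelDeriv 𝕜 E E' (fun _ : M => c) x = 0 :=
  mfderiv_const

theorem modelDeriv_congr {f g : M → M'} {x : M} (h : f =ᶠ[𝓝 x] g) :
    modelDeriv 𝕜 E E' f x = modelDeriv 𝕜 E E' g x := by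
  have h2 := h.mfderiv_eq (I := 𝓘(𝕜, E)) (I' := 𝓘(𝕜, E'))
  unfold modelDeriv
  exact h2

variable [IsManifold 𝓘(𝕜, E) ∞ M]

theorem contMDiffAt_chart {x₀ x : M} (hx : x ∈ (chartAt E x₀).source) :
    ContMDiffAt 𝓘(𝕜, E) 𝓘(𝕜, E) ∞ (chartAt E x₀) x :=
  (contMDiffOn_chart (I := 𝓘(𝕜, E)) (n := ∞)).contMDiffAt
    ((chartAt E x₀).open_source.mem_nhds hx)

theorem contMDiffAt_chart_symm {x₀ : M} {y : E} (hy : y ∈ (chartAt E x₀).target) :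
    ContMDiffAt 𝓘(𝕜, E) 𝓘(𝕜, E) ∞ (chartAt E x₀).symm y :=
  (contMDiffOn_chart_symm (I := 𝓘(𝕜, E)) (n := ∞)).contMDiffAt
    ((chartAt E x₀).open_target.mem_nhds hy)

theorem mdifferentiableAt_chart {x₀ x : M} (hx : x ∈ (chartAt E x₀).source) :
    MDifferentiableAt 𝓘(𝕜, E) 𝓘(𝕜, E) (chartAt E x₀) x :=
  (contMDiffAt_chart (𝕜 := 𝕜) hx).mdifferentiableAt (by simp)

theorem mdifferentiableAt_chart_symm {x₀ : M} {y : E} (hy : y ∈ (chartAt E x₀).target) :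
    MDifferentiableAt 𝓘(𝕜, E) 𝓘(𝕜, E) (chartAt E x₀).symm y :=
  (contMDiffAt_chart_symm (𝕜 := 𝕜) hy).mdifferentiableAt (by simp)

theorem modelDeriv_chart_comp_symm {x₀ : M} {y : E} (hy : y ∈ (chartAt E x₀).target) :
    (modelDeriv 𝕜 E E (chartAt E x₀) ((chartAt E x₀).symm y)).comp
      (modelDeriv 𝕜 E E (chartAt E x₀).symm y) = ContinuousLinearMap.id 𝕜 E := by
  rw [← modelDeriv_comp
    (mdifferentiableAt_chart ((chartAt E x₀).map_target hy)) (mdifferentiableAt_chart_symm hy),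
    ← modelDeriv_id (M := E) y]
  refine modelDeriv_congr ?_
  filter_upwards [(chartAt E x₀).open_target.mem_nhds hy] with z hz
  exact (chartAt E x₀).right_inv hz

theorem modelDeriv_symm_comp_chart {x₀ x : M} (hx : x ∈ (chartAt E x₀).source) :
    (modelDeriv 𝕜 E E (chartAt E x₀).symm (chartAt E x₀ x)).comp
      (modelDeriv 𝕜 E E (chartAt E x₀) x) = ContinuousLinearMap.id 𝕜 E := by
  rw [← modelDeriv_comp
    (mdifferentiableAt_chart_symm ((chartAt E x₀).map_source hx)) (mdifferentiableAt_chart hx),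
    ← modelDeriv_id (M := M) x]
  refine modelDeriv_congr ?_
  filter_upwards [(chartAt E x₀).open_source.mem_nhds hx] with z hz
  exact (chartAt E x₀).left_inv hz

/-- The tangent space at `x` is the model space as seen by the preferred chart at `x`, so the change
of coordinates from this chart to itself is trivial. Computing each quantity at the centre of its
own chart therefore costs no correction factor. -/
theorem modelDeriv_chart_self (x : M) :
    modelDeriv 𝕜 E E (chartAt E x) x = ContinuousLinearMap.id 𝕜 E := by
  have := IsManifold.of_le (I := 𝓘(𝕜, E)) (M := M) (n := ∞) (m := 1) (by simp)
  ext v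
  have h := mfderiv_chartAt_eq_tangentCoordChange (I := 𝓘(𝕜, E)) (mem_chart_source E x)
  have h2 := tangentCoordChange_self (I := 𝓘(𝕜, E)) (x := x) (z := x) (v := v) (by simp)
  unfold modelDeriv
  erw [h]
  exact h2

theorem modelDeriv_chart_symm_self (x : M) :
    modelDeriv 𝕜 E E (chartAt E x).symm (chartAt E x x) = ContinuousLinearMap.id 𝕜 E := by
  have h := modelDeriv_symm_comp_chart (𝕜 := 𝕜) (mem_chart_source E x)
  rwa [modelDeriv_chart_self, ContinuousLinearMap.comp_id] at h

theorem modelDeriv_comp_chart_symm {f : M → M'} {x₀ : M} {y : E}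
    (hy : y ∈ (chartAt E x₀).target)
    (hf : MDifferentiableAt 𝓘(𝕜, E) 𝓘(𝕜, E') f ((chartAt E x₀).symm y)) :
    modelDeriv 𝕜 E E' (fun z => f ((chartAt E x₀).symm z)) y
      = (modelDeriv 𝕜 E E' f ((chartAt E x₀).symm y)).comp
          (modelDeriv 𝕜 E E (chartAt E x₀).symm y) :=
  modelDeriv_comp hf (mdifferentiableAt_chart_symm hy)

theorem modelDeriv_eq_fderiv_chart {f : M → E'} {x : M}
    (hf : MDifferentiableAt 𝓘(𝕜, E) 𝓘(𝕜, E') f x) :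
    modelDeriv 𝕜 E E' f x = fderiv 𝕜 (fun z => f ((chartAt E x).symm z)) (chartAt E x x) := by
  have hx := mem_chart_source E x
  have hl := (chartAt E x).left_inv hx
  rw [← modelDeriv_eq_fderiv, modelDeriv_comp_chart_symm ((chartAt E x).map_source hx)
    (by rwa [hl]), modelDeriv_chart_symm_self, ContinuousLinearMap.comp_id, hl]

theorem contMDiffAt_of_contDiffAt_chart {f : M → E'} {x₀ x : M} {n : ℕ∞ω} (hn : n ≤ ∞)
    (hx : x ∈ (chartAt E x₀).source)
    (hf : ContDiffAt 𝕜 n (fun z => f ((chartAt E x₀).symm z)) (chartAt E x₀ x)) :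
    ContMDiffAt 𝓘(𝕜, E) 𝓘(𝕜, E') n f x := by
  have h := (contMDiffAt_iff_contDiffAt.2 hf).comp x ((contMDiffAt_chart (𝕜 := 𝕜) hx).of_le hn)
  refine h.congr_of_eventuallyEq ?_
  filter_upwards [(chartAt E x₀).open_source.mem_nhds hx] with z hz
  simp [(chartAt E x₀).left_inv hz]

theorem contDiffAt_comp_chart_symm {f : M → E'} {x₀ : M} {y : E} {n : ℕ∞ω} (hn : n ≤ ∞)
    (hy : y ∈ (chartAt E x₀).target)
    (hf : ContMDiffAt 𝓘(𝕜, E) 𝓘(𝕜, E') n f ((chartAt E x₀).symm y)) :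
    ContDiffAt 𝕜 n (fun z => f ((chartAt E x₀).symm z)) y :=
  contMDiffAt_iff_contDiffAt.1 (hf.comp y ((contMDiffAt_chart_symm (𝕜 := 𝕜) hy).of_le hn))

/-- A function on a connected manifold with vanishing derivative is constant. -/
theorem eq_of_modelDeriv_eq_zero [PreconnectedSpace M] {f : M → E'}
    (hf : MDifferentiable 𝓘(𝕜, E) 𝓘(𝕜, E') f) (h0 : ∀ x, modelDeriv 𝕜 E E' f x = 0)
    (x y : M) : f x = f y := by
  have hloc : IsLocallyConstant f := by
    rw [IsLocallyConstant.iff_eventually_eq]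
    intro x
    set c := chartAt E x
    have hcx : c x ∈ c.target := c.map_source (mem_chart_source E x)
    obtain ⟨r, hr, hball⟩ := Metric.isOpen_iff.1 c.open_target _ hcx
    -- Balls are preconnected by convexity, which needs real scalars.
    let _ : NormedSpace ℝ E := NormedSpace.restrictScalars ℝ 𝕜 E
    have key : ∀ z ∈ Metric.ball (c x) r, f (c.symm z) = f (c.symm (c x)) := by
      intro z hz
      refine (Metric.isOpen_ball.is_const_of_fderiv_eq_zero (𝕜 := 𝕜)
        (f := fun z => f (c.symm z)) (convex_ball (c x) r).isPreconnected ?_ ?_ hz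
        (Metric.mem_ball_self hr))
      · intro z hz
        exact (mdifferentiableAt_iff_differentiableAt.1
          ((hf _).comp z (mdifferentiableAt_chart_symm (hball hz)))).differentiableWithinAt
      · intro z hz
        have := modelDeriv_comp_chart_symm (𝕜 := 𝕜) (hball hz) (hf _)
        rw [h0, ContinuousLinearMap.zero_comp, modelDeriv_eq_fderiv] at this
        exact this
    have hnhds : c.source ∩ c ⁻¹' Metric.ball (c x) r ∈ 𝓝 x :=
      Filter.inter_mem (c.open_source.mem_nhds (mem_chart_source E x))
        ((c.continuousAt (mem_chart_source E x)).preimage_mem_nhds (Metric.ball_mem_nhds _ hr))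
    filter_upwards [hnhds] with z hz
    have := key _ hz.2
    rwa [c.left_inv hz.1, c.left_inv (mem_chart_source E x)] at this
  exact hloc.apply_eq_of_isPreconnected isPreconnected_univ trivial trivial

end ChartCalculus

/-! ### The Lie bracket of vector fields in a chart -/

section BracketInChart

variable {𝕜 : Type*} [RCLike 𝕜]
  {E : Type*} [NormedAddCommGroup E] [NormedSpace 𝕜 E]
  {M : Type*} [TopologicalSpace M] [ChartedSpace E M] [IsManifold 𝓘(𝕜, E) ∞ M]

variable (𝕜 E) in
/-- The expression of a vector field in the preferred chart at `x₀`. -/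
def chartField (V : M → E) (x₀ : M) (y : E) : E :=
  modelDeriv 𝕜 E E (chartAt E x₀) ((chartAt E x₀).symm y) (V ((chartAt E x₀).symm y))

variable (𝕜 E) in
/-- The Lie bracket of vector fields, with values in the model space. -/
def modelBracket (V W : M → E) (x : M) : E := mlieBracket 𝓘(𝕜, E) V W x

/-- The bracket on a manifold is defined by pulling the fields back along the inverse chart, that
is, by applying the inverse of its derivative. Near the centre this inverse is the derivative of the
chart, and the transport back to the manifold is the identity there. -/
theorem mlieBracket_eq_lieBracket_chartField (V W : ∀ x : M, TangentSpace 𝓘(𝕜, E) x) (x : M) :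
    (mlieBracket 𝓘(𝕜, E) V W x : E)
      = lieBracket 𝕜 (chartField 𝕜 E V x) (chartField 𝕜 E W x) (chartAt E x x) := by
  have key : ∀ V : ∀ x : M, TangentSpace 𝓘(𝕜, E) x,
      (mpullbackWithin 𝓘(𝕜, E) 𝓘(𝕜, E) (extChartAt 𝓘(𝕜, E) x).symm V (Set.range 𝓘(𝕜, E)) :
        E → E) =ᶠ[𝓝 (chartAt E x x)] chartField 𝕜 E V x := by
    intro V
    filter_upwards [(chartAt E x).open_target.mem_nhds
      ((chartAt E x).map_source (mem_chart_source E x))] with y hy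
    have h1 := modelDeriv_chart_comp_symm (𝕜 := 𝕜) hy
    have h2 := modelDeriv_symm_comp_chart (𝕜 := 𝕜) ((chartAt E x).map_target hy)
    rw [(chartAt E x).right_inv hy] at h2
    have h3 : (modelDeriv 𝕜 E E (chartAt E x).symm y).inverse
        = modelDeriv 𝕜 E E (chartAt E x) ((chartAt E x).symm y) :=
      ContinuousLinearMap.inverse_eq h2 h1
    simp only [mpullbackWithin_apply, modelWithCornersSelf_coe, Set.range_id, mfderivWithin_univ]
    exact DFunLike.congr_fun h3 _
  have h1 : (modelDeriv 𝕜 E E (chartAt E x) x).inverse = ContinuousLinearMap.id 𝕜 E := by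
    rw [modelDeriv_chart_self, ContinuousLinearMap.inverse_id]
  rw [← (key V).lieBracket_vectorField_eq (key W), ← mlieBracketWithin_univ,
    mlieBracketWithin_apply]
  refine (DFunLike.congr_fun h1 _).trans ?_
  have h2 : ∀ (A B : E → E) (s : Set E) (p : E), s = Set.univ →
      lieBracketWithin 𝕜 A B s p = lieBracket 𝕜 A B p := by
    rintro A B s p rfl
    rw [lieBracketWithin_univ]
  exact h2 _ _ _ _ (by simp)

theorem modelBracket_eq_lieBracket_chartField (V W : M → E) (x : M) :
    modelBracket 𝕜 E V W x
      = lieBracket 𝕜 (chartField 𝕜 E V x) (chartField 𝕜 E W x) (chartAt E x x) :=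
  mlieBracket_eq_lieBracket_chartField V W x

end BracketInChart

/-! ### Translations and the Maurer–Cartan form -/

section LieGroupCalculus

set_option linter.unusedSectionVars false

variable {𝕜 : Type*} [RCLike 𝕜]
  {E : Type*} [NormedAddCommGroup E] [NormedSpace 𝕜 E]
  {G : Type*} [Group G] [TopologicalSpace G] [ChartedSpace E G]

variable (𝕜 E) in
/-- Left translation `T_1 G → T_g G`. -/
def leftTrans (g : G) : E →L[𝕜] E := modelDeriv 𝕜 E E (fun x : G => g * x) 1

variable (𝕜 E) in
/-- Right translation `T_1 G → T_g G`. -/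
def rightTrans (g : G) : E →L[𝕜] E := modelDeriv 𝕜 E E (fun x : G => x * g) 1

variable (𝕜 E) in
/-- The left-invariant Maurer–Cartan form. -/
def mcForm (g : G) : E →L[𝕜] E := modelDeriv 𝕜 E E (fun x : G => g⁻¹ * x) g

variable (𝕜 E) in
/-- The adjoint action of `g⁻¹`. -/
def adInv (g : G) : E →L[𝕜] E := modelDeriv 𝕜 E E (fun x : G => g⁻¹ * (x * g)) 1

variable (𝕜 E) in
/-- The Maurer–Cartan form in the preferred chart at `x₀`. -/
def mcChart (x₀ : G) (y : E) : E →L[𝕜] E :=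
  (mcForm 𝕜 E ((chartAt E x₀).symm y)).comp (modelDeriv 𝕜 E E (chartAt E x₀).symm y)

variable [LieGroup 𝓘(𝕜, E) ∞ G]

theorem mdifferentiable_mul_left (g : G) :
    MDifferentiable 𝓘(𝕜, E) 𝓘(𝕜, E) (fun x : G => g * x) :=
  (contMDiff_mul_left (I := 𝓘(𝕜, E)) (n := ∞)).mdifferentiable (by simp)

theorem mdifferentiable_mul_right (g : G) :
    MDifferentiable 𝓘(𝕜, E) 𝓘(𝕜, E) (fun x : G => x * g) :=
  (contMDiff_mul_right (I := 𝓘(𝕜, E)) (n := ∞)).mdifferentiable (by simp)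

theorem modelDeriv_mul_left_comp_leftTrans (g h : G) :
    (modelDeriv 𝕜 E E (fun x : G => g * x) h).comp (leftTrans 𝕜 E h)
      = leftTrans 𝕜 E (g * h) := by
  rw [leftTrans, ← modelDeriv_comp_of_eq (mdifferentiable_mul_left g h)
    (mdifferentiable_mul_left h 1) (mul_one h), leftTrans]
  simp only [mul_assoc]

theorem leftTrans_one : leftTrans 𝕜 E (1 : G) = ContinuousLinearMap.id 𝕜 E := by
  simp only [leftTrans, one_mul, modelDeriv_id]

theorem mcForm_comp_leftTrans (g : G) :
    (mcForm 𝕜 E g).comp (leftTrans 𝕜 E g) = ContinuousLinearMap.id 𝕜 E := by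
  rw [mcForm, modelDeriv_mul_left_comp_leftTrans, inv_mul_cancel, leftTrans_one]

theorem leftTrans_comp_mcForm (g : G) :
    (leftTrans 𝕜 E g).comp (mcForm 𝕜 E g) = ContinuousLinearMap.id 𝕜 E := by
  rw [mcForm, leftTrans, ← modelDeriv_comp_of_eq (mdifferentiable_mul_left g 1)
    (mdifferentiable_mul_left g⁻¹ g) (inv_mul_cancel g)]
  simp only [mul_inv_cancel_left, modelDeriv_id]

@[simp] theorem mcForm_leftTrans (g : G) (x : E) :
    mcForm 𝕜 E g (leftTrans 𝕜 E g x) = x :=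
  DFunLike.congr_fun (mcForm_comp_leftTrans g) x

@[simp] theorem leftTrans_mcForm (g : G) (x : E) :
    leftTrans 𝕜 E g (mcForm 𝕜 E g x) = x :=
  DFunLike.congr_fun (leftTrans_comp_mcForm g) x

/-- Right-invariant fields enter the left trivialization only through `adInv`; this is why
`Ad_{g⁻¹}` rather than `Ad_g` is the basic operator below. -/
theorem mcForm_comp_rightTrans (g : G) :
    (mcForm 𝕜 E g).comp (rightTrans 𝕜 E g) = adInv 𝕜 E g := by
  rw [mcForm, rightTrans, ← modelDeriv_comp_of_eq (mdifferentiable_mul_left _ _)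
    (mdifferentiable_mul_right _ _) (one_mul g), adInv]

theorem rightTrans_apply (g : G) (x : E) :
    rightTrans 𝕜 E g x = leftTrans 𝕜 E g (adInv 𝕜 E g x) := by
  rw [← mcForm_comp_rightTrans, ContinuousLinearMap.comp_apply, leftTrans_mcForm]

theorem mdifferentiable_conj_inv (g : G) :
    MDifferentiable 𝓘(𝕜, E) 𝓘(𝕜, E) (fun x : G => g⁻¹ * (x * g)) :=
  (mdifferentiable_mul_left g⁻¹).comp (mdifferentiable_mul_right g)

theorem adInv_mul (g h : G) :
    adInv 𝕜 E (g * h) = (adInv 𝕜 E h).comp (adInv 𝕜 E g) := by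
  rw [adInv, adInv, adInv, ← modelDeriv_comp_of_eq (mdifferentiable_conj_inv h 1)
    (mdifferentiable_conj_inv g 1) (by simp)]
  simp only [mul_inv_rev, mul_assoc]

theorem adInv_one : adInv 𝕜 E (1 : G) = ContinuousLinearMap.id 𝕜 E := by
  simp only [adInv, inv_one, one_mul, mul_one, modelDeriv_id]

@[simp] theorem adInv_adInv_inv (g : G) (x : E) : adInv 𝕜 E g (adInv 𝕜 E g⁻¹ x) = x := by
  rw [← ContinuousLinearMap.comp_apply, ← adInv_mul, inv_mul_cancel, adInv_one]; rfl

theorem mcChart_self (x : G) : mcChart 𝕜 E x (chartAt E x x) = mcForm 𝕜 E x := by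
  rw [mcChart, modelDeriv_chart_symm_self, (chartAt E x).left_inv (mem_chart_source E x),
    ContinuousLinearMap.comp_id]

theorem mcChart_comp_chart_leftTrans {x₀ : G} {y : E} (hy : y ∈ (chartAt E x₀).target) :
    (mcChart 𝕜 E x₀ y).comp ((modelDeriv 𝕜 E E (chartAt E x₀) ((chartAt E x₀).symm y)).comp
      (leftTrans 𝕜 E ((chartAt E x₀).symm y))) = ContinuousLinearMap.id 𝕜 E := by
  have h2 := modelDeriv_symm_comp_chart (𝕜 := 𝕜) ((chartAt E x₀).map_target hy)
  rw [(chartAt E x₀).right_inv hy] at h2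
  ext v
  have := DFunLike.congr_fun h2 (leftTrans 𝕜 E ((chartAt E x₀).symm y) v)
  simp only [ContinuousLinearMap.comp_apply, ContinuousLinearMap.id_apply] at this
  simp [mcChart, this]

theorem chart_leftTrans_comp_mcChart {x₀ : G} {y : E} (hy : y ∈ (chartAt E x₀).target) :
    ((modelDeriv 𝕜 E E (chartAt E x₀) ((chartAt E x₀).symm y)).comp
      (leftTrans 𝕜 E ((chartAt E x₀).symm y))).comp (mcChart 𝕜 E x₀ y)
        = ContinuousLinearMap.id 𝕜 E := by
  ext v
  simpa [mcChart] using DFunLike.congr_fun (modelDeriv_chart_comp_symm (𝕜 := 𝕜) hy) v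

variable (𝕜 E) in
/-- The Maurer–Cartan form in the preferred chart at `x₀`, as an equivalence. -/
def mcChartEquiv (x₀ : G) {y : E} (hy : y ∈ (chartAt E x₀).target) : E ≃L[𝕜] E :=
  ContinuousLinearEquiv.equivOfInverse (mcChart 𝕜 E x₀ y)
    ((modelDeriv 𝕜 E E (chartAt E x₀) ((chartAt E x₀).symm y)).comp
      (leftTrans 𝕜 E ((chartAt E x₀).symm y)))
    (DFunLike.congr_fun (chart_leftTrans_comp_mcChart hy))
    (DFunLike.congr_fun (mcChart_comp_chart_leftTrans hy))

theorem inverse_mcChart {x₀ : G} {y : E} (hy : y ∈ (chartAt E x₀).target) :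
    (mcChart 𝕜 E x₀ y).inverse
      = (modelDeriv 𝕜 E E (chartAt E x₀) ((chartAt E x₀).symm y)).comp
      (leftTrans 𝕜 E ((chartAt E x₀).symm y)) :=
  ContinuousLinearMap.inverse_eq (mcChart_comp_chart_leftTrans hy)
    (chart_leftTrans_comp_mcChart hy)

theorem mcChart_chartField {x₀ : G} {y : E} (hy : y ∈ (chartAt E x₀).target)
    (V : G → E) :
    mcChart 𝕜 E x₀ y (chartField 𝕜 E V x₀ y)
      = mcForm 𝕜 E ((chartAt E x₀).symm y) (V ((chartAt E x₀).symm y)) := by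
  have h := DFunLike.congr_fun (mcChart_comp_chart_leftTrans (𝕜 := 𝕜) hy)
    (mcForm 𝕜 E ((chartAt E x₀).symm y) (V ((chartAt E x₀).symm y)))
  simp only [ContinuousLinearMap.comp_apply, leftTrans_mcForm, ContinuousLinearMap.id_apply] at h
  exact h

theorem chartField_eq {x₀ : G} {y : E} (hy : y ∈ (chartAt E x₀).target)
    (V : G → E) :
    chartField 𝕜 E V x₀ y = (mcChart 𝕜 E x₀ y).inverse
      (mcForm 𝕜 E ((chartAt E x₀).symm y) (V ((chartAt E x₀).symm y))) := by
  rw [inverse_mcChart hy]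
  simp [chartField]

/-- The Maurer–Cartan form becomes the derivative in `z`, on the diagonal `z = y`, of a function
that is jointly smooth in `y` and `z`. Its smooth dependence on the base point is read from this
form. -/
theorem mcChart_eq_fderiv {x₀ : G} {y : E} (hy : y ∈ (chartAt E x₀).target) :
    mcChart 𝕜 E x₀ y = fderiv 𝕜 (fun z => chartAt E (1 : G)
      (((chartAt E x₀).symm y)⁻¹ * (chartAt E x₀).symm z)) y := by
  set g := (chartAt E x₀).symm y
  have h1 : MDifferentiableAt 𝓘(𝕜, E) 𝓘(𝕜, E) (fun x : G => g⁻¹ * x) g :=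
    mdifferentiable_mul_left _ _
  have h2 : MDifferentiableAt 𝓘(𝕜, E) 𝓘(𝕜, E) (fun z => g⁻¹ * (chartAt E x₀).symm z) y :=
    MDifferentiableAt.comp y h1 (mdifferentiableAt_chart_symm hy)
  rw [← modelDeriv_eq_fderiv, modelDeriv_comp_of_eq
    (mdifferentiableAt_chart (mem_chart_source E (1 : G))) h2 (inv_mul_cancel g),
    modelDeriv_chart_self, ContinuousLinearMap.id_comp]
  exact (modelDeriv_comp h1 (mdifferentiableAt_chart_symm hy)).symm

theorem contDiffAt_mcChart {x₀ : G} {y : E} (hy : y ∈ (chartAt E x₀).target) :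
    ContDiffAt 𝕜 ∞ (mcChart 𝕜 E x₀) y := by
  have hF : ContDiffAt 𝕜 ∞ (Function.uncurry fun y z : E => chartAt E (1 : G)
      (((chartAt E x₀).symm y)⁻¹ * (chartAt E x₀).symm z)) (y, y) := by
    rw [← contMDiffAt_iff_contDiffAt]
    have hs := contMDiffAt_chart_symm (𝕜 := 𝕜) hy
    have h1 : ContMDiffAt 𝓘(𝕜, E × E) 𝓘(𝕜, E) ∞
        (fun p : E × E => (chartAt E x₀).symm p.1) (y, y) :=
      ContMDiffAt.comp (y, y) (g := (chartAt E x₀).symm) hs contDiffAt_fst.contMDiffAt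
    have h2 : ContMDiffAt 𝓘(𝕜, E × E) 𝓘(𝕜, E) ∞
        (fun p : E × E => (chartAt E x₀).symm p.2) (y, y) :=
      ContMDiffAt.comp (y, y) (g := (chartAt E x₀).symm) hs contDiffAt_snd.contMDiffAt
    refine ContMDiffAt.comp (y, y) (g := chartAt E (1 : G)) ?_ (h1.inv.mul h2)
    refine contMDiffAt_chart ?_
    simp
  refine (hF.fderiv (n := ∞) contDiffAt_id (by simp)).congr_of_eventuallyEq ?_
  filter_upwards [(chartAt E x₀).open_target.mem_nhds hy] with z hz
  exact mcChart_eq_fderiv hz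

end LieGroupCalculus

/-! ### The structure equation -/

section LieBracketCalculus

set_option linter.unusedSectionVars false

variable {𝕜 : Type*} [RCLike 𝕜]
  {E : Type*} [NormedAddCommGroup E] [NormedSpace 𝕜 E] [FiniteDimensional 𝕜 E] [CompleteSpace E]
  {G : Type*} [Group G] [TopologicalSpace G] [ChartedSpace E G] [LieGroup 𝓘(𝕜, E) ∞ G]

variable (𝕜 E G) in
/-- The bracket of the Lie algebra of `G`, on the model space. -/
def lieBr : E →L[𝕜] E →L[𝕜] E :=
  LinearMap.toContinuousBilinearMap (bracketMap 𝕜 E G : E →ₗ[𝕜] E →ₗ[𝕜] E)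

theorem lieBr_skew (x y : E) : lieBr 𝕜 E G x y = -lieBr 𝕜 E G y x :=
  (lie_skew (L := GroupLieAlgebra 𝓘(𝕜, E) G) x y).symm

theorem lieBr_jacobi (x y z : E) : lieBr 𝕜 E G x (lieBr 𝕜 E G y z)
    = lieBr 𝕜 E G (lieBr 𝕜 E G x y) z + lieBr 𝕜 E G y (lieBr 𝕜 E G x z) :=
  leibniz_lie (L₁ := GroupLieAlgebra 𝓘(𝕜, E) G) (L₂ := GroupLieAlgebra 𝓘(𝕜, E) G)
    (M := GroupLieAlgebra 𝓘(𝕜, E) G) x y z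

/-- The bracket of the Lie algebra is by definition that of left-invariant fields. All signs below
go back to this identity. -/
theorem modelBracket_leftTrans (x y : E) (g : G) :
    modelBracket 𝕜 E (fun h : G => leftTrans 𝕜 E h x) (fun h : G => leftTrans 𝕜 E h y) g
      = leftTrans 𝕜 E g (lieBr 𝕜 E G x y) :=
  (congr_fun (mulInvariantVector_mlieBracket (I := 𝓘(𝕜, E)) (G := G)
    (x : GroupLieAlgebra 𝓘(𝕜, E) G) y) g).symm

theorem contDiffAt_inverse_mcChart {x₀ : G} {y : E} (hy : y ∈ (chartAt E x₀).target) :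
    ContDiffAt 𝕜 ∞ (fun z => (mcChart 𝕜 E x₀ z).inverse) y := by
  have h : ContDiffAt 𝕜 ∞ (ContinuousLinearMap.inverse : (E →L[𝕜] E) → (E →L[𝕜] E))
      (mcChart 𝕜 E x₀ y) := contDiffAt_map_inverse (mcChartEquiv 𝕜 E x₀ hy)
  exact h.comp y (contDiffAt_mcChart hy)

theorem inverse_mcChart_self (x : G) :
    (mcChart 𝕜 E x (chartAt E x x)).inverse = leftTrans 𝕜 E x := by
  rw [mcChart_self]
  exact ContinuousLinearMap.inverse_eq (mcForm_comp_leftTrans x) (leftTrans_comp_mcForm x)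

/-- The Lie bracket of vector fields, in terms of their left trivializations. -/
theorem lieBracket_chartField_eq {V W : G → E} {x : G}
    (hV : MDifferentiableAt 𝓘(𝕜, E) 𝓘(𝕜, E) (fun g => mcForm 𝕜 E g (V g)) x)
    (hW : MDifferentiableAt 𝓘(𝕜, E) 𝓘(𝕜, E) (fun g => mcForm 𝕜 E g (W g)) x) :
    lieBracket 𝕜 (chartField 𝕜 E V x) (chartField 𝕜 E W x) (chartAt E x x)
      = fderiv 𝕜 (fun z => (mcChart 𝕜 E x z).inverse) (chartAt E x x) (V x) (mcForm 𝕜 E x (W x))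
        - fderiv 𝕜 (fun z => (mcChart 𝕜 E x z).inverse) (chartAt E x x) (W x)
            (mcForm 𝕜 E x (V x))
        + leftTrans 𝕜 E x (modelDeriv 𝕜 E E (fun g => mcForm 𝕜 E g (W g)) x (V x)
        - modelDeriv 𝕜 E E (fun g => mcForm 𝕜 E g (V g)) x (W x)) := by
  have hx := (chartAt E x).map_source (mem_chart_source E x)
  have hl := (chartAt E x).left_inv (mem_chart_source E x)
  have hN := ((contDiffAt_inverse_mcChart (𝕜 := 𝕜) hx).differentiableAt (by simp)).hasFDerivAt
  have key : ∀ V : G → E, MDifferentiableAt 𝓘(𝕜, E) 𝓘(𝕜, E) (fun g => mcForm 𝕜 E g (V g)) x →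
      (∀ u, fderiv 𝕜 (chartField 𝕜 E V x) (chartAt E x x) u
        = leftTrans 𝕜 E x (modelDeriv 𝕜 E E (fun g => mcForm 𝕜 E g (V g)) x u)
          + fderiv 𝕜 (fun z => (mcChart 𝕜 E x z).inverse) (chartAt E x x) u
            (mcForm 𝕜 E x (V x))) ∧ chartField 𝕜 E V x (chartAt E x x) = V x := by
    intro V hV
    -- Near the centre, the field is the left-invariant frame applied to its trivialization, so the
    -- product rule splits its derivative into a derivative of the frame and a derivative of the
    -- coefficients.
    have heq : chartField 𝕜 E V x =ᶠ[𝓝 (chartAt E x x)] fun y => (mcChart 𝕜 E x y).inverse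
        (mcForm 𝕜 E ((chartAt E x).symm y) (V ((chartAt E x).symm y))) := by
      filter_upwards [(chartAt E x).open_target.mem_nhds hx] with y hy
      exact chartField_eq hy V
    constructor
    · intro u
      have hV' : MDifferentiableAt 𝓘(𝕜, E) 𝓘(𝕜, E) (fun g => mcForm 𝕜 E g (V g))
        ((chartAt E x).symm (chartAt E x x)) := by rwa [hl]
      have ha := ((hV'.comp (chartAt E x x)
        (mdifferentiableAt_chart_symm hx)).differentiableAt).hasFDerivAt
      simp only [Function.comp_def] at ha
      rw [heq.fderiv_eq, (hN.clm_apply ha).fderiv, modelDeriv_eq_fderiv_chart hV,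
        inverse_mcChart_self, hl]
      rfl
    · rw [heq.eq_of_nhds, inverse_mcChart_self]
      simp [hl]
  obtain ⟨h1, h2⟩ := key V hV
  obtain ⟨h3, h4⟩ := key W hW
  rw [lieBracket, h1, h3, h2, h4, map_sub]
  abel

/-- Left-invariant fields have constant trivializations, so in the general formula for the bracket
only the derivatives of the frame survive. Comparison with the known bracket of left-invariant
fields evaluates their antisymmetrization. -/
theorem fderiv_inverse_mcChart_sub (x : G) (u w : E) :
    fderiv 𝕜 (fun z => (mcChart 𝕜 E x z).inverse) (chartAt E x x) (leftTrans 𝕜 E x u) w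
      - fderiv 𝕜 (fun z => (mcChart 𝕜 E x z).inverse) (chartAt E x x) (leftTrans 𝕜 E x w) u
      = leftTrans 𝕜 E x (lieBr 𝕜 E G u w) := by
  have hc : ∀ u : E, (fun g : G => mcForm 𝕜 E g (leftTrans 𝕜 E g u)) = fun _ => u := fun u => by
    ext g; simp
  have hd : ∀ u : E, MDifferentiableAt 𝓘(𝕜, E) 𝓘(𝕜, E)
      (fun g : G => mcForm 𝕜 E g (leftTrans 𝕜 E g u)) x := fun u => by
    rw [hc]; exact mdifferentiableAt_const
  have h := lieBracket_chartField_eq (hd u) (hd w)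
  rw [hc, hc, modelDeriv_const, modelDeriv_const] at h
  simp only [mcForm_leftTrans, zero_apply, sub_zero, map_zero, add_zero] at h
  rw [← h, ← modelBracket_leftTrans u w x]
  exact (modelBracket_eq_lieBracket_chartField _ _ x).symm

/-- The derivatives of the frame enter the bracket only antisymmetrized, hence through the Lie
bracket, and no trace of the chart is left. -/
theorem mcForm_modelBracket {V W : G → E} {x : G}
    (hV : MDifferentiableAt 𝓘(𝕜, E) 𝓘(𝕜, E) (fun g => mcForm 𝕜 E g (V g)) x)
    (hW : MDifferentiableAt 𝓘(𝕜, E) 𝓘(𝕜, E) (fun g => mcForm 𝕜 E g (W g)) x) :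
    mcForm 𝕜 E x (modelBracket 𝕜 E V W x)
      = lieBr 𝕜 E G (mcForm 𝕜 E x (V x)) (mcForm 𝕜 E x (W x))
        + modelDeriv 𝕜 E E (fun g => mcForm 𝕜 E g (W g)) x (V x)
        - modelDeriv 𝕜 E E (fun g => mcForm 𝕜 E g (V g)) x (W x) := by
  have h1 := (modelBracket_eq_lieBracket_chartField V W x).trans (lieBracket_chartField_eq hV hW)
  have h2 := fderiv_inverse_mcChart_sub (𝕜 := 𝕜) x (mcForm 𝕜 E x (V x)) (mcForm 𝕜 E x (W x))
  rw [leftTrans_mcForm, leftTrans_mcForm] at h2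
  rw [h2] at h1
  rw [h1, map_add, mcForm_leftTrans, mcForm_leftTrans]
  abel

/-- The Maurer–Cartan structure equation, in a chart. -/
theorem fderiv_mcChart_sub (x : G) (u w : E) :
    fderiv 𝕜 (mcChart 𝕜 E x) (chartAt E x x) u w - fderiv 𝕜 (mcChart 𝕜 E x) (chartAt E x x) w u
      = -lieBr 𝕜 E G (mcForm 𝕜 E x u) (mcForm 𝕜 E x w) := by
  have hx := (chartAt E x).map_source (mem_chart_source E x)
  have hN := ((contDiffAt_inverse_mcChart (𝕜 := 𝕜) hx).differentiableAt (by simp)).hasFDerivAt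
  have hM := ((contDiffAt_mcChart (𝕜 := 𝕜) hx).differentiableAt (by simp)).hasFDerivAt
  -- Differentiating `M N = 1`, with `N = M⁻¹`, gives `dM(u) = -M ∘ dN(u) ∘ M`, which transfers the
  -- antisymmetrized derivative of the frame to the coframe.
  have key : ∀ u w, fderiv 𝕜 (mcChart 𝕜 E x) (chartAt E x x) u w
      = -mcForm 𝕜 E x (fderiv 𝕜 (fun z => (mcChart 𝕜 E x z).inverse) (chartAt E x x) u
        (mcForm 𝕜 E x w)) := by
    intro u w
    have h1 := hM.clm_apply (hN.clm_apply (hasFDerivAt_const (mcForm 𝕜 E x w) (chartAt E x x)))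
    have h2 : (fun y => mcChart 𝕜 E x y ((mcChart 𝕜 E x y).inverse (mcForm 𝕜 E x w)))
        =ᶠ[𝓝 (chartAt E x x)] fun _ => mcForm 𝕜 E x w := by
      filter_upwards [(chartAt E x).open_target.mem_nhds hx] with y hy
      rw [inverse_mcChart hy]
      exact DFunLike.congr_fun (mcChart_comp_chart_leftTrans hy) _
    have h3 := DFunLike.congr_fun (h1.unique ((hasFDerivAt_const _ _).congr_of_eventuallyEq h2)) u
    rw [inverse_mcChart_self, mcChart_self] at h3
    simp only [ContinuousLinearMap.comp_zero, zero_add, add_apply, leftTrans_mcForm,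
      ContinuousLinearMap.comp_apply, ContinuousLinearMap.flip_apply, zero_apply] at h3
    exact (neg_eq_of_add_eq_zero_right h3).symm
  have h2 := fderiv_inverse_mcChart_sub (𝕜 := 𝕜) x (mcForm 𝕜 E x u) (mcForm 𝕜 E x w)
  rw [leftTrans_mcForm, leftTrans_mcForm] at h2
  have h3 := congr_arg (mcForm 𝕜 E x) h2
  rw [mcForm_leftTrans, map_sub] at h3
  rw [key, key, ← h3]
  abel

end LieBracketCalculus

/-! ### The adjoint action and its derivative -/

section AdjointCalculus

set_option linter.unusedSectionVars false

variable {𝕜 : Type*} [RCLike 𝕜]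
  {E : Type*} [NormedAddCommGroup E] [NormedSpace 𝕜 E]
  {G : Type*} [Group G] [TopologicalSpace G] [ChartedSpace E G] [LieGroup 𝓘(𝕜, E) ∞ G]

theorem adInv_eq_fderiv (g : G) :
    adInv 𝕜 E g = fderiv 𝕜 (fun z => chartAt E (1 : G)
      (g⁻¹ * ((chartAt E (1 : G)).symm z * g))) (chartAt E (1 : G) 1) := by
  have h1 := (chartAt E (1 : G)).map_source (mem_chart_source E (1 : G))
  have hl := (chartAt E (1 : G)).left_inv (mem_chart_source E (1 : G))
  have h2 : MDifferentiableAt 𝓘(𝕜, E) 𝓘(𝕜, E)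
      (fun z => g⁻¹ * ((chartAt E (1 : G)).symm z * g)) (chartAt E (1 : G) 1) :=
    (mdifferentiable_conj_inv g).mdifferentiableAt.comp _ (mdifferentiableAt_chart_symm h1)
  rw [← modelDeriv_eq_fderiv, modelDeriv_comp_of_eq
    (mdifferentiableAt_chart (mem_chart_source E (1 : G))) h2 (by simp [hl]),
    modelDeriv_chart_self, ContinuousLinearMap.id_comp]
  refine Eq.trans ?_ (modelDeriv_comp_of_eq (mdifferentiable_conj_inv g 1)
    (mdifferentiableAt_chart_symm h1) hl).symm
  rw [modelDeriv_chart_symm_self]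
  rfl

/-- Conjugation is jointly smooth in both arguments, and `adInv` is its derivative in the second one
at the identity, with values in a fixed chart. -/
theorem contMDiff_adInv : ContMDiff 𝓘(𝕜, E) 𝓘(𝕜, E →L[𝕜] E) ∞ (adInv 𝕜 E : G → E →L[𝕜] E) := by
  intro g
  have hg := (chartAt E g).map_source (mem_chart_source E g)
  have hgl := (chartAt E g).left_inv (mem_chart_source E g)
  have h1 := (chartAt E (1 : G)).map_source (mem_chart_source E (1 : G))
  have hl := (chartAt E (1 : G)).left_inv (mem_chart_source E (1 : G))
  refine contMDiffAt_of_contDiffAt_chart le_rfl (mem_chart_source E g) ?_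
  have hF : ContDiffAt 𝕜 ∞ (Function.uncurry fun y z : E => chartAt E (1 : G)
      (((chartAt E g).symm y)⁻¹ * ((chartAt E (1 : G)).symm z * (chartAt E g).symm y)))
      (chartAt E g g, chartAt E (1 : G) 1) := by
    rw [← contMDiffAt_iff_contDiffAt]
    have h1 : ContMDiffAt 𝓘(𝕜, E × E) 𝓘(𝕜, E) ∞
        (fun p : E × E => (chartAt E g).symm p.1) (chartAt E g g, chartAt E (1 : G) 1) :=
      ContMDiffAt.comp _ (g := (chartAt E g).symm) (contMDiffAt_chart_symm (𝕜 := 𝕜) hg)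
        contDiffAt_fst.contMDiffAt
    have h2 : ContMDiffAt 𝓘(𝕜, E × E) 𝓘(𝕜, E) ∞
        (fun p : E × E => (chartAt E (1 : G)).symm p.2) (chartAt E g g, chartAt E (1 : G) 1) :=
      ContMDiffAt.comp _ (g := (chartAt E (1 : G)).symm)
        (contMDiffAt_chart_symm (𝕜 := 𝕜) ‹_›) contDiffAt_snd.contMDiffAt
    refine ContMDiffAt.comp _ (g := chartAt E (1 : G)) ?_ (h1.inv.mul (h2.mul h1))
    refine contMDiffAt_chart ?_
    simp [hl]
  refine (hF.fderiv (n := ∞) contDiffAt_const (by simp)).congr_of_eventuallyEq ?_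
  exact Eventually.of_forall fun y => adInv_eq_fderiv _

theorem contMDiff_adInv_apply (x : E) :
    ContMDiff 𝓘(𝕜, E) 𝓘(𝕜, E) ∞ (fun g : G => adInv 𝕜 E g x) := fun g =>
  (contMDiff_adInv g).clm_apply contMDiffAt_const

theorem mdifferentiable_adInv_apply (x : E) :
    MDifferentiable 𝓘(𝕜, E) 𝓘(𝕜, E) (fun g : G => adInv 𝕜 E g x) :=
  (contMDiff_adInv_apply x).mdifferentiable (by simp)

variable [FiniteDimensional 𝕜 E] [CompleteSpace E]

/-- Let `m` be the multiplication in the chart at the identity and `N` the left-invariant frame. Its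
partial derivative in the second variable is left translation `N`, and in the first it is right
translation `N ∘ Ad⁻¹`. Differentiating both once more gives mixed second derivatives of `m`, and
their symmetry yields `d(Ad⁻¹ x)(u) = dN(x)u - dN(u)x = -[u, x]`. -/
theorem modelDeriv_adInv_apply_one (x u : E) :
    modelDeriv 𝕜 E E (fun g : G => adInv 𝕜 E g x) 1 u = -lieBr 𝕜 E G u x := by
  set c := chartAt E (1 : G)
  set e := c 1
  have he : e ∈ c.target := c.map_source (mem_chart_source E (1 : G))
  have hl : c.symm e = 1 := c.left_inv (mem_chart_source E (1 : G))
  set m : E × E → E := fun p => c (c.symm p.1 * c.symm p.2) with hm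
  have hm1 : ContDiffAt 𝕜 ∞ m (e, e) := by
    rw [← contMDiffAt_iff_contDiffAt]
    have h1 : ContMDiffAt 𝓘(𝕜, E × E) 𝓘(𝕜, E) ∞ (fun p : E × E => c.symm p.1) (e, e) :=
      ContMDiffAt.comp _ (g := c.symm) (contMDiffAt_chart_symm (𝕜 := 𝕜) he)
        contDiffAt_fst.contMDiffAt
    have h2 : ContMDiffAt 𝓘(𝕜, E × E) 𝓘(𝕜, E) ∞ (fun p : E × E => c.symm p.2) (e, e) :=
      ContMDiffAt.comp _ (g := c.symm) (contMDiffAt_chart_symm (𝕜 := 𝕜) he)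
        contDiffAt_snd.contMDiffAt
    refine ContMDiffAt.comp _ (g := c) ?_ (h1.mul h2)
    refine contMDiffAt_chart ?_
    simp [hl]
  have hsymm : IsSymmSndFDerivAt 𝕜 m (e, e) := hm1.isSymmSndFDerivAt (by
    rw [minSmoothness_of_isRCLikeNormedField]
    exact ENat.LEInfty.out)
  have hdm : ∀ᶠ p in 𝓝 (e, e), DifferentiableAt 𝕜 m p :=
    ((hm1.of_le (m := 1) (by simp)).eventually (by simp)).mono
      fun p hp => hp.differentiableAt (by simp)
  have hd2 : HasFDerivAt (fderiv 𝕜 m) (fderiv 𝕜 (fderiv 𝕜 m) (e, e)) (e, e) :=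
    ((hm1.fderiv_right (m := ∞) (by simp)).differentiableAt (by simp)).hasFDerivAt
  -- left and right translations in the chart
  set N : E → E →L[𝕜] E := fun y => (mcChart 𝕜 E (1 : G) y).inverse with hN
  have hNe : N e = ContinuousLinearMap.id 𝕜 E := (inverse_mcChart_self 1).trans leftTrans_one
  have hinl : Tendsto (fun y : E => (y, e)) (𝓝 e) (𝓝 (e, e)) :=
    (continuous_id.prodMk continuous_const).tendsto e
  have hinr : Tendsto (fun y : E => (e, y)) (𝓝 e) (𝓝 (e, e)) :=
    (continuous_const.prodMk continuous_id).tendsto e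
  have hnear : ∀ᶠ y in 𝓝 e, y ∈ c.target := c.open_target.mem_nhds he
  -- The map `z ↦ m (y, z)` is left translation by the point with coordinate `y`.
  have hNm : ∀ w, (fun y => N y w) =ᶠ[𝓝 e] fun y => fderiv 𝕜 m (y, e) (0, w) := by
    intro w
    filter_upwards [hnear, hinl.eventually hdm] with y hy hdy
    have h1 : fderiv 𝕜 (fun z => m (y, z)) e = (fderiv 𝕜 m (y, e)).comp (.inr 𝕜 E E) :=
      (HasFDerivAt.comp (g := m) (f := fun z => (y, z)) e hdy.hasFDerivAt
        (hasFDerivAt_prodMk_right y e)).fderiv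
    have h2 : MDifferentiableAt 𝓘(𝕜, E) 𝓘(𝕜, E) (fun z => c.symm y * c.symm z) e :=
      (mdifferentiable_mul_left (c.symm y)).mdifferentiableAt.comp _
        (mdifferentiableAt_chart_symm he)
    have h3 : N y w = fderiv 𝕜 (fun z => m (y, z)) e w := by
      rw [hN, ← modelDeriv_eq_fderiv, hm, modelDeriv_comp_of_eq (y := c.symm y)
        (mdifferentiableAt_chart (c.map_target hy)) h2 (by simp [hl]),
        modelDeriv_comp_of_eq (mdifferentiable_mul_left (c.symm y) 1)
        (mdifferentiableAt_chart_symm he) hl, modelDeriv_chart_symm_self,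
        ContinuousLinearMap.comp_id]
      exact DFunLike.congr_fun (inverse_mcChart hy) w
    rw [h3, h1]
    simp
  -- The map `z ↦ m (z, y)` is right translation, which is left translation preceded by the inverse
  -- adjoint action.
  have hRm : ∀ w, (fun y => N y (adInv 𝕜 E (c.symm y) w)) =ᶠ[𝓝 e]
      fun y => fderiv 𝕜 m (e, y) (w, 0) := by
    intro w
    filter_upwards [hnear, hinr.eventually hdm] with y hy hdy
    have h1 : fderiv 𝕜 (fun z => m (z, y)) e = (fderiv 𝕜 m (e, y)).comp (.inl 𝕜 E E) :=
      (HasFDerivAt.comp (g := m) (f := fun z => (z, y)) e hdy.hasFDerivAt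
        (hasFDerivAt_prodMk_left e y)).fderiv
    have h2 : MDifferentiableAt 𝓘(𝕜, E) 𝓘(𝕜, E) (fun z => c.symm z * c.symm y) e :=
      (mdifferentiable_mul_right (c.symm y)).mdifferentiableAt.comp _
        (mdifferentiableAt_chart_symm he)
    have h3 : N y (adInv 𝕜 E (c.symm y) w) = fderiv 𝕜 (fun z => m (z, y)) e w := by
      rw [hN, ← modelDeriv_eq_fderiv, hm, modelDeriv_comp_of_eq (y := c.symm y)
        (mdifferentiableAt_chart (c.map_target hy)) h2 (by simp [hl]),
        modelDeriv_comp_of_eq (mdifferentiable_mul_right (c.symm y) 1)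
        (mdifferentiableAt_chart_symm he) hl, modelDeriv_chart_symm_self,
        ContinuousLinearMap.comp_id]
      change (mcChart 𝕜 E (1 : G) y).inverse _ = _
      rw [inverse_mcChart hy, ContinuousLinearMap.comp_apply,
        ContinuousLinearMap.comp_apply, ← rightTrans_apply]
      rfl
    rw [h3, h1]
    simp
  have hdN : ∀ u w, fderiv 𝕜 N e u w = fderiv 𝕜 (fderiv 𝕜 m) (e, e) (u, 0) (0, w) := by
    intro u w
    have h1 := ((contDiffAt_inverse_mcChart (𝕜 := 𝕜) he).differentiableAt
      (by simp)).hasFDerivAt.clm_apply (hasFDerivAt_const w e)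
    have h2 := (HasFDerivAt.comp (g := fderiv 𝕜 m) (f := fun z => (z, e)) e hd2
      (hasFDerivAt_prodMk_left e e)).clm_apply (hasFDerivAt_const (0, w) e)
    have h3 := DFunLike.congr_fun (h1.unique (h2.congr_of_eventuallyEq (hNm w))) u
    simpa using h3
  have hA : HasFDerivAt (fun y => adInv 𝕜 E (c.symm y) x)
      (modelDeriv 𝕜 E E (fun g : G => adInv 𝕜 E g x) 1) e := by
    rw [modelDeriv_eq_fderiv_chart (mdifferentiable_adInv_apply x 1)]
    exact (((mdifferentiable_adInv_apply x).mdifferentiableAt.comp e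
      (mdifferentiableAt_chart_symm he)).differentiableAt).hasFDerivAt
  have hR : fderiv 𝕜 N e u x + modelDeriv 𝕜 E E (fun g : G => adInv 𝕜 E g x) 1 u
      = fderiv 𝕜 (fderiv 𝕜 m) (e, e) (0, u) (x, 0) := by
    have h1 := ((contDiffAt_inverse_mcChart (𝕜 := 𝕜) he).differentiableAt
      (by simp)).hasFDerivAt.clm_apply hA
    have h2 := (HasFDerivAt.comp (g := fderiv 𝕜 m) (f := fun z => (e, z)) e hd2
      (hasFDerivAt_prodMk_right e e)).clm_apply (hasFDerivAt_const (x, 0) e)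
    have h3 := DFunLike.congr_fun (h1.unique (h2.congr_of_eventuallyEq (hRm x))) u
    simp only [hl, adInv_one, add_apply, ContinuousLinearMap.comp_apply,
      ContinuousLinearMap.flip_apply, ContinuousLinearMap.id_apply] at h3
    rw [add_comm, ← ContinuousLinearMap.id_apply (R₁ := 𝕜) (modelDeriv 𝕜 E E _ 1 u), ← hNe]
    simpa using h3
  have hbr := fderiv_inverse_mcChart_sub (𝕜 := 𝕜) (1 : G) u x
  rw [leftTrans_one] at hbr
  simp only [ContinuousLinearMap.id_apply] at hbr
  change fderiv 𝕜 N e u x - fderiv 𝕜 N e x u = _ at hbr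
  -- Symmetry of the second derivative of `m` replaces the mixed term in `(0, u), (x, 0)` by the
  -- derivative of `N` along `x`.
  rw [hsymm.eq, ← hdN] at hR
  rw [← hbr, ← hR]
  abel

/-- The rule `Ad_{(gh)⁻¹} = Ad_{h⁻¹} ∘ Ad_{g⁻¹}` reduces the derivative at `g` to the one at the
identity, with `x` replaced by `Ad_{g⁻¹} x`. -/
theorem modelDeriv_adInv_apply (x u : E) (g : G) :
    modelDeriv 𝕜 E E (fun g : G => adInv 𝕜 E g x) g (leftTrans 𝕜 E g u)
      = -lieBr 𝕜 E G u (adInv 𝕜 E g x) := by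
  rw [← modelDeriv_adInv_apply_one, leftTrans, ← ContinuousLinearMap.comp_apply,
    ← modelDeriv_comp_of_eq (mdifferentiable_adInv_apply x g) (mdifferentiable_mul_left g 1)
      (mul_one g)]
  simp only [adInv_mul]
  rfl

section Hom

variable {E' : Type*} [NormedAddCommGroup E'] [NormedSpace 𝕜 E']
  {G' : Type*} [Group G'] [TopologicalSpace G'] [ChartedSpace E' G'] [LieGroup 𝓘(𝕜, E') ∞ G']
  [FiniteDimensional 𝕜 E'] [CompleteSpace E']

theorem modelDeriv_hom_leftTrans {f : G' →* G}
    (hf : MDifferentiable 𝓘(𝕜, E') 𝓘(𝕜, E) f) (h : G') (x : E') :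
    modelDeriv 𝕜 E' E f h (leftTrans 𝕜 E' h x)
      = leftTrans 𝕜 E (f h) (modelDeriv 𝕜 E' E f 1 x) := by
  rw [leftTrans, leftTrans, ← ContinuousLinearMap.comp_apply, ← ContinuousLinearMap.comp_apply,
    ← modelDeriv_comp_of_eq (hf h) (mdifferentiable_mul_left h 1) (mul_one h),
    ← modelDeriv_comp_of_eq (mdifferentiable_mul_left (f h) 1) (hf 1) (map_one f)]
  simp only [map_mul]

theorem mcForm_modelDeriv_hom {f : G' →* G}
    (hf : MDifferentiable 𝓘(𝕜, E') 𝓘(𝕜, E) f) (h : G') (v : E') :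
    mcForm 𝕜 E (f h) (modelDeriv 𝕜 E' E f h v)
      = modelDeriv 𝕜 E' E f 1 (mcForm 𝕜 E' h v) := by
  rw [← leftTrans_mcForm (𝕜 := 𝕜) h v, modelDeriv_hom_leftTrans hf, mcForm_leftTrans,
    mcForm_leftTrans]

theorem modelDeriv_hom_adInv {f : G' →* G}
    (hf : MDifferentiable 𝓘(𝕜, E') 𝓘(𝕜, E) f) (h : G') (x : E') :
    modelDeriv 𝕜 E' E f 1 (adInv 𝕜 E' h x) = adInv 𝕜 E (f h) (modelDeriv 𝕜 E' E f 1 x) := by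
  rw [adInv, adInv, ← ContinuousLinearMap.comp_apply, ← ContinuousLinearMap.comp_apply,
    ← modelDeriv_comp_of_eq (hf 1) (mdifferentiable_conj_inv h 1) (by simp),
    ← modelDeriv_comp_of_eq (mdifferentiable_conj_inv (f h) 1) (hf 1) (map_one f)]
  simp only [map_mul, map_inv]

/-- A homomorphism intertwines the adjoint actions. The bracket is minus the derivative of `adInv`,
so differentiating this relation at the identity gives compatibility with brackets. -/
theorem modelDeriv_hom_lieBr {f : G' →* G}
    (hf : MDifferentiable 𝓘(𝕜, E') 𝓘(𝕜, E) f) (x y : E') :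
    modelDeriv 𝕜 E' E f 1 (lieBr 𝕜 E' G' x y)
      = lieBr 𝕜 E G (modelDeriv 𝕜 E' E f 1 x) (modelDeriv 𝕜 E' E f 1 y) := by
  have h1 := modelDeriv_comp (𝕜 := 𝕜) (x := (1 : G'))
    (modelDeriv 𝕜 E' E f 1).differentiableAt.mdifferentiableAt
    (mdifferentiable_adInv_apply (G := G') y 1)
  have h2 := modelDeriv_comp_of_eq (𝕜 := 𝕜) (x := (1 : G'))
    (mdifferentiable_adInv_apply (G := G) (modelDeriv 𝕜 E' E f 1 y) 1) (hf 1) (map_one f)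
  simp only [modelDeriv_hom_adInv hf] at h1
  have h3 := DFunLike.congr_fun (h1.symm.trans h2) x
  rw [modelDeriv_eq_fderiv, ContinuousLinearMap.fderiv, ContinuousLinearMap.comp_apply,
    ContinuousLinearMap.comp_apply, modelDeriv_adInv_apply_one, modelDeriv_adInv_apply_one,
    map_neg] at h3
  exact neg_injective h3

end Hom

/-- Conjugation by `g⁻¹` is a group homomorphism whose derivative at the identity is `adInv`. -/
theorem adInv_lieBr (g : G) (x y : E) :
    adInv 𝕜 E g (lieBr 𝕜 E G x y) = lieBr 𝕜 E G (adInv 𝕜 E g x) (adInv 𝕜 E g y) := by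
  have h : (MulAut.conj g⁻¹ : G → G) = fun x => g⁻¹ * (x * g) := by
    ext x; simp [mul_assoc]
  have hf : MDifferentiable 𝓘(𝕜, E) 𝓘(𝕜, E) ((MulAut.conj g⁻¹).toMonoidHom : G → G) := by
    change MDifferentiable 𝓘(𝕜, E) 𝓘(𝕜, E) (MulAut.conj g⁻¹ : G → G)
    rw [h]
    exact mdifferentiable_conj_inv g
  have key := modelDeriv_hom_lieBr hf x y
  change modelDeriv 𝕜 E E (MulAut.conj g⁻¹ : G → G) 1 _ = lieBr 𝕜 E G
    (modelDeriv 𝕜 E E (MulAut.conj g⁻¹ : G → G) 1 _)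
    (modelDeriv 𝕜 E E (MulAut.conj g⁻¹ : G → G) 1 _) at key
  rwa [h] at key

end AdjointCalculus

/-! ### The invariant pairing on the model space -/

section Pairing

set_option linter.unusedSectionVars false

variable {𝕜 : Type*} [RCLike 𝕜]
  {E : Type*} [NormedAddCommGroup E] [NormedSpace 𝕜 E] [FiniteDimensional 𝕜 E] [CompleteSpace E]
  {G : Type*} [Group G] [TopologicalSpace G] [ChartedSpace E G] [LieGroup 𝓘(𝕜, E) ∞ G]

/-- The invariant pairing as a continuous bilinear form on the model space. -/
def pairForm (B : InvariantPairing 𝕜 E G) : E →L[𝕜] E →L[𝕜] 𝕜 :=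
  LinearMap.toContinuousBilinearMap (B.form : E →ₗ[𝕜] E →ₗ[𝕜] 𝕜)

variable (B : InvariantPairing 𝕜 E G)

theorem pairForm_symm (x y : E) : pairForm B x y = pairForm B y x := B.symm x y

theorem pairForm_lieBr (x y z : E) :
    pairForm B (lieBr 𝕜 E G x y) z = pairForm B x (lieBr 𝕜 E G y z) :=
  B.lie_invariant x y z

theorem Ad_eq_adInv_inv (g : G) : (Ad 𝕜 E g : E →L[𝕜] E) = adInv 𝕜 E g⁻¹ := by
  have h1 : (fun x : G => g * x * g⁻¹) = fun x => g⁻¹⁻¹ * (x * g⁻¹) := by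
    simp only [inv_inv, mul_assoc]
  rw [Ad, h1]
  rfl

theorem pairForm_adInv (g : G) (x y : E) :
    pairForm B (adInv 𝕜 E g x) (adInv 𝕜 E g y) = pairForm B x y := by
  have h := Ad_eq_adInv_inv (𝕜 := 𝕜) (E := E) g⁻¹
  rw [inv_inv] at h
  rw [← h]
  exact B.Ad_invariant g⁻¹ x y

theorem pairForm_injective : Function.Injective (pairForm B) := by
  rw [injective_iff_map_eq_zero]
  intro x hx
  exact B.nondegenerate.1 x fun y => DFunLike.congr_fun hx y

theorem ext_pairForm {x y : E} (h : ∀ z, pairForm B x z = pairForm B y z) : x = y :=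
  pairForm_injective B (ContinuousLinearMap.ext h)

/-- The identification of the Lie algebra with its dual. -/
def pairEquiv : E ≃L[𝕜] (E →L[𝕜] 𝕜) :=
  (LinearEquiv.ofBijective (pairForm B).toLinearMap ⟨pairForm_injective B, by
    have hd : Module.finrank 𝕜 (E →L[𝕜] 𝕜) = Module.finrank 𝕜 E := by
      rw [← (LinearMap.toContinuousLinearMap : (E →ₗ[𝕜] 𝕜) ≃ₗ[𝕜] (E →L[𝕜] 𝕜)).finrank_eq]
      exact Subspace.dual_finrank_eq
    exact (LinearMap.injective_iff_surjective_of_finrank_eq_finrank hd.symm).1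
      (pairForm_injective B)⟩).toContinuousLinearEquiv

theorem pairEquiv_apply (x : E) : pairEquiv B x = pairForm B x := rfl

@[simp] theorem pairForm_pairEquiv_symm (α : E →L[𝕜] 𝕜) :
    pairForm B ((pairEquiv B).symm α) = α :=
  (pairEquiv B).apply_symm_apply α

/-- The Cartan tensor `(x, [y, z])`. -/
def triForm (x y z : E) : 𝕜 := pairForm B x (lieBr 𝕜 E G y z)

theorem triForm_cyclic (x y z : E) : triForm B x y z = triForm B y z x := by
  rw [triForm, triForm, pairForm_symm, pairForm_lieBr]

theorem triForm_swap (x y z : E) : triForm B x y z = -triForm B x z y := by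
  rw [triForm, triForm, lieBr_skew, map_neg]

end Pairing

/-! ### Smooth functions and vector fields in charts -/

section SmoothSections

set_option linter.unusedSectionVars false

variable {𝕜 : Type*} [RCLike 𝕜]
  {E : Type*} [NormedAddCommGroup E] [NormedSpace 𝕜 E]
  {M : Type*} [TopologicalSpace M] [ChartedSpace E M] [IsManifold 𝓘(𝕜, E) ∞ M]

theorem contMDiffAt_iff_chart {F : Type*} [NormedAddCommGroup F] [NormedSpace 𝕜 F]
    {f : M → F} {x : M} : ContMDiffAt 𝓘(𝕜, E) 𝓘(𝕜, F) ∞ f x ↔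
      ContDiffAt 𝕜 ∞ (fun z => f ((chartAt E x).symm z)) (chartAt E x x) := by
  refine ⟨fun h => contDiffAt_comp_chart_symm le_rfl ((chartAt E x).map_source
    (mem_chart_source E x)) ?_, contMDiffAt_of_contDiffAt_chart le_rfl (mem_chart_source E x)⟩
  rwa [(chartAt E x).left_inv (mem_chart_source E x)]

theorem contMDiffAt_vectorField_iff {v : ∀ x : M, TangentSpace 𝓘(𝕜, E) x} {x : M} :
    ContMDiffAt 𝓘(𝕜, E) 𝓘(𝕜, E).tangent ∞ (fun x => (⟨x, v x⟩ : TangentBundle 𝓘(𝕜, E) M)) x ↔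
      ContDiffAt 𝕜 ∞ (chartField 𝕜 E v x) (chartAt E x x) := by
  have h1 := IsManifold.of_le (I := 𝓘(𝕜, E)) (M := M) (n := ∞) (m := 1) (by simp)
  have h2 := Bundle.contMDiffAt_section (IB := 𝓘(𝕜, E)) (n := ∞) (F := E) (s := v) x
  refine h2.trans ?_
  rw [contMDiffAt_iff_chart]
  suffices h : (fun z => (trivializationAt E (TangentSpace 𝓘(𝕜, E)) x
      ⟨(chartAt E x).symm z, v ((chartAt E x).symm z)⟩).2) =ᶠ[𝓝 (chartAt E x x)]
      chartField 𝕜 E v x from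
    ⟨fun h' => h'.congr_of_eventuallyEq h.symm, fun h' => h'.congr_of_eventuallyEq h⟩
  filter_upwards [(chartAt E x).open_target.mem_nhds
    ((chartAt E x).map_source (mem_chart_source E x))] with y hy
  have h3 := TangentBundle.continuousLinearMapAt_trivializationAt (I := 𝓘(𝕜, E))
    ((chartAt E x).map_target hy)
  have h4 := DFunLike.congr_fun h3 (v ((chartAt E x).symm y))
  refine Eq.trans ?_ h4
  rw [Bundle.Trivialization.continuousLinearMapAt_apply, Bundle.Trivialization.linearMapAt_apply,
    if_pos]
  simpa using (chartAt E x).map_target hy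

end SmoothSections

/-! ### Left trivialization of the generalized tangent bundle -/

section LeftTrivialization

set_option linter.unusedSectionVars false

variable {𝕜 : Type*} [RCLike 𝕜]
  {E : Type*} [NormedAddCommGroup E] [NormedSpace 𝕜 E] [FiniteDimensional 𝕜 E] [CompleteSpace E]
  {G : Type*} [Group G] [TopologicalSpace G] [ChartedSpace E G] [LieGroup 𝓘(𝕜, E) ∞ G]

theorem contMDiffAt_vectorField_iff_mcForm {v : ∀ x : G, TangentSpace 𝓘(𝕜, E) x} {g : G} :
    ContMDiffAt 𝓘(𝕜, E) 𝓘(𝕜, E).tangent ∞ (fun x => (⟨x, v x⟩ : TangentBundle 𝓘(𝕜, E) G)) g ↔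
      ContMDiffAt 𝓘(𝕜, E) 𝓘(𝕜, E) ∞ (fun x => mcForm 𝕜 E x (v x) : G → E) g := by
  have hx := (chartAt E g).map_source (mem_chart_source E g)
  rw [contMDiffAt_vectorField_iff, contMDiffAt_iff_chart]
  constructor <;> intro h
  · refine ((contDiffAt_mcChart hx).clm_apply h).congr_of_eventuallyEq ?_
    filter_upwards [(chartAt E g).open_target.mem_nhds hx] with y hy
    exact (mcChart_chartField hy v).symm
  · refine ((contDiffAt_inverse_mcChart hx).clm_apply h).congr_of_eventuallyEq ?_
    filter_upwards [(chartAt E g).open_target.mem_nhds hx] with y hy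
    exact chartField_eq hy v

variable (B : InvariantPairing 𝕜 E G)

/-- The left trivialization of a field of covectors, transported to the Lie algebra. -/
def dualTriv (g : G) (α : E →L[𝕜] 𝕜) : E := (pairEquiv B).symm (α.comp (leftTrans 𝕜 E g))

theorem pairForm_dualTriv (g : G) (α : E →L[𝕜] 𝕜) (v : E) :
    pairForm B (dualTriv B g α) v = α (leftTrans 𝕜 E g v) := by
  rw [dualTriv, pairForm_pairEquiv_symm]; rfl

theorem eq_pairForm_dualTriv (g : G) (α : E →L[𝕜] 𝕜) :
    α = (pairForm B (dualTriv B g α)).comp (mcForm 𝕜 E g) := by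
  ext v
  rw [ContinuousLinearMap.comp_apply, pairForm_dualTriv, leftTrans_mcForm]

theorem chartForm_oneForm_eq (α : ∀ x : G, Cotangent 𝕜 E x) (x₀ : G) (y : E) :
    chartForm (oneForm α) x₀ y =
      ContinuousAlternatingMap.ofSubsingletonLIE (𝕜 := 𝕜) (E := E) (F := 𝕜) (0 : Fin 1)
      ((pairForm B (dualTriv B ((chartAt E x₀).symm y) (α ((chartAt E x₀).symm y)))).comp
        (mcChart 𝕜 E x₀ y)) := by
  ext v
  have h := DFunLike.congr_fun (eq_pairForm_dualTriv B ((chartAt E x₀).symm y)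
    (α ((chartAt E x₀).symm y))) (modelDeriv 𝕜 E E (chartAt E x₀).symm y (v 0))
  exact h

/-- In the chart, a covector field is its trivialization composed with the coframe. The coframe and
its inverse are both smooth, so smoothness passes either way. -/
theorem contDiffAt_chartForm_oneForm_iff {α : ∀ x : G, Cotangent 𝕜 E x} {x₀ : G} {y : E}
    (hy : y ∈ (chartAt E x₀).target) :
    ContDiffAt 𝕜 ∞ (chartForm (oneForm α) x₀) y ↔
      ContMDiffAt 𝓘(𝕜, E) 𝓘(𝕜, E) ∞ (fun x => dualTriv B x (α x)) ((chartAt E x₀).symm y) := by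
  have h1 : chartForm (oneForm α) x₀ = fun y =>
    ContinuousAlternatingMap.ofSubsingletonLIE (𝕜 := 𝕜) (E := E) (F := 𝕜) (0 : Fin 1)
      ((pairForm B (dualTriv B ((chartAt E x₀).symm y) (α ((chartAt E x₀).symm y)))).comp
        (mcChart 𝕜 E x₀ y)) := funext fun y => chartForm_oneForm_eq B α x₀ y
  constructor <;> intro h
  · refine contMDiffAt_of_contDiffAt_chart le_rfl ((chartAt E x₀).map_target hy) ?_
    rw [(chartAt E x₀).right_inv hy]
    rw [h1] at h
    have h2 := ((pairEquiv B).symm.contDiff.contDiffAt).comp y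
      ((((ContinuousAlternatingMap.ofSubsingletonLIE (𝕜 := 𝕜) (E := E) (F := 𝕜)
        (0 : Fin 1)).symm.contDiff.contDiffAt
        ).comp y h).clm_comp (contDiffAt_inverse_mcChart hy))
    refine h2.congr_of_eventuallyEq ?_
    filter_upwards [(chartAt E x₀).open_target.mem_nhds hy] with z hz
    simp only [Function.comp_def, LinearIsometryEquiv.symm_apply_apply]
    rw [ContinuousLinearMap.comp_assoc, inverse_mcChart hz, mcChart_comp_chart_leftTrans hz,
      ContinuousLinearMap.comp_id, ← pairEquiv_apply, ContinuousLinearEquiv.symm_apply_apply]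
  · rw [h1]
    have h2 := contDiffAt_comp_chart_symm (𝕜 := 𝕜) le_rfl hy h
    exact ((ContinuousAlternatingMap.ofSubsingletonLIE (𝕜 := 𝕜) (E := E) (F := 𝕜)
      (0 : Fin 1)).contDiff.contDiffAt).comp y ((((pairForm B).contDiff.contDiffAt).comp y
        h2).clm_comp (contDiffAt_mcChart hy))

/-- From here on, a smooth section of the generalized tangent bundle is a pair of smooth functions
with values in the Lie algebra, and charts no longer intervene. -/
theorem isSmoothSectionOn_iff {e : ∀ x : G, GenTangent 𝕜 E x} {U : Set G} (hU : IsOpen U) :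
    IsSmoothSectionOn e U ↔
      ∀ g ∈ U, ContMDiffAt 𝓘(𝕜, E) 𝓘(𝕜, E) ∞ (fun x => mcForm 𝕜 E x (e x).1 : G → E) g ∧
        ContMDiffAt 𝓘(𝕜, E) 𝓘(𝕜, E) ∞ (fun x => dualTriv B x (e x).2) g := by
  have hopen : ∀ x₀ : G, IsOpen ((chartAt E x₀).target ∩ (chartAt E x₀).symm ⁻¹' U) :=
    fun x₀ => (chartAt E x₀).isOpen_inter_preimage_symm hU
  constructor
  · rintro ⟨h1, h2⟩ g hg
    refine ⟨contMDiffAt_vectorField_iff_mcForm.1 (h1.contMDiffAt (hU.mem_nhds hg)), ?_⟩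
    have hx := (chartAt E g).map_source (mem_chart_source E g)
    have hl := (chartAt E g).left_inv (mem_chart_source E g)
    have h3 := (contDiffAt_chartForm_oneForm_iff B hx).1 ((h2 g).contDiffAt
      ((hopen g).mem_nhds ⟨hx, by rwa [Set.mem_preimage, hl]⟩))
    rwa [hl] at h3
  · intro h
    refine ⟨fun g hg => (contMDiffAt_vectorField_iff_mcForm.2 (h g hg).1).contMDiffWithinAt,
      fun x₀ y hy => ?_⟩
    exact ((contDiffAt_chartForm_oneForm_iff B hy.1).2 (h _ hy.2).2).contDiffWithinAt

end LeftTrivialization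

/-! ### Exterior derivatives and closedness of the Cartan form -/

section ExteriorDerivative

set_option linter.unusedSectionVars false

variable {𝕜 : Type*} [RCLike 𝕜]
  {E : Type*} [NormedAddCommGroup E] [NormedSpace 𝕜 E]

section General

variable {M : Type*} [TopologicalSpace M] [ChartedSpace E M] [IsManifold 𝓘(𝕜, E) ∞ M]

theorem extDerivForm_apply {k : ℕ} {θ : FormField 𝕜 E M k} {x : M}
    (h : DifferentiableAt 𝕜 (chartForm θ x) (chartAt E x x)) (v : Fin (k + 1) → E) :
    extDerivForm θ x v = ∑ i, (-1) ^ i.val •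
      fderiv 𝕜 (fun y => chartForm θ x y (i.removeNth v)) (chartAt E x x) (v i) := by
  rw [← extDeriv_apply h]
  have h1 : extDerivForm θ x v
      = extDeriv (chartForm θ x) (chartAt E x x)
        (fun i => modelDeriv 𝕜 E E (chartAt E x) x (v i)) := rfl
  rw [h1, modelDeriv_chart_self]
  rfl

theorem extDerivForm_zero {k : ℕ} (x : M) :
    extDerivForm (0 : FormField 𝕜 E M k) x = 0 := by
  have h : chartForm (0 : FormField 𝕜 E M k) x = fun _ => 0 := by
    funext y
    ext v
    rfl
  refine ContinuousAlternatingMap.ext fun (v : Fin (k + 1) → E) => ?_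
  have hd : DifferentiableAt 𝕜 (chartForm (0 : FormField 𝕜 E M k) x) (chartAt E x x) := by
    rw [h]; exact differentiableAt_const _
  refine (extDerivForm_apply hd v).trans ?_
  rw [h]
  simp only [fderiv_const_apply, zero_apply, smul_zero, Finset.sum_const_zero]
  rfl

theorem extDerivForm_neg {k : ℕ} {θ : FormField 𝕜 E M k} {x : M}
    (h : DifferentiableAt 𝕜 (chartForm θ x) (chartAt E x x)) :
    extDerivForm (-θ) x = -extDerivForm θ x := by
  have h1 : chartForm (-θ) x = fun y => -chartForm θ x y := by
    funext y
    ext v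
    rfl
  have hd : DifferentiableAt 𝕜 (chartForm (-θ) x) (chartAt E x x) := by
    rw [h1]; exact h.neg
  refine ContinuousAlternatingMap.ext fun (v : Fin (k + 1) → E) => ?_
  refine (extDerivForm_apply hd v).trans ?_
  refine Eq.trans ?_ (congr_arg Neg.neg (extDerivForm_apply h v)).symm
  rw [h1, ← Finset.sum_neg_distrib]
  refine Finset.sum_congr rfl fun i _ => ?_
  simp only [ContinuousAlternatingMap.neg_apply, fderiv_fun_neg, neg_apply, smul_neg]

end General

variable [FiniteDimensional 𝕜 E] [CompleteSpace E]
  {G : Type*} [Group G] [TopologicalSpace G] [ChartedSpace E G] [LieGroup 𝓘(𝕜, E) ∞ G]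
  (B : InvariantPairing 𝕜 E G)

theorem hasFDerivAt_mcChart (g : G) : HasFDerivAt (mcChart 𝕜 E g)
    (fderiv 𝕜 (mcChart 𝕜 E g) (chartAt E g g)) (chartAt E g g) :=
  ((contDiffAt_mcChart ((chartAt E g).map_source (mem_chart_source E g))).differentiableAt
    (by simp)).hasFDerivAt

theorem hasFDerivAt_comp_chart_symm {F : Type*} [NormedAddCommGroup F] [NormedSpace 𝕜 F]
    {f : G → F} {g : G} (hf : MDifferentiableAt 𝓘(𝕜, E) 𝓘(𝕜, F) f g) :
    HasFDerivAt (fun y => f ((chartAt E g).symm y)) (modelDeriv 𝕜 E F f g) (chartAt E g g) := by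
  have hx := (chartAt E g).map_source (mem_chart_source E g)
  have hl := (chartAt E g).left_inv (mem_chart_source E g)
  rw [modelDeriv_eq_fderiv_chart hf]
  have hf' : MDifferentiableAt 𝓘(𝕜, E) 𝓘(𝕜, F) f ((chartAt E g).symm (chartAt E g g)) := by
    rwa [hl]
  exact ((hf'.comp (chartAt E g g) (mdifferentiableAt_chart_symm hx)).differentiableAt).hasFDerivAt

/-- The exterior derivative of a `1`-form in a left trivialization. -/
theorem extDerivForm_oneForm {α : ∀ x : G, Cotangent 𝕜 E x} {g : G}
    (hα : MDifferentiableAt 𝓘(𝕜, E) 𝓘(𝕜, E) (fun x => dualTriv B x (α x)) g) (u w : E) :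
    extDerivForm (oneForm α) g ![u, w]
      = pairForm B (modelDeriv 𝕜 E E (fun x => dualTriv B x (α x)) g u) (mcForm 𝕜 E g w)
        - pairForm B (modelDeriv 𝕜 E E (fun x => dualTriv B x (α x)) g w) (mcForm 𝕜 E g u)
        - triForm B (dualTriv B g (α g)) (mcForm 𝕜 E g u) (mcForm 𝕜 E g w) := by
  have hl := (chartAt E g).left_inv (mem_chart_source E g)
  have hb := hasFDerivAt_comp_chart_symm hα
  have hM := hasFDerivAt_mcChart (𝕜 := 𝕜) (E := E) g
  have heq : chartForm (oneForm α) g = fun y =>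
    ContinuousAlternatingMap.ofSubsingletonLIE (𝕜 := 𝕜) (E := E) (F := 𝕜) (0 : Fin 1)
      ((pairForm B (dualTriv B ((chartAt E g).symm y) (α ((chartAt E g).symm y)))).comp
        (mcChart 𝕜 E g y)) := funext fun y => chartForm_oneForm_eq B α g y
  have hpb := (pairForm B).hasFDerivAt.comp (chartAt E g g) hb
  have hd : DifferentiableAt 𝕜 (chartForm (oneForm α) g) (chartAt E g g) := by
    rw [heq]
    exact (ContinuousAlternatingMap.ofSubsingletonLIE (𝕜 := 𝕜) (E := E) (F := 𝕜)
      (0 : Fin 1)).differentiableAt.comp _ (hpb.clm_comp hM).differentiableAt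
  have key : ∀ u w : E, fderiv 𝕜 (fun y => chartForm (oneForm α) g y ![w]) (chartAt E g g) u
      = pairForm B (modelDeriv 𝕜 E E (fun x => dualTriv B x (α x)) g u) (mcForm 𝕜 E g w)
        + pairForm B (dualTriv B g (α g)) (fderiv 𝕜 (mcChart 𝕜 E g) (chartAt E g g) u w) := by
    intro u w
    have h1 := hpb.clm_apply (hM.clm_apply (hasFDerivAt_const w _))
    have h2 : (fun y => chartForm (oneForm α) g y ![w]) = fun y =>
        pairForm B (dualTriv B ((chartAt E g).symm y) (α ((chartAt E g).symm y)))
          (mcChart 𝕜 E g y w) := by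
      rw [heq]
      rfl
    rw [h2]
    refine (DFunLike.congr_fun h1.fderiv u).trans ?_
    have e0 : dualTriv B ((chartAt E g).symm (chartAt E g g))
        (α ((chartAt E g).symm (chartAt E g g))) = dualTriv B g (α g) :=
      congr_arg (fun x => dualTriv B x (α x)) hl
    simp only [Function.comp_def, e0, mcChart_self, add_apply, ContinuousLinearMap.comp_apply,
      ContinuousLinearMap.flip_apply, zero_apply, map_zero, zero_add]
    rw [add_comm]
  have h0 : (0 : Fin 2).removeNth ![u, w] = ![w] := by ext i; fin_cases i; rfl
  have h1 : (1 : Fin 2).removeNth ![u, w] = ![u] := by ext i; fin_cases i; rfl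
  refine (extDerivForm_apply hd ![u, w]).trans ?_
  rw [Fin.sum_univ_two, h0, h1]
  change _ • fderiv 𝕜 (fun y => chartForm (oneForm α) g y ![w]) (chartAt E g g) u
    + _ • fderiv 𝕜 (fun y => chartForm (oneForm α) g y ![u]) (chartAt E g g) w = _
  rw [key, key]
  -- The derivatives of the coframe occur antisymmetrized, and the structure equation converts them
  -- into the Lie bracket term.
  have h2 := congr_arg (pairForm B (dualTriv B g (α g))) (fderiv_mcChart_sub (𝕜 := 𝕜) g u w)
  rw [map_sub, map_neg] at h2
  simp only [Fin.val_zero, Fin.val_one, pow_zero, pow_one, one_smul, neg_smul, triForm]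
  linear_combination h2

/-- The pullback of a fixed alternating form depends smoothly on the linear map. -/
theorem contDiff_compContinuousLinearMap {n : ℕ} (T : E [⋀^Fin n]→L[𝕜] 𝕜) :
    ContDiff 𝕜 ∞ fun A : E →L[𝕜] E => T.compContinuousLinearMap A := by
  have hfin : FiniteDimensional 𝕜 (ContinuousMultilinearMap 𝕜 (fun _ : Fin n => E) 𝕜) :=
    FiniteDimensional.of_injective (V₂ := MultilinearMap 𝕜 (fun _ : Fin n => E) 𝕜)
      ContinuousMultilinearMap.toMultilinearMapLinear
      ContinuousMultilinearMap.toMultilinearMap_injective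
  -- Smoothness is known for multilinear maps. A linear left inverse of the inclusion of alternating
  -- maps carries it over; it is continuous in finite dimension.
  obtain ⟨p, hp⟩ := (ContinuousAlternatingMap.toContinuousMultilinearMapLI
    (𝕜 := 𝕜) (E := E) (F := 𝕜) (ι := Fin n)).toLinearMap.exists_leftInverse_of_injective
    (LinearMap.ker_eq_bot.2 (LinearIsometry.injective _))
  have h1 : ContDiff 𝕜 ∞ fun A : E →L[𝕜] E =>
      ContinuousMultilinearMap.compContinuousLinearMapContinuousMultilinear 𝕜
        (fun _ : Fin n => E) (fun _ : Fin n => E) 𝕜 (fun _ => A) T.toContinuousMultilinearMap :=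
    ((ContinuousMultilinearMap.contDiff _).comp (contDiff_pi.2 fun _ => contDiff_id)).clm_apply
      contDiff_const
  have h2 := (LinearMap.toContinuousLinearMap p).contDiff.comp h1
  have h3 : (fun A : E →L[𝕜] E => T.compContinuousLinearMap A) = fun A =>
      p (ContinuousMultilinearMap.compContinuousLinearMapContinuousMultilinear 𝕜
        (fun _ : Fin n => E) (fun _ : Fin n => E) 𝕜 (fun _ => A) T.toContinuousMultilinearMap) :=
    funext fun A => (LinearMap.congr_fun hp (T.compContinuousLinearMap A)).symm
  rw [h3]
  exact h2

theorem chartForm_cartanForm (x₀ : G) (y : E) :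
    chartForm (cartanForm B) x₀ y
      = (cartanTensor B : E [⋀^Fin 3]→L[𝕜] 𝕜).compContinuousLinearMap (mcChart 𝕜 E x₀ y) := by
  ext v
  rfl

theorem isSmoothForm_cartanForm : IsSmoothForm (cartanForm B) := by
  intro x₀ y hy
  set T : E [⋀^Fin 3]→L[𝕜] 𝕜 := cartanTensor B
  have h : chartForm (cartanForm B) x₀ = fun y => T.compContinuousLinearMap (mcChart 𝕜 E x₀ y) :=
    funext fun y => chartForm_cartanForm B x₀ y
  rw [h]
  exact ((contDiff_compContinuousLinearMap T).contDiffAt.comp y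
      (contDiffAt_mcChart hy)).contDiffWithinAt

theorem isSmoothForm_neg_cartanForm : IsSmoothForm (-cartanForm B) := fun x₀ =>
  (isSmoothForm_cartanForm B x₀).neg

theorem differentiableAt_chartForm_cartanForm (g : G) :
    DifferentiableAt 𝕜 (chartForm (cartanForm B) g) (chartAt E g g) := by
  have hx := (chartAt E g).map_source (mem_chart_source E g)
  exact ((isSmoothForm_cartanForm B g).contDiffAt
    ((chartAt E g).open_target.mem_nhds hx)).differentiableAt (by simp)

/-- Invariance moves `a` to the left slot of the pairing, and the other slot is then the Jacobi
identity for `b`, `c`, `d`. -/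
theorem triForm_jacobi (a b c d : E) :
    triForm B (lieBr 𝕜 E G a b) c d - triForm B (lieBr 𝕜 E G a c) b d
      + triForm B (lieBr 𝕜 E G a d) b c = 0 := by
  simp only [triForm, pairForm_lieBr]
  rw [← map_sub, ← map_add, lieBr_jacobi b c d, lieBr_skew d]
  simp

theorem fderiv_chartForm_cartanForm (g : G) (u a b c : E) :
    fderiv 𝕜 (fun y => chartForm (cartanForm B) g y ![a, b, c]) (chartAt E g g) u
      = (1 / 2 : 𝕜) * (triForm B (fderiv 𝕜 (mcChart 𝕜 E g) (chartAt E g g) u a)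
          (mcForm 𝕜 E g b) (mcForm 𝕜 E g c)
        + triForm B (mcForm 𝕜 E g a) (fderiv 𝕜 (mcChart 𝕜 E g) (chartAt E g g) u b)
          (mcForm 𝕜 E g c)
        + triForm B (mcForm 𝕜 E g a) (mcForm 𝕜 E g b)
          (fderiv 𝕜 (mcChart 𝕜 E g) (chartAt E g g) u c)) := by
  have hM := hasFDerivAt_mcChart (𝕜 := 𝕜) (E := E) g
  have hMv : ∀ v : E, HasFDerivAt (fun y => mcChart 𝕜 E g y v)
      ((fderiv 𝕜 (mcChart 𝕜 E g) (chartAt E g g)).flip v) (chartAt E g g) := fun v => by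
    simpa using hM.clm_apply (hasFDerivAt_const v _)
  have h1 : (fun y => chartForm (cartanForm B) g y ![a, b, c]) = fun y => (1 / 2 : 𝕜) *
      pairForm B (mcChart 𝕜 E g y a)
        (lieBr 𝕜 E G (mcChart 𝕜 E g y b) (mcChart 𝕜 E g y c)) := rfl
  have h2 := (((pairForm B).hasFDerivAt.comp _ (hMv a)).clm_apply
    (((lieBr 𝕜 E G).hasFDerivAt.comp _ (hMv b)).clm_apply (hMv c))).const_mul (1 / 2 : 𝕜)
  rw [h1]
  refine (DFunLike.congr_fun h2.fderiv u).trans ?_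
  simp only [Function.comp_def, mcChart_self, add_apply, ContinuousLinearMap.comp_apply,
    ContinuousLinearMap.flip_apply, smul_apply, smul_eq_mul, map_add, triForm]
  ring

/-- Differentiating the coefficients gives derivatives of the coframe, which antisymmetrize to
brackets by the structure equation. What remains is a sum of terms `([a_i, a_j], [a_k, a_l])`;
symmetry of the pairing identifies them two by two, and Jacobi makes the sum vanish. -/
theorem extDerivForm_cartanForm (g : G) : extDerivForm (cartanForm B) g = 0 := by
  refine ContinuousAlternatingMap.ext fun (v : Fin 4 → E) => ?_
  refine (extDerivForm_apply (differentiableAt_chartForm_cartanForm B g) v).trans ?_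
  have h0 : (0 : Fin 4).removeNth v = ![v 1, v 2, v 3] := by ext i; fin_cases i <;> rfl
  have h1 : (1 : Fin 4).removeNth v = ![v 0, v 2, v 3] := by ext i; fin_cases i <;> rfl
  have h2 : (2 : Fin 4).removeNth v = ![v 0, v 1, v 3] := by ext i; fin_cases i <;> rfl
  have h3 : (3 : Fin 4).removeNth v = ![v 0, v 1, v 2] := by ext i; fin_cases i <;> rfl
  refine Eq.trans (b := (0 : 𝕜)) ?_ rfl
  rw [Fin.sum_univ_four, h0, h1, h2, h3]
  simp only [fderiv_chartForm_cartanForm]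
  have hs : ∀ i j c d, triForm B (fderiv 𝕜 (mcChart 𝕜 E g) (chartAt E g g) (v i) (v j)) c d
      - triForm B (fderiv 𝕜 (mcChart 𝕜 E g) (chartAt E g g) (v j) (v i)) c d
      = -triForm B (lieBr 𝕜 E G (mcForm 𝕜 E g (v i)) (mcForm 𝕜 E g (v j))) c d := by
    intro i j c d
    have := congr_arg (fun x => pairForm B x (lieBr 𝕜 E G c d))
      (fderiv_mcChart_sub (𝕜 := 𝕜) g (v i) (v j))
    simpa [triForm] using this
  have c1 : ∀ i j c d, triForm B c (fderiv 𝕜 (mcChart 𝕜 E g) (chartAt E g g) (v i) (v j)) d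
      = -triForm B (fderiv 𝕜 (mcChart 𝕜 E g) (chartAt E g g) (v i) (v j)) c d := by
    intro i j c d
    rw [triForm_cyclic, triForm_swap]
  have c2 : ∀ i j c d, triForm B c d (fderiv 𝕜 (mcChart 𝕜 E g) (chartAt E g g) (v i) (v j))
      = triForm B (fderiv 𝕜 (mcChart 𝕜 E g) (chartAt E g g) (v i) (v j)) c d := by
    intro i j c d
    rw [← triForm_cyclic]
  simp only [c1, c2]
  set a := fun i => mcForm 𝕜 E g (v i) with ha
  have j1 := triForm_jacobi B (a 0) (a 1) (a 2) (a 3)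
  have j2 : ∀ i j k l, triForm B (lieBr 𝕜 E G (a i) (a j)) (a k) (a l)
      = triForm B (lieBr 𝕜 E G (a k) (a l)) (a i) (a j) := fun i j k l => pairForm_symm B _ _
  have e01 := hs 0 1 (a 2) (a 3)
  have e02 := hs 0 2 (a 1) (a 3)
  have e03 := hs 0 3 (a 1) (a 2)
  have e12 := hs 1 2 (a 0) (a 3)
  have e13 := hs 1 3 (a 0) (a 2)
  have e23 := hs 2 3 (a 0) (a 1)
  have d1 := j2 1 2 0 3
  have d2 := j2 1 3 0 2
  have d3 := j2 2 3 0 1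
  simp only [ha] at *
  norm_num
  linear_combination (1 / 2 : 𝕜) * (e01 - e02 + e03 + e12 - e13 + e23 - 2 * j1 - d1 + d2 - d3)

theorem extDerivForm_neg_cartanForm (g : G) : extDerivForm (-cartanForm B) g = 0 := by
  rw [extDerivForm_neg (differentiableAt_chartForm_cartanForm B g), extDerivForm_cartanForm,
    neg_zero]

end ExteriorDerivative

/-! ### The Dorfman bracket on the Cartan–Dirac structure -/

section CartanDiracBracket

set_option linter.unusedSectionVars false

variable {𝕜 : Type*} [RCLike 𝕜]
  {E : Type*} [NormedAddCommGroup E] [NormedSpace 𝕜 E] [FiniteDimensional 𝕜 E] [CompleteSpace E]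
  {G : Type*} [Group G] [TopologicalSpace G] [ChartedSpace E G] [LieGroup 𝓘(𝕜, E) ∞ G]

theorem modelDeriv_adInv_fun {f : G → E} {g : G} (hf : MDifferentiableAt 𝓘(𝕜, E) 𝓘(𝕜, E) f g)
    (u : E) :
    modelDeriv 𝕜 E E (fun x => adInv 𝕜 E x (f x)) g u
      = adInv 𝕜 E g (modelDeriv 𝕜 E E f g u)
        - lieBr 𝕜 E G (mcForm 𝕜 E g u) (adInv 𝕜 E g (f g)) := by
  have hl := (chartAt E g).left_inv (mem_chart_source E g)
  have hA : MDifferentiableAt 𝓘(𝕜, E) 𝓘(𝕜, E →L[𝕜] E) (adInv 𝕜 E : G → E →L[𝕜] E) g :=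
    (contMDiff_adInv g).mdifferentiableAt (by simp)
  have h1 := hasFDerivAt_comp_chart_symm hA
  have h2 := hasFDerivAt_comp_chart_symm hf
  have hAf : MDifferentiableAt 𝓘(𝕜, E) 𝓘(𝕜, E) (fun x => adInv 𝕜 E x (f x)) g :=
    hA.clm_apply hf
  have h3 := (hasFDerivAt_comp_chart_symm hAf).unique (h1.clm_apply h2)
  have h4 := (hasFDerivAt_comp_chart_symm (mdifferentiable_adInv_apply (f g) g)).unique
    (h1.clm_apply (hasFDerivAt_const (f g) _))
  have h5 := DFunLike.congr_fun h3 u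
  have h6 := DFunLike.congr_fun h4 u
  have h7 := modelDeriv_adInv_apply (𝕜 := 𝕜) (f g) (mcForm 𝕜 E g u) g
  rw [leftTrans_mcForm, h6] at h7
  simp only [hl, add_apply, ContinuousLinearMap.comp_apply, ContinuousLinearMap.flip_apply,
    zero_apply, map_zero, zero_add] at h5 h7
  rw [h5, h7]
  abel

variable (B : InvariantPairing 𝕜 E G)

theorem fst_cartanDiracMap (g : G) (ξ : E) :
    ((cartanDiracMap B g ξ).1 : E) = leftTrans 𝕜 E g (ξ - adInv 𝕜 E g ξ) := by
  rw [map_sub, ← rightTrans_apply]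
  rfl

theorem mcForm_fst_cartanDiracMap (g : G) (ξ : E) :
    mcForm 𝕜 E g (cartanDiracMap B g ξ).1 = ξ - adInv 𝕜 E g ξ :=
  (congr_arg (mcForm 𝕜 E g) (fst_cartanDiracMap B g ξ)).trans (mcForm_leftTrans _ _)

theorem snd_cartanDiracMap (g : G) (ξ v : E) :
    (cartanDiracMap B g ξ).2 v
      = pairForm B ((1 / 2 : 𝕜) • (ξ + adInv 𝕜 E g ξ)) (mcForm 𝕜 E g v) := by
  have h : (cartanDiracMap B g ξ).2 v = (1 / 2 : 𝕜) •
    pairForm B (mcForm 𝕜 E g (leftTrans 𝕜 E g ξ + rightTrans 𝕜 E g ξ)) (mcForm 𝕜 E g v) := rfl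
  rw [h, rightTrans_apply, ← map_add, mcForm_leftTrans, map_smul]
  rfl

theorem dualTriv_snd_cartanDiracMap (g : G) (ξ : E) :
    dualTriv B g (cartanDiracMap B g ξ).2 = (1 / 2 : 𝕜) • (ξ + adInv 𝕜 E g ξ) := by
  refine ext_pairForm B fun z => ?_
  exact (pairForm_dualTriv B g _ z).trans
    ((snd_cartanDiracMap B g ξ _).trans (by rw [mcForm_leftTrans]))

theorem genTangent_ext {g : G} {p q : GenTangent 𝕜 E g}
    (h1 : mcForm 𝕜 E g p.1 = mcForm 𝕜 E g q.1) (h2 : dualTriv B g p.2 = dualTriv B g q.2) :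
    p = q := by
  refine Prod.ext ?_ ?_
  · exact (leftTrans_mcForm (𝕜 := 𝕜) (E := E) g p.1).symm.trans
      ((congr_arg (leftTrans 𝕜 E g) h1).trans (leftTrans_mcForm (𝕜 := 𝕜) (E := E) g q.1))
  · refine (eq_pairForm_dualTriv B g p.2).trans ?_
    rw [h2]
    exact (eq_pairForm_dualTriv B g q.2).symm

theorem eq_cartanDiracMap {g : G} {p : GenTangent 𝕜 E g} {ξ : E}
    (h1 : mcForm 𝕜 E g p.1 = ξ - adInv 𝕜 E g ξ)
    (h2 : dualTriv B g p.2 = (1 / 2 : 𝕜) • (ξ + adInv 𝕜 E g ξ)) : p = cartanDiracMap B g ξ :=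
  genTangent_ext B (h1.trans (mcForm_fst_cartanDiracMap B g ξ).symm)
    (h2.trans (dualTriv_snd_cartanDiracMap B g ξ).symm)

/-- The element of the Lie algebra which parametrizes an element of the Cartan–Dirac structure. -/
def cartanParam (g : G) (p : GenTangent 𝕜 E g) : E :=
  dualTriv B g p.2 + (1 / 2 : 𝕜) • mcForm 𝕜 E g p.1

theorem cartanParam_cartanDiracMap (g : G) (ξ : E) :
    cartanParam B g (cartanDiracMap B g ξ) = ξ := by
  rw [cartanParam, mcForm_fst_cartanDiracMap, dualTriv_snd_cartanDiracMap, ← smul_add]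
  have : ξ + adInv 𝕜 E g ξ + (ξ - adInv 𝕜 E g ξ) = (2 : 𝕜) • ξ := by rw [two_smul]; abel
  rw [this, smul_smul]
  norm_num

theorem cartanDiracMap_injective (g : G) : Function.Injective (cartanDiracMap B g) := by
  intro x y h
  exact (cartanParam_cartanDiracMap B g x).symm.trans
    ((congr_arg (cartanParam B g) h).trans (cartanParam_cartanDiracMap B g y))

theorem cartanDiracMap_cartanParam {g : G} {p : GenTangent 𝕜 E g} (hp : p ∈ cartanDirac B g) :
    cartanDiracMap B g (cartanParam B g p : E) = p := by
  obtain ⟨ξ, rfl⟩ := hp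
  exact congr_arg (cartanDiracMap B g) (cartanParam_cartanDiracMap B g ξ)

/-- The Dorfman bracket in a left trivialization. -/
theorem mcForm_fst_dorfman {η : FormField 𝕜 E G 3} {e₁ e₂ : ∀ x : G, GenTangent 𝕜 E x} {g : G}
    (h1 : MDifferentiableAt 𝓘(𝕜, E) 𝓘(𝕜, E) (fun x => mcForm 𝕜 E x (e₁ x).1) g)
    (h2 : MDifferentiableAt 𝓘(𝕜, E) 𝓘(𝕜, E) (fun x => mcForm 𝕜 E x (e₂ x).1) g) :
    mcForm 𝕜 E g (dorfman η e₁ e₂ g).1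
      = lieBr 𝕜 E G (mcForm 𝕜 E g (e₁ g).1) (mcForm 𝕜 E g (e₂ g).1)
        + modelDeriv 𝕜 E E (fun x => mcForm 𝕜 E x (e₂ x).1) g (e₁ g).1
        - modelDeriv 𝕜 E E (fun x => mcForm 𝕜 E x (e₁ x).1) g (e₂ g).1 :=
  mcForm_modelBracket h1 h2

theorem modelDeriv_pairForm {f₁ f₂ : G → E} {g : G}
    (h1 : MDifferentiableAt 𝓘(𝕜, E) 𝓘(𝕜, E) f₁ g) (h2 : MDifferentiableAt 𝓘(𝕜, E) 𝓘(𝕜, E) f₂ g)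
    (u : E) : modelDeriv 𝕜 E 𝕜 (fun x => pairForm B (f₁ x) (f₂ x)) g u
      = pairForm B (modelDeriv 𝕜 E E f₁ g u) (f₂ g)
        + pairForm B (f₁ g) (modelDeriv 𝕜 E E f₂ g u) := by
  have hl := (chartAt E g).left_inv (mem_chart_source E g)
  have hP : MDifferentiableAt 𝓘(𝕜, E) 𝓘(𝕜, E →L[𝕜] 𝕜) (fun x => pairForm B (f₁ x)) g :=
    (pairForm B).differentiableAt.mdifferentiableAt.comp g h1
  have h3 := (hasFDerivAt_comp_chart_symm (hP.clm_apply h2)).unique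
    (((pairForm B).hasFDerivAt.comp _ (hasFDerivAt_comp_chart_symm h1)).clm_apply
      (hasFDerivAt_comp_chart_symm h2))
  have h4 := DFunLike.congr_fun h3 u
  simp only [Function.comp_def, hl, add_apply, ContinuousLinearMap.comp_apply,
    ContinuousLinearMap.flip_apply] at h4
  rw [h4, add_comm]

/-- In `d(β(v)) + ι_v dβ`, the two terms that differentiate `b₂` in the direction `z` cancel. The
rest is the product rule together with the formula for the exterior derivative of a trivialized
`1`-form. -/
theorem snd_dorfman {η : FormField 𝕜 E G 3} {e₁ e₂ : ∀ x : G, GenTangent 𝕜 E x} {g : G}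
    {a₁ a₂ b₁ b₂ : G → E}
    (ha1 : ∀ x, mcForm 𝕜 E x (e₁ x).1 = a₁ x) (ha2 : ∀ x, mcForm 𝕜 E x (e₂ x).1 = a₂ x)
    (hb1 : ∀ x, dualTriv B x (e₁ x).2 = b₁ x) (hb2 : ∀ x, dualTriv B x (e₂ x).2 = b₂ x)
    (da1 : MDifferentiableAt 𝓘(𝕜, E) 𝓘(𝕜, E) a₁ g)
    (db1 : MDifferentiableAt 𝓘(𝕜, E) 𝓘(𝕜, E) b₁ g) (db2 : MDifferentiableAt 𝓘(𝕜, E) 𝓘(𝕜, E) b₂ g)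
    (z : E) :
    (dorfman η e₁ e₂ g).2 z
      = pairForm B (b₂ g) (modelDeriv 𝕜 E E a₁ g z)
        + pairForm B (modelDeriv 𝕜 E E b₁ g z) (a₂ g)
        + pairForm B (modelDeriv 𝕜 E E b₂ g (e₁ g).1 - modelDeriv 𝕜 E E b₁ g (e₂ g).1)
          (mcForm 𝕜 E g z)
        - triForm B (b₂ g) (a₁ g) (mcForm 𝕜 E g z) + triForm B (b₁ g) (a₂ g) (mcForm 𝕜 E g z)
        + η g ![(e₁ g).1, (e₂ g).1, z] := by
  obtain rfl : (fun x => dualTriv B x (e₁ x).2) = b₁ := funext hb1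
  obtain rfl : (fun x => dualTriv B x (e₂ x).2) = b₂ := funext hb2
  have h : (dorfman η e₁ e₂ g).2 z = modelDeriv 𝕜 E 𝕜 (fun y => (e₂ y).2 (e₁ y).1) g z
      + extDerivForm (oneForm fun y => (e₂ y).2) g ![(e₁ g).1, z]
      - extDerivForm (oneForm fun y => (e₁ y).2) g ![(e₂ g).1, z]
      + η g ![(e₁ g).1, (e₂ g).1, z] := rfl
  have h5 : (fun y => (e₂ y).2 (e₁ y).1) = fun y => pairForm B (dualTriv B y (e₂ y).2) (a₁ y) := by
    funext y
    rw [← ha1]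
    refine Eq.trans ?_ (pairForm_dualTriv B y _ _).symm
    exact congr_arg (e₂ y).2 (leftTrans_mcForm (𝕜 := 𝕜) (E := E) y (e₁ y).1).symm
  have h6 := extDerivForm_oneForm B db2 (e₁ g).1 z
  have h7 := extDerivForm_oneForm B db1 (e₂ g).1 z
  rw [h, h5, modelDeriv_pairForm B db2 da1]
  have h8 : ∀ p q r s p' q' : 𝕜, p = p' → q = q' → r + p - q + s = r + p' - q' + s := by
    rintro p q r s _ _ rfl rfl; rfl
  refine (h8 _ _ _ _ _ _ h6 h7).trans ?_
  simp only [ha1, ha2, map_sub, sub_apply]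
  ring

/-- The bracket depends only on germs. This allows a section of `L_G` over an open set to be
replaced by its parametrized form, which it agrees with only near the point. -/
theorem dorfman_congr {η : FormField 𝕜 E G 3} {e₁ e₂ e₁' e₂' : ∀ x : G, GenTangent 𝕜 E x} {g : G}
    (h1 : ∀ᶠ x in 𝓝 g, e₁ x = e₁' x) (h2 : ∀ᶠ x in 𝓝 g, e₂ x = e₂' x) :
    dorfman η e₁ e₂ g = dorfman η e₁' e₂' g := by
  have key : ∀ {e e' : ∀ x : G, GenTangent 𝕜 E x}, (∀ᶠ x in 𝓝 g, e x = e' x) →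
      extDerivForm (oneForm fun y => (e y).2) g = extDerivForm (oneForm fun y => (e' y).2) g := by
    intro e e' h
    have hx := (chartAt E g).map_source (mem_chart_source E g)
    have hc := ((chartAt E g).symm.continuousAt hx).eventually
      (p := fun x => e x = e' x) (by
        rwa [(chartAt E g).left_inv (mem_chart_source E g)])
    have hf : chartForm (oneForm fun y => (e y).2) g
        =ᶠ[𝓝 (chartAt E g g)] chartForm (oneForm fun y => (e' y).2) g := by
      filter_upwards [hc] with y hy
      simp only [chartForm, oneForm, hy]
    simp only [extDerivForm, extDeriv, hf.fderiv_eq]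
  have k1 := key h1
  have k2 := key h2
  have h3 : (fun y => (e₂ y).2 (e₁ y).1) =ᶠ[𝓝 g] fun y => (e₂' y).2 (e₁' y).1 := by
    filter_upwards [h1, h2] with y hy1 hy2
    rw [hy1, hy2]
  have h4 : (fun y => (e₁ y).1) =ᶠ[𝓝 g] fun y => (e₁' y).1 :=
    h1.mono fun y hy => congr_arg Prod.fst hy
  have h5 : (fun y => (e₂ y).1) =ᶠ[𝓝 g] fun y => (e₂' y).1 :=
    h2.mono fun y hy => congr_arg Prod.fst hy
  have h6 := h3.mfderiv_eq (I := 𝓘(𝕜, E)) (I' := 𝓘(𝕜, 𝕜))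
  have h7 := h4.mlieBracket_vectorField_eq (I := 𝓘(𝕜, E)) h5
  refine Prod.ext h7 ?_
  simp only [dorfman]
  rw [k1, k2, h1.self_of_nhds, h2.self_of_nhds]
  congr 3

/-- The map `ξ ↦ (ξ^L - ξ^R, σ(ξ))` intertwines the bracket of the action Lie algebroid of the
conjugation action with the Dorfman bracket. -/
theorem dorfman_cartanDiracMap {e₁ e₂ : ∀ x : G, GenTangent 𝕜 E x} {f₁ f₂ : G → E} {g : G}
    (he1 : ∀ᶠ x in 𝓝 g, e₁ x = cartanDiracMap B x (f₁ x))
    (he2 : ∀ᶠ x in 𝓝 g, e₂ x = cartanDiracMap B x (f₂ x))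
    (hf1 : MDifferentiableAt 𝓘(𝕜, E) 𝓘(𝕜, E) f₁ g) (hf2 : MDifferentiableAt 𝓘(𝕜, E) 𝓘(𝕜, E) f₂ g) :
    dorfman (-cartanForm B) e₁ e₂ g = cartanDiracMap B g
      (lieBr 𝕜 E G (f₁ g) (f₂ g) + modelDeriv 𝕜 E E f₂ g (e₁ g).1
        - modelDeriv 𝕜 E E f₁ g (e₂ g).1) := by
  rw [dorfman_congr he1 he2, he1.self_of_nhds, he2.self_of_nhds]
  have hA : ∀ {f : G → E}, MDifferentiableAt 𝓘(𝕜, E) 𝓘(𝕜, E) f g →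
      MDifferentiableAt 𝓘(𝕜, E) 𝓘(𝕜, E) (fun x => adInv 𝕜 E x (f x)) g := fun hf =>
    ((contMDiff_adInv g).mdifferentiableAt (by simp)).clm_apply hf
  -- The parameter and the adjoint action are differentiated separately; the latter contributes a
  -- bracket with the direction of differentiation.
  have hDa : ∀ {f : G → E}, MDifferentiableAt 𝓘(𝕜, E) 𝓘(𝕜, E) f g → ∀ u : E,
      modelDeriv 𝕜 E E (fun x => f x - adInv 𝕜 E x (f x)) g u
        = modelDeriv 𝕜 E E f g u - (adInv 𝕜 E g (modelDeriv 𝕜 E E f g u)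
        - lieBr 𝕜 E G (mcForm 𝕜 E g u) (adInv 𝕜 E g (f g))) := by
    intro f hf u
    rw [← modelDeriv_adInv_fun hf]
    exact DFunLike.congr_fun (mfderiv_sub hf (hA hf)) u
  have hDb : ∀ {f : G → E}, MDifferentiableAt 𝓘(𝕜, E) 𝓘(𝕜, E) f g → ∀ u : E,
      modelDeriv 𝕜 E E (fun x => (1 / 2 : 𝕜) • (f x + adInv 𝕜 E x (f x))) g u
        = (1 / 2 : 𝕜) • (modelDeriv 𝕜 E E f g u + (adInv 𝕜 E g (modelDeriv 𝕜 E E f g u)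
        - lieBr 𝕜 E G (mcForm 𝕜 E g u) (adInv 𝕜 E g (f g)))) := by
    intro f hf u
    rw [← modelDeriv_adInv_fun hf]
    exact DFunLike.congr_fun ((const_smul_mfderiv (hf.add (hA hf)) (1 / 2 : 𝕜)).trans
      (congr_arg _ (mfderiv_add hf (hA hf)))) u
  have da : ∀ {f : G → E}, MDifferentiableAt 𝓘(𝕜, E) 𝓘(𝕜, E) f g →
      MDifferentiableAt 𝓘(𝕜, E) 𝓘(𝕜, E) (fun x => f x - adInv 𝕜 E x (f x)) g := fun hf =>
    hf.sub (hA hf)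
  have db : ∀ {f : G → E}, MDifferentiableAt 𝓘(𝕜, E) 𝓘(𝕜, E) f g →
      MDifferentiableAt 𝓘(𝕜, E) 𝓘(𝕜, E) (fun x => (1 / 2 : 𝕜) • (f x + adInv 𝕜 E x (f x))) g :=
    fun hf => (hf.add (hA hf)).const_smul _
  have ea : ∀ f : G → E, (fun x => mcForm 𝕜 E x (cartanDiracMap B x (f x)).1)
      = fun x => f x - adInv 𝕜 E x (f x) := fun f =>
    funext fun x => mcForm_fst_cartanDiracMap B x (f x)
  have m1 := mcForm_fst_cartanDiracMap B g (f₁ g)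
  have m2 := mcForm_fst_cartanDiracMap B g (f₂ g)
  set v₁ : E := (cartanDiracMap B g (f₁ g)).1
  set v₂ : E := (cartanDiracMap B g (f₂ g)).1
  refine eq_cartanDiracMap B ?_ (ext_pairForm B fun z => ?_)
  · refine (mcForm_fst_dorfman (by rw [ea]; exact da hf1) (by rw [ea]; exact da hf2)).trans ?_
    rw [ea, ea]
    change lieBr 𝕜 E G (mcForm 𝕜 E g v₁) (mcForm 𝕜 E g v₂) +
      modelDeriv 𝕜 E E (fun x => f₂ x - adInv 𝕜 E x (f₂ x)) g v₁
      - modelDeriv 𝕜 E E (fun x => f₁ x - adInv 𝕜 E x (f₁ x)) g v₂ = _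
    rw [hDa hf1, hDa hf2, m1, m2]
    simp only [map_add, map_sub, sub_apply, adInv_lieBr]
    rw [lieBr_skew (f₂ g) (adInv 𝕜 E g (f₁ g)),
      lieBr_skew (adInv 𝕜 E g (f₂ g)) (adInv 𝕜 E g (f₁ g))]
    abel
  · refine (pairForm_dualTriv B g _ z).trans ((snd_dorfman B
      (fun x => mcForm_fst_cartanDiracMap B x (f₁ x))
      (fun x => mcForm_fst_cartanDiracMap B x (f₂ x))
      (fun x => dualTriv_snd_cartanDiracMap B x (f₁ x))
      (fun x => dualTriv_snd_cartanDiracMap B x (f₂ x)) (da hf1) (db hf1) (db hf2) _).trans ?_)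
    -- The twist contributes `-½ (a₁, [a₂, z])`; this coefficient is what balances the brackets
    -- produced by the halves in `σ`.
    have hη : (-cartanForm B) g ![v₁, v₂, leftTrans 𝕜 E g z]
        = -((1 / 2 : 𝕜) * triForm B (mcForm 𝕜 E g v₁) (mcForm 𝕜 E g v₂)
          (mcForm 𝕜 E g (leftTrans 𝕜 E g z))) := rfl
    change _ + pairForm B
      (modelDeriv 𝕜 E E (fun x => (1 / 2 : 𝕜) • (f₂ x + adInv 𝕜 E x (f₂ x))) g v₁
        - modelDeriv 𝕜 E E (fun x => (1 / 2 : 𝕜) • (f₁ x + adInv 𝕜 E x (f₁ x))) g v₂) _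
      - _ + _ + (-cartanForm B) g ![v₁, v₂, leftTrans 𝕜 E g z] = _
    rw [hη, m1, m2, hDa hf1, hDb hf1, hDb hf2, hDb hf1, mcForm_leftTrans, m1, m2]
    -- The derivative of `f₁` in the test direction must disappear. Its total contribution is `(f₂,
    -- X) - (A f₂, A X)` with `A = adInv`, which is zero since `A` is an isometry.
    set X := modelDeriv 𝕜 E E f₁ g (leftTrans 𝕜 E g z)
    have o1 := pairForm_adInv B g (f₂ g) X
    have s1 := pairForm_symm B X (f₂ g)
    have s2 := pairForm_symm B (adInv 𝕜 E g X) (f₂ g)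
    have s3 := pairForm_symm B X (adInv 𝕜 E g (f₂ g))
    have s4 := pairForm_symm B (adInv 𝕜 E g X) (adInv 𝕜 E g (f₂ g))
    -- Invariance puts every cubic term in the normal form `([u, w], z)`, after which the brackets
    -- can be compared linearly.
    have hz : ∀ u w : E, pairForm B u (lieBr 𝕜 E G z w) = -pairForm B (lieBr 𝕜 E G u w) z := by
      intro u w
      rw [lieBr_skew, map_neg, pairForm_lieBr]
    have hz' : ∀ u w : E, pairForm B (lieBr 𝕜 E G z w) u = -pairForm B (lieBr 𝕜 E G u w) z := by
      intro u w
      rw [pairForm_symm, hz]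
    have hz'' : ∀ u w : E, pairForm B u (lieBr 𝕜 E G w z) = pairForm B (lieBr 𝕜 E G u w) z := by
      intro u w
      rw [pairForm_lieBr]
    have k1 := lieBr_skew (𝕜 := 𝕜) (G := G) (f₂ g) (f₁ g)
    have k2 := lieBr_skew (𝕜 := 𝕜) (G := G) (f₂ g) (adInv 𝕜 E g (f₁ g))
    have k3 := lieBr_skew (𝕜 := 𝕜) (G := G) (adInv 𝕜 E g (f₂ g)) (f₁ g)
    have k4 := lieBr_skew (𝕜 := 𝕜) (G := G) (adInv 𝕜 E g (f₂ g)) (adInv 𝕜 E g (f₁ g))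
    simp only [triForm, map_add, map_sub, map_smul, sub_apply, add_apply, smul_apply, smul_eq_mul,
      adInv_lieBr, hz, hz', hz'', k1, k2, k3, k4, map_neg, neg_apply]
    linear_combination (1 / 2 : 𝕜) * (s1 + s2 - s3 - s4) - o1

end CartanDiracBracket

/-! ### Cartan–Dirac structures are twisted Dirac structures -/

section CartanDiracIsDirac

set_option linter.unusedSectionVars false

variable {𝕜 : Type*} [RCLike 𝕜]
  {E : Type*} [NormedAddCommGroup E] [NormedSpace 𝕜 E] [FiniteDimensional 𝕜 E] [CompleteSpace E]
  {G : Type*} [Group G] [TopologicalSpace G] [ChartedSpace E G] [LieGroup 𝓘(𝕜, E) ∞ G]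
  (B : InvariantPairing 𝕜 E G)

theorem pairing_eq_pairForm (g : G) (p q : GenTangent 𝕜 E g) :
    pairing p q = pairForm B (dualTriv B g p.2) (mcForm 𝕜 E g q.1)
      + pairForm B (dualTriv B g q.2) (mcForm 𝕜 E g p.1) := by
  have h : ∀ p q : GenTangent 𝕜 E g, p.2 q.1 = pairForm B (dualTriv B g p.2)
      (mcForm 𝕜 E g q.1) := fun p q =>
    ((pairForm_dualTriv B g p.2 _).trans
      (congr_arg p.2 (leftTrans_mcForm (𝕜 := 𝕜) (E := E) g q.1))).symm
  exact congr_arg₂ (· + ·) (h p q) (h q p)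

theorem pairing_cartanDiracMap (g : G) (p : GenTangent 𝕜 E g) (y : E) :
    pairing p (cartanDiracMap B g y) = pairForm B (dualTriv B g p.2) (y - adInv 𝕜 E g y)
      + pairForm B ((1 / 2 : 𝕜) • (y + adInv 𝕜 E g y)) (mcForm 𝕜 E g p.1) :=
  (pairing_eq_pairForm B g p _).trans (congr_arg₂ (· + ·)
    (congr_arg (pairForm B (dualTriv B g p.2)) (mcForm_fst_cartanDiracMap B g y))
    (DFunLike.congr_fun (congr_arg (pairForm B) (dualTriv_snd_cartanDiracMap B g y)) _))

theorem contMDiffAt_half_smul {f : G → E} {g : G} (hf : ContMDiffAt 𝓘(𝕜, E) 𝓘(𝕜, E) ∞ f g) :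
    ContMDiffAt 𝓘(𝕜, E) 𝓘(𝕜, E) ∞ (fun x => (1 / 2 : 𝕜) • f x) g :=
  ContMDiffAt.comp g (g := fun y : E => (1 / 2 : 𝕜) • y)
    (contDiff_const_smul (1 / 2 : 𝕜)).contMDiff.contMDiffAt hf

/-- Isotropy is the isometry property of `A = adInv`. For maximality, let `(a, b)` be the
trivialization of an orthogonal element. Nondegeneracy turns orthogonality into `½(Aa + a) = b -
Ab`, so `ξ = b + ½a` satisfies `Aξ = b - ½a`, and `ξ` is the required parameter. -/
theorem isLagrangian_cartanDirac (g : G) : IsLagrangian (cartanDirac B g) := by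
  intro p
  constructor
  · have key : ∀ x y : E, pairing (cartanDiracMap B g x) (cartanDiracMap B g y) = 0 := by
      intro x y
      refine (pairing_cartanDiracMap B g _ y).trans ?_
      refine (congr_arg₂ (fun u v : E => pairForm B u (y - adInv 𝕜 E g y)
        + pairForm B ((1 / 2 : 𝕜) • (y + adInv 𝕜 E g y)) v) (dualTriv_snd_cartanDiracMap B g x)
        (mcForm_fst_cartanDiracMap B g x)).trans ?_
      have h := pairForm_adInv B g x y
      have s1 := pairForm_symm B y x
      have s2 := pairForm_symm B y (adInv 𝕜 E g x)
      have s3 := pairForm_symm B (adInv 𝕜 E g y) x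
      have s4 := pairForm_symm B (adInv 𝕜 E g y) (adInv 𝕜 E g x)
      simp only [map_add, map_sub, map_smul, add_apply, smul_apply, smul_eq_mul]
      linear_combination (1 / 2 : 𝕜) * (s1 - s2 + s3 - s4) - h
    rintro ⟨x, rfl⟩ _ ⟨y, rfl⟩
    exact key x y
  · intro h
    set a := mcForm 𝕜 E g p.1
    set b := dualTriv B g p.2
    have key : (1 / 2 : 𝕜) • (adInv 𝕜 E g a + a) = b - adInv 𝕜 E g b := by
      refine ext_pairForm B fun z => ?_
      -- Testing against the parameter `Ad_g z` lets the isometry property move every adjoint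
      -- operator onto `a` and `b`.
      have h1 := (pairing_cartanDiracMap B g p (adInv 𝕜 E g⁻¹ z)).symm.trans
        (h _ (LinearMap.mem_range_self _ _))
      have h2 := pairForm_adInv B g (adInv 𝕜 E g⁻¹ z) a
      have h3 := pairForm_adInv B g b (adInv 𝕜 E g⁻¹ z)
      rw [adInv_adInv_inv] at h1 h2 h3
      have s1 := pairForm_symm B z a
      have s2 := pairForm_symm B z (adInv 𝕜 E g a)
      change pairForm B b (adInv 𝕜 E g⁻¹ z - z)
        + pairForm B ((1 / 2 : 𝕜) • (adInv 𝕜 E g⁻¹ z + z)) a = 0 at h1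
      simp only [map_add, map_sub, map_smul, add_apply, sub_apply, smul_apply, smul_eq_mul] at h1 ⊢
      linear_combination h1 + (1 / 2 : 𝕜) * (h2 - s1 - s2) + h3
    have e : (2 : 𝕜)⁻¹ + (2 : 𝕜)⁻¹ = 1 := by norm_num
    have key' : adInv 𝕜 E g b = b - (1 / 2 : 𝕜) • (adInv 𝕜 E g a + a) := by rw [key]; abel
    refine ⟨(b + (1 / 2 : 𝕜) • a : E), (eq_cartanDiracMap B ?_ ?_).symm⟩
    · change a = _
      rw [map_add, map_smul, key']
      module
    · change b = _
      rw [map_add, map_smul, key']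
      module

theorem isSmoothSectionOn_cartanDiracMap (ξ : E) {U : Set G} (hU : IsOpen U) :
    IsSmoothSectionOn (fun x : G => cartanDiracMap B x ξ) U := by
  refine (isSmoothSectionOn_iff B hU).2 fun g _ => ⟨?_, ?_⟩
  · have h : (fun x : G => mcForm 𝕜 E x (cartanDiracMap B x ξ).1) = fun x => ξ - adInv 𝕜 E x ξ :=
      funext fun x => mcForm_fst_cartanDiracMap B x ξ
    rw [h]
    exact contMDiffAt_const.sub (contMDiff_adInv_apply ξ g)
  · have h : (fun x : G => dualTriv B x (cartanDiracMap B x ξ).2)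
        = fun x => (1 / 2 : 𝕜) • (ξ + adInv 𝕜 E x ξ) :=
      funext fun x => dualTriv_snd_cartanDiracMap B x ξ
    rw [h]
    exact contMDiffAt_half_smul (contMDiffAt_const.add (contMDiff_adInv_apply ξ g))

theorem contMDiffAt_cartanParam {e : ∀ x : G, GenTangent 𝕜 E x} {U : Set G} (hU : IsOpen U)
    (he : IsSmoothSectionOn e U) {g : G} (hg : g ∈ U) :
    ContMDiffAt 𝓘(𝕜, E) 𝓘(𝕜, E) ∞ (fun x => cartanParam B x (e x)) g := by
  obtain ⟨h1, h2⟩ := (isSmoothSectionOn_iff B hU).1 he g hg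
  exact h2.add (contMDiffAt_half_smul h1)

theorem eventually_eq_cartanDiracMap {e : ∀ x : G, GenTangent 𝕜 E x} {U : Set G} (hU : IsOpen U)
    (he : ∀ x ∈ U, e x ∈ cartanDirac B x) {g : G} (hg : g ∈ U) :
    ∀ᶠ x in 𝓝 g, e x = cartanDiracMap B x (cartanParam B x (e x) : E) := by
  filter_upwards [hU.mem_nhds hg] with x hx
  exact (cartanDiracMap_cartanParam B (he x hx)).symm

/-- A smooth section of `L_G` has a smooth parameter, since that parameter is a linear combination
of its two trivialized components. The bracket formula for parametrized sections therefore covers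
all of them. -/
theorem dorfman_eq_cartanDiracMap {e₁ e₂ : ∀ x : G, GenTangent 𝕜 E x} {U : Set G}
    (hU : IsOpen U) (h1 : IsSmoothSectionOn e₁ U) (h2 : IsSmoothSectionOn e₂ U)
    (m1 : ∀ x ∈ U, e₁ x ∈ cartanDirac B x) (m2 : ∀ x ∈ U, e₂ x ∈ cartanDirac B x)
    {g : G} (hg : g ∈ U) :
    dorfman (-cartanForm B) e₁ e₂ g = cartanDiracMap B g
      (lieBr 𝕜 E G (cartanParam B g (e₁ g)) (cartanParam B g (e₂ g))
        + modelDeriv 𝕜 E E (fun x => cartanParam B x (e₂ x)) g (e₁ g).1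
        - modelDeriv 𝕜 E E (fun x => cartanParam B x (e₁ x)) g (e₂ g).1) :=
  dorfman_cartanDiracMap B (f₁ := fun x => cartanParam B x (e₁ x))
    (f₂ := fun x => cartanParam B x (e₂ x)) (eventually_eq_cartanDiracMap B hU m1 hg)
    (eventually_eq_cartanDiracMap B hU m2 hg)
    ((contMDiffAt_cartanParam B hU h1 hg).mdifferentiableAt (by simp))
    ((contMDiffAt_cartanParam B hU h2 hg).mdifferentiableAt (by simp))

theorem isDirac_cartanDirac : IsDirac (-cartanForm B) (cartanDirac B) where
  smooth_twist := isSmoothForm_neg_cartanForm B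
  closed_twist := extDerivForm_neg_cartanForm B
  lagrangian := isLagrangian_cartanDirac B
  subbundle := fun x₀ => by
    -- A basis of the Lie algebra gives a global frame.
    let b : Module.Basis (Fin (Module.finrank 𝕜 E)) 𝕜 (GroupLieAlgebra 𝓘(𝕜, E) G) :=
      Module.finBasis 𝕜 E
    refine ⟨Set.univ, isOpen_univ, trivial, Module.finrank 𝕜 E, fun i x => cartanDiracMap B x (b i),
      fun i => isSmoothSectionOn_cartanDiracMap B (b i) isOpen_univ, fun x _ => ⟨?_, ?_⟩⟩
    · exact b.linearIndependent.map' (cartanDiracMap B x)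
        (LinearMap.ker_eq_bot.2 (cartanDiracMap_injective B x))
    · have h : (Set.range fun i => cartanDiracMap B x (b i))
          = cartanDiracMap B x '' Set.range b := by
        rw [← Set.range_comp]
        rfl
      rw [h, ← Submodule.map_span, b.span_eq, Submodule.map_top]
      rfl
  involutive := fun U hU e₁ e₂ h1 h2 m1 m2 x hx => by
    rw [dorfman_eq_cartanDiracMap B hU h1 h2 m1 m2 hx]
    exact LinearMap.mem_range_self _ _

end CartanDiracIsDirac

/-! ### Separability of connected Lie groups -/

section Separability

/-- A connected topological group with a separable neighbourhood of the identity is separable. -/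
theorem separableSpace_of_isSeparable_nhds_one {P : Type*} [Group P] [TopologicalSpace P]
    [IsTopologicalGroup P] [PreconnectedSpace P] {U : Set P} (hU : U ∈ 𝓝 (1 : P))
    (hs : TopologicalSpace.IsSeparable U) : TopologicalSpace.SeparableSpace P := by
  obtain ⟨D, hD, hUD⟩ := hs
  -- A subgroup with countably many generators is the image of a countable free group.
  have hcount : (Subgroup.closure D : Set P).Countable := by
    have : Countable D := hD
    have hfree : Countable (FreeGroup D) := by
      unfold FreeGroup
      infer_instance
    have h1 := FreeGroup.range_lift_eq_closure (β := P) (α := D) (f := Subtype.val)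
    rw [Subtype.range_coe] at h1
    rw [← h1]
    exact Set.countable_range _
  -- The closure is a subgroup containing a neighbourhood of the identity, hence open; being also
  -- closed, it is the whole connected group.
  have hmem : ((Subgroup.closure D).topologicalClosure : Set P) ∈ 𝓝 (1 : P) := by
    refine mem_of_superset hU (hUD.trans ?_)
    exact closure_mono Subgroup.subset_closure
  have hopen := (Subgroup.closure D).topologicalClosure.isOpen_of_mem_nhds hmem
  have huniv : ((Subgroup.closure D).topologicalClosure : Set P) = Set.univ :=
    IsClopen.eq_univ ⟨Subgroup.isClosed_topologicalClosure _, hopen⟩ ⟨1, one_mem _⟩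
  refine ⟨⟨_, hcount, ?_⟩⟩
  rw [dense_iff_closure_eq, ← huniv]
  rfl

theorem isSeparable_chart_source (𝕜 : Type*) [RCLike 𝕜] {E : Type*} [NormedAddCommGroup E]
    [NormedSpace 𝕜 E] [FiniteDimensional 𝕜 E] {M : Type*} [TopologicalSpace M] [ChartedSpace E M]
    (x : M) : TopologicalSpace.IsSeparable (chartAt E x).source := by
  have : ProperSpace E := FiniteDimensional.proper_rclike 𝕜 E
  have h : (chartAt E x).source
      = Set.range ((chartAt E x).target.domRestrict (chartAt E x).symm) := by
    rw [Set.range_domRestrict, (chartAt E x).symm_image_target_eq_source]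
  rw [h]
  exact TopologicalSpace.isSeparable_range
    (continuousOn_iff_continuous_domRestrict.1 (chartAt E x).continuousOn_symm)

theorem separableSpace_of_connected_lieGroup (𝕜 : Type*) [RCLike 𝕜] {E : Type*}
    [NormedAddCommGroup E] [NormedSpace 𝕜 E] [FiniteDimensional 𝕜 E] {P : Type*} [Group P]
    [TopologicalSpace P] [ChartedSpace E P] [LieGroup 𝓘(𝕜, E) ∞ P] [PreconnectedSpace P] :
    TopologicalSpace.SeparableSpace P := by
  have : IsTopologicalGroup P := topologicalGroup_of_lieGroup 𝓘(𝕜, E) ∞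
  exact separableSpace_of_isSeparable_nhds_one
    ((chartAt E (1 : P)).open_source.mem_nhds (mem_chart_source E 1))
    (isSeparable_chart_source 𝕜 (1 : P))

end Separability

/-! ### Local injectivity of immersions -/

section LocalInjectivity

/-- Composing `f` with a linear left inverse of `f'` gives a map with strict derivative the
identity. The inverse function theorem makes the composite locally injective, hence `f` too. -/
theorem exists_injOn_of_hasStrictFDerivAt {𝕜 : Type*} [RCLike 𝕜] {E : Type*}
    [NormedAddCommGroup E] [NormedSpace 𝕜 E] [FiniteDimensional 𝕜 E] {F : Type*}
    [NormedAddCommGroup F] [NormedSpace 𝕜 F] [FiniteDimensional 𝕜 F] {f : E → F} {f' : E →L[𝕜] F}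
    {a : E} (hf : HasStrictFDerivAt f f' a) (hinj : Function.Injective f') :
    ∃ U ∈ 𝓝 a, Set.InjOn f U := by
  have : CompleteSpace E := FiniteDimensional.complete 𝕜 E
  obtain ⟨l, hl⟩ := f'.toLinearMap.exists_leftInverse_of_injective (LinearMap.ker_eq_bot.2 hinj)
  have h1 := (LinearMap.toContinuousLinearMap l).hasStrictFDerivAt.comp a hf
  have h2 : (LinearMap.toContinuousLinearMap l).comp f'
      = (ContinuousLinearEquiv.refl 𝕜 E : E →L[𝕜] E) := by
    ext v
    exact LinearMap.congr_fun hl v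
  rw [h2] at h1
  refine ⟨(h1.toOpenPartialHomeomorph _).source, (h1.toOpenPartialHomeomorph _).open_source.mem_nhds
    h1.mem_toOpenPartialHomeomorph_source, fun x hx y hy hxy => ?_⟩
  exact (h1.toOpenPartialHomeomorph _).injOn hx hy (congr_arg l hxy)

end LocalInjectivity

/-! ### Integral curves of left-invariant fields -/

section IntegralCurves

set_option linter.unusedSectionVars false

variable {𝕜 : Type*} [RCLike 𝕜]
  {E : Type*} [NormedAddCommGroup E] [NormedSpace 𝕜 E] [FiniteDimensional 𝕜 E] [CompleteSpace E]
  {G : Type*} [Group G] [TopologicalSpace G] [ChartedSpace E G] [LieGroup 𝓘(𝕜, E) ∞ G]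

variable (𝕜 E G) in
/-- The curve `α` is the expression in the chart at the identity of an integral curve of the
left-invariant vector field of `v`, starting at the identity. -/
def IsLeftCurve [NormedSpace ℝ E] (v : E) (α : ℝ → E) : Prop :=
  α 0 = chartAt E (1 : G) 1 ∧
    ∀ᶠ t in 𝓝 (0 : ℝ), HasDerivAt α ((mcChart 𝕜 E (1 : G) (α t)).inverse v) t

/-- Time is real even over the complex numbers: the field is continuously differentiable over the
reals, and the real existence theorem applies. -/
theorem exists_isLeftCurve [NormedSpace ℝ E] [IsScalarTower ℝ 𝕜 E] (v : E) :
    ∃ α, IsLeftCurve 𝕜 E G v α := by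
  have h1 := (chartAt E (1 : G)).map_source (mem_chart_source E (1 : G))
  have hN : ContDiffAt ℝ 1 (fun y => (mcChart 𝕜 E (1 : G) y).inverse v) (chartAt E (1 : G) 1) :=
    (((contDiffAt_inverse_mcChart (𝕜 := 𝕜) h1).clm_apply contDiffAt_const).restrict_scalars ℝ).of_le
      (by simp)
  obtain ⟨α, h0, ε, hε, h⟩ :=
    hN.exists_forall_mem_closedBall_exists_eq_forall_mem_Ioo_hasDerivAt₀ 0
  refine ⟨α, h0, ?_⟩
  filter_upwards [Ioo_mem_nhds (show (0 : ℝ) - ε < 0 by linarith)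
    (show (0 : ℝ) < 0 + ε by linarith)] with t ht using h t ht

theorem IsLeftCurve.continuousAt [NormedSpace ℝ E] {v : E} {α : ℝ → E}
    (hα : IsLeftCurve 𝕜 E G v α) : ContinuousAt α 0 :=
  hα.2.self_of_nhds.continuousAt

theorem IsLeftCurve.eventuallyEq [NormedSpace ℝ E] [IsScalarTower ℝ 𝕜 E] {v : E} {α β : ℝ → E}
    (hα : IsLeftCurve 𝕜 E G v α) (hβ : IsLeftCurve 𝕜 E G v β) : α =ᶠ[𝓝 0] β := by
  have h1 := (chartAt E (1 : G)).map_source (mem_chart_source E (1 : G))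
  have hN : ContDiffAt ℝ 1 (fun y => (mcChart 𝕜 E (1 : G) y).inverse v) (chartAt E (1 : G) 1) :=
    (((contDiffAt_inverse_mcChart (𝕜 := 𝕜) h1).clm_apply contDiffAt_const).restrict_scalars ℝ).of_le
      (by simp)
  obtain ⟨K, s, hs, hK⟩ := hN.exists_lipschitzOnWith
  refine ODE_solution_unique_of_eventually (K := K) (s := fun _ => s)
    (v := fun _ y => (mcChart 𝕜 E (1 : G) y).inverse v) (Eventually.of_forall fun _ => hK)
    (hα.2.and (hα.continuousAt.eventually_mem ?_)) (hβ.2.and (hβ.continuousAt.eventually_mem ?_))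
    (hα.1.trans hβ.1.symm)
  · rwa [hα.1]
  · rwa [hβ.1]

variable {E' : Type*} [NormedAddCommGroup E'] [NormedSpace 𝕜 E']
  {G' : Type*} [Group G'] [TopologicalSpace G'] [ChartedSpace E' G'] [LieGroup 𝓘(𝕜, E') ∞ G']
  [FiniteDimensional 𝕜 E'] [CompleteSpace E']

/-- A homomorphism is equivariant under left translations, so it carries the left-invariant field of
`v` to that of the image of `v`, also when read in charts. Integral curves are therefore sent to
integral curves. -/
theorem hasFDerivAt_hom_chart {f : G' →* G} (hf : MDifferentiable 𝓘(𝕜, E') 𝓘(𝕜, E) f) {y : E'}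
    (hy : y ∈ (chartAt E' (1 : G')).target)
    (hy' : f ((chartAt E' (1 : G')).symm y) ∈ (chartAt E (1 : G)).source) :
    ∃ D : E' →L[𝕜] E,
      HasFDerivAt (fun z => chartAt E (1 : G) (f ((chartAt E' (1 : G')).symm z))) D y ∧
      ∀ v, D ((mcChart 𝕜 E' (1 : G') y).inverse v)
        = (mcChart 𝕜 E (1 : G) (chartAt E (1 : G) (f ((chartAt E' (1 : G')).symm y)))).inverse
          (modelDeriv 𝕜 E' E f 1 v) := by
  set h := (chartAt E' (1 : G')).symm y
  have hd1 : MDifferentiableAt 𝓘(𝕜, E') 𝓘(𝕜, E)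
      (fun z => f ((chartAt E' (1 : G')).symm z)) y :=
    (hf h).comp y (mdifferentiableAt_chart_symm hy)
  have hd2 : MDifferentiableAt 𝓘(𝕜, E') 𝓘(𝕜, E)
      (fun z => chartAt E (1 : G) (f ((chartAt E' (1 : G')).symm z))) y :=
    (mdifferentiableAt_chart hy').comp y hd1
  refine ⟨_, (mdifferentiableAt_iff_differentiableAt.1 hd2).hasFDerivAt, fun v => ?_⟩
  have h2 := modelDeriv_symm_comp_chart (𝕜 := 𝕜) ((chartAt E' (1 : G')).map_target hy)
  rw [(chartAt E' (1 : G')).right_inv hy] at h2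
  have h3 := DFunLike.congr_fun h2 (leftTrans 𝕜 E' h v)
  rw [ContinuousLinearMap.comp_apply, ContinuousLinearMap.id_apply] at h3
  have h4 := modelDeriv_comp (x := y) (g := chartAt E (1 : G)) (mdifferentiableAt_chart hy') hd1
  have h5 := modelDeriv_comp_chart_symm (𝕜 := 𝕜) hy (hf h)
  rw [← modelDeriv_eq_fderiv, h4, h5, inverse_mcChart hy,
    inverse_mcChart ((chartAt E (1 : G)).map_source hy'), (chartAt E (1 : G)).left_inv hy']
  simp only [ContinuousLinearMap.comp_apply]
  rw [h3, modelDeriv_hom_leftTrans hf]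

theorem tendsto_hom_chart_symm {f : G' →* G} (hf : MDifferentiable 𝓘(𝕜, E') 𝓘(𝕜, E) f) :
    Tendsto (fun z => f ((chartAt E' (1 : G')).symm z)) (𝓝 (chartAt E' (1 : G') 1))
      (𝓝 (1 : G)) := by
  have h1 := (chartAt E' (1 : G')).map_source (mem_chart_source E' (1 : G'))
  have hl := (chartAt E' (1 : G')).left_inv (mem_chart_source E' (1 : G'))
  have h2 := (chartAt E' (1 : G')).symm.continuousAt h1
  have h3 : ContinuousAt f ((chartAt E' (1 : G')).symm (chartAt E' (1 : G') 1)) :=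
    (hf _).continuousAt
  have h4 := h3.comp h2
  have h5 : f ((chartAt E' (1 : G')).symm (chartAt E' (1 : G') 1)) = 1 := by rw [hl, map_one]
  have h6 := h4.tendsto
  simp only [Function.comp_def] at h6
  rwa [h5] at h6

theorem IsLeftCurve.eventually_mem_source {f : G' →* G}
    (hf : MDifferentiable 𝓘(𝕜, E') 𝓘(𝕜, E) f) [NormedSpace ℝ E'] {v : E'} {α : ℝ → E'}
    (hα : IsLeftCurve 𝕜 E' G' v α) :
    ∀ᶠ t in 𝓝 (0 : ℝ), f ((chartAt E' (1 : G')).symm (α t)) ∈ (chartAt E (1 : G)).source := by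
  have h1 := hα.continuousAt.tendsto
  rw [hα.1] at h1
  exact ((tendsto_hom_chart_symm hf).comp h1).eventually_mem
    ((chartAt E (1 : G)).open_source.mem_nhds (mem_chart_source E 1))

theorem IsLeftCurve.map {f : G' →* G} (hf : MDifferentiable 𝓘(𝕜, E') 𝓘(𝕜, E) f)
    [NormedSpace ℝ E] [IsScalarTower ℝ 𝕜 E] [NormedSpace ℝ E'] [IsScalarTower ℝ 𝕜 E']
    {v : E'} {α : ℝ → E'} (hα : IsLeftCurve 𝕜 E' G' v α) :
    IsLeftCurve 𝕜 E G (modelDeriv 𝕜 E' E f 1 v)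
      (fun t => chartAt E (1 : G) (f ((chartAt E' (1 : G')).symm (α t)))) := by
  have hl := (chartAt E' (1 : G')).left_inv (mem_chart_source E' (1 : G'))
  refine ⟨by simp only [hα.1, hl, map_one], ?_⟩
  have ht : ∀ᶠ t in 𝓝 (0 : ℝ), α t ∈ (chartAt E' (1 : G')).target := by
    refine hα.continuousAt.eventually_mem ?_
    rw [hα.1]
    exact (chartAt E' (1 : G')).open_target.mem_nhds
      ((chartAt E' (1 : G')).map_source (mem_chart_source E' (1 : G')))
  filter_upwards [hα.2, ht, hα.eventually_mem_source hf] with t h1 h2 h3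
  obtain ⟨D, hD, hDv⟩ := hasFDerivAt_hom_chart hf h2 h3
  rw [← hDv v]
  exact (hD.restrictScalars ℝ).comp_hasDerivAt t h1

end IntegralCurves

/-! ### Tangent vectors of an intersection of immersed subgroups -/

section KernelOfQuotient

set_option linter.unusedSectionVars false

variable {𝕜 : Type*} [RCLike 𝕜]
  {EG : Type*} [NormedAddCommGroup EG] [NormedSpace 𝕜 EG] [FiniteDimensional 𝕜 EG]
  [CompleteSpace EG]
  {G : Type*} [Group G] [TopologicalSpace G] [ChartedSpace EG G] [LieGroup 𝓘(𝕜, EG) ∞ G]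
  {EH : Type*} [NormedAddCommGroup EH] [NormedSpace 𝕜 EH] [FiniteDimensional 𝕜 EH]
  [CompleteSpace EH]
  {H : Type*} [Group H] [TopologicalSpace H] [ChartedSpace EH H] [LieGroup 𝓘(𝕜, EH) ∞ H]
  {EP : Type*} [NormedAddCommGroup EP] [NormedSpace 𝕜 EP] [FiniteDimensional 𝕜 EP]
  [CompleteSpace EP]
  {P : Type*} [Group P] [TopologicalSpace P] [ChartedSpace EP P] [LieGroup 𝓘(𝕜, EP) ∞ P]
  {EQ : Type*} [NormedAddCommGroup EQ] [NormedSpace 𝕜 EQ] [FiniteDimensional 𝕜 EQ]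
  [CompleteSpace EQ]
  {Q : Type*} [Group Q] [TopologicalSpace Q] [ChartedSpace EQ Q] [LieGroup 𝓘(𝕜, EQ) ∞ Q]
  {ι : H →* G} {κ : P →* G} {φ : H →* Q}

/-- Tangent vectors of `H` that are also tangent to `P` are killed by any homomorphism which is
trivial on the intersection of `H` and `P`. -/
theorem modelDeriv_eq_zero_of_eq (hι : MDifferentiable 𝓘(𝕜, EH) 𝓘(𝕜, EG) ι)
    (hκ : MDifferentiable 𝓘(𝕜, EP) 𝓘(𝕜, EG) κ) (hφ : MDifferentiable 𝓘(𝕜, EH) 𝓘(𝕜, EQ) φ)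
    (hker : ∀ h p, ι h = κ p → φ h = 1) {x : EH} {y : EP}
    (hxy : modelDeriv 𝕜 EH EG ι 1 x = modelDeriv 𝕜 EP EG κ 1 y) :
    modelDeriv 𝕜 EH EQ φ 1 x = 0 := by
  -- Integral curves run in real time, so all model spaces are also regarded as real ones.
  let _ : NormedSpace ℝ EG := NormedSpace.restrictScalars ℝ 𝕜 EG
  let _ : NormedSpace ℝ EH := NormedSpace.restrictScalars ℝ 𝕜 EH
  let _ : NormedSpace ℝ EP := NormedSpace.restrictScalars ℝ 𝕜 EP
  let _ : NormedSpace ℝ EQ := NormedSpace.restrictScalars ℝ 𝕜 EQ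
  have _ : IsScalarTower ℝ 𝕜 EG := IsScalarTower.of_algebraMap_smul fun _ _ => rfl
  have _ : IsScalarTower ℝ 𝕜 EH := IsScalarTower.of_algebraMap_smul fun _ _ => rfl
  have _ : IsScalarTower ℝ 𝕜 EP := IsScalarTower.of_algebraMap_smul fun _ _ => rfl
  have _ : IsScalarTower ℝ 𝕜 EQ := IsScalarTower.of_algebraMap_smul fun _ _ => rfl
  obtain ⟨α, hα⟩ := exists_isLeftCurve (𝕜 := 𝕜) (G := H) x
  obtain ⟨β, hβ⟩ := exists_isLeftCurve (𝕜 := 𝕜) (G := P) y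
  have h1 := hα.map hι
  have h2 := hβ.map hκ
  rw [← hxy] at h2
  have h3 := hα.map hφ
  -- The images in `G` of the two curves are integral curves of the same field with the same initial
  -- point, so they coincide for small times. The curve in `H` then stays in the kernel of `φ`, and
  -- its image has zero velocity.
  have heq : (fun t => chartAt EQ (1 : Q) (φ ((chartAt EH (1 : H)).symm (α t))))
      =ᶠ[𝓝 0] fun _ => chartAt EQ (1 : Q) 1 := by
    filter_upwards [h1.eventuallyEq h2, hα.eventually_mem_source hι, hβ.eventually_mem_source hκ]
      with t e1 e2 e3
    rw [hker _ _ ((chartAt EG (1 : G)).injOn e2 e3 e1)]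
  have h4 := h3.2.self_of_nhds
  have h5 := h4.unique ((hasDerivAt_const (0 : ℝ) _).congr_of_eventuallyEq heq)
  rw [h3.1, inverse_mcChart_self, leftTrans_one] at h5
  exact h5

/-- A one-parameter family in the kernel of a submersive homomorphism, with prescribed
velocity. -/
theorem exists_curve_in_ker (hφ : ContMDiff 𝓘(𝕜, EH) 𝓘(𝕜, EQ) ∞ φ)
    (hsurj : Function.Surjective (modelDeriv 𝕜 EH EQ φ 1)) {x : EH}
    (hx : modelDeriv 𝕜 EH EQ φ 1 x = 0) :
    ∃ c : 𝕜 → EH, c 0 = chartAt EH (1 : H) 1 ∧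
      HasStrictFDerivAt c (ContinuousLinearMap.toSpanSingleton 𝕜 x) 0 ∧
      ∀ᶠ t in 𝓝 (0 : 𝕜), φ ((chartAt EH (1 : H)).symm (c t)) = 1 := by
  have h1 := (chartAt EH (1 : H)).map_source (mem_chart_source EH (1 : H))
  have hl := (chartAt EH (1 : H)).left_inv (mem_chart_source EH (1 : H))
  have hφ' : MDifferentiable 𝓘(𝕜, EH) 𝓘(𝕜, EQ) φ := hφ.mdifferentiable (by simp)
  set a := chartAt EH (1 : H) 1
  set F : EH → EQ := fun z => chartAt EQ (1 : Q) (φ ((chartAt EH (1 : H)).symm z)) with hF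
  have hs : φ ((chartAt EH (1 : H)).symm a) ∈ (chartAt EQ (1 : Q)).source := by
    rw [hl, map_one]; exact mem_chart_source EQ 1
  have hFs : ContDiffAt 𝕜 ∞ F a := by
    rw [← contMDiffAt_iff_contDiffAt]
    exact (contMDiffAt_chart (𝕜 := 𝕜) hs).comp a
      (hφ.contMDiffAt.comp a (contMDiffAt_chart_symm (𝕜 := 𝕜) h1))
  have hFd : HasStrictFDerivAt F (modelDeriv 𝕜 EH EQ φ 1) a := by
    have h2 := hFs.hasStrictFDerivAt (by simp)
    obtain ⟨D, hD, hDv⟩ := hasFDerivAt_hom_chart hφ' h1 hs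
    have h3 : D = modelDeriv 𝕜 EH EQ φ 1 := by
      ext v
      have := hDv v
      rw [inverse_mcChart_self, hl, map_one, inverse_mcChart_self, leftTrans_one,
        leftTrans_one] at this
      exact this
    rwa [hD.fderiv, h3] at h2
  have hr : (modelDeriv 𝕜 EH EQ φ 1).range = ⊤ := LinearMap.range_eq_top.2 hsurj
  -- The implicit function parametrizes the fibre through the identity by the kernel of the
  -- derivative; the curve is its restriction to the line spanned by `x`.
  let k : (modelDeriv 𝕜 EH EQ φ 1).ker := ⟨x, hx⟩
  let m : 𝕜 →L[𝕜] (modelDeriv 𝕜 EH EQ φ 1).ker := ContinuousLinearMap.toSpanSingleton 𝕜 k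
  have hm0 : m 0 = 0 := map_zero m
  have hc0 : hFd.implicitFunction F _ hr (F a) (m 0) = a := by
    rw [hm0, HasStrictFDerivAt.implicitFunction_apply_image]
  have hcd : HasStrictFDerivAt (fun t => hFd.implicitFunction F _ hr (F a) (m t))
      (ContinuousLinearMap.toSpanSingleton 𝕜 x) 0 := by
    have h2 := hFd.to_implicitFunction hr
    rw [← hm0] at h2
    have h3 := h2.comp 0 m.hasStrictFDerivAt
    refine h3.congr_fderiv ?_
    ext
    simp [m, k]
  refine ⟨fun t => hFd.implicitFunction F _ hr (F a) (m t), hc0, hcd, ?_⟩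
  have hcont : Tendsto (fun t => hFd.implicitFunction F _ hr (F a) (m t)) (𝓝 0) (𝓝 a) := by
    have := hcd.continuousAt.tendsto
    rwa [hc0] at this
  have e1 : ∀ᶠ t in 𝓝 (0 : 𝕜), F (hFd.implicitFunction F _ hr (F a) (m t)) = F a := by
    have h2 : Tendsto (fun t => (F a, m t)) (𝓝 (0 : 𝕜)) (𝓝 (F a, 0)) := by
      refine tendsto_const_nhds.prodMk_nhds ?_
      have := m.continuous.tendsto 0
      rwa [hm0] at this
    exact h2.eventually (hFd.map_implicitFunction_eq hr)
  have e2 := ((tendsto_hom_chart_symm hφ').comp hcont).eventually_mem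
    ((chartAt EQ (1 : Q)).open_source.mem_nhds (mem_chart_source EQ 1))
  filter_upwards [e1, e2] with t ht1 ht2
  have h2 := (chartAt EQ (1 : Q)).injOn ht2 hs ht1
  rw [hl, map_one] at h2
  exact h2

/-- If a subgroup of `H` lies in `P`, then so do its tangent vectors. -/
theorem exists_eq_of_modelDeriv_eq_zero [PreconnectedSpace P]
    (hι : ContMDiff 𝓘(𝕜, EH) 𝓘(𝕜, EG) ∞ ι)
    (hκ : ContMDiff 𝓘(𝕜, EP) 𝓘(𝕜, EG) ∞ κ) (hκi : Function.Injective (modelDeriv 𝕜 EP EG κ 1))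
    (hφ : ContMDiff 𝓘(𝕜, EH) 𝓘(𝕜, EQ) ∞ φ)
    (hsurj : Function.Surjective (modelDeriv 𝕜 EH EQ φ 1))
    (hker : ∀ h, φ h = 1 → ∃ p, κ p = ι h) {x : EH} (hx : modelDeriv 𝕜 EH EQ φ 1 x = 0) :
    ∃ y, modelDeriv 𝕜 EP EG κ 1 y = modelDeriv 𝕜 EH EG ι 1 x := by
  -- Otherwise the curve in the kernel with velocity `x` would be transverse to `P` in `G`. Since it
  -- also stays in the image of `P`, it would yield uncountably many disjoint open sets in the
  -- separable group `P`.
  by_contra hcon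
  push Not at hcon
  obtain ⟨c, hc0, hcd, hcφ⟩ := exists_curve_in_ker hφ hsurj hx
  have hι' : MDifferentiable 𝓘(𝕜, EH) 𝓘(𝕜, EG) ι := hι.mdifferentiable (by simp)
  have hκ' : MDifferentiable 𝓘(𝕜, EP) 𝓘(𝕜, EG) κ := hκ.mdifferentiable (by simp)
  have hH := (chartAt EH (1 : H)).map_source (mem_chart_source EH (1 : H))
  have hHl := (chartAt EH (1 : H)).left_inv (mem_chart_source EH (1 : H))
  have hP := (chartAt EP (1 : P)).map_source (mem_chart_source EP (1 : P))
  have hPl := (chartAt EP (1 : P)).left_inv (mem_chart_source EP (1 : P))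
  set a := chartAt EH (1 : H) 1
  set b := chartAt EP (1 : P) 1
  set m : EP × EH → EG := fun z => chartAt EG (1 : G)
    (κ ((chartAt EP (1 : P)).symm z.1) * ι ((chartAt EH (1 : H)).symm z.2)) with hm
  have h11 : κ ((chartAt EP (1 : P)).symm b) * ι ((chartAt EH (1 : H)).symm a) = 1 := by
    rw [hPl, hHl, map_one, map_one, one_mul]
  have hms : ContDiffAt 𝕜 ∞ m (b, a) := by
    rw [← contMDiffAt_iff_contDiffAt]
    have h1 : ContMDiffAt 𝓘(𝕜, EP × EH) 𝓘(𝕜, EP) ∞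
        (fun p : EP × EH => (chartAt EP (1 : P)).symm p.1) (b, a) :=
      ContMDiffAt.comp _ (g := (chartAt EP (1 : P)).symm) (contMDiffAt_chart_symm (𝕜 := 𝕜) hP)
        contDiffAt_fst.contMDiffAt
    have h2 : ContMDiffAt 𝓘(𝕜, EP × EH) 𝓘(𝕜, EH) ∞
        (fun p : EP × EH => (chartAt EH (1 : H)).symm p.2) (b, a) :=
      ContMDiffAt.comp _ (g := (chartAt EH (1 : H)).symm) (contMDiffAt_chart_symm (𝕜 := 𝕜) hH)
        contDiffAt_snd.contMDiffAt
    refine ContMDiffAt.comp _ (g := chartAt EG (1 : G)) ?_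
      ((hκ.contMDiffAt.comp _ h1).mul (hι.contMDiffAt.comp _ h2))
    refine contMDiffAt_chart ?_
    rw [h11]
    exact mem_chart_source EG 1
  have hmd := hms.hasStrictFDerivAt (by simp)
  have hcd' : HasStrictFDerivAt (fun z : EP × 𝕜 => m (z.1, c z.2)) _ (b, (0 : 𝕜)) :=
    HasStrictFDerivAt.comp (g := m) (b, (0 : 𝕜)) (by rw [hc0]; exact hmd)
      (hasStrictFDerivAt_fst.prodMk
        (HasStrictFDerivAt.comp (g := c) (b, (0 : 𝕜)) hcd hasStrictFDerivAt_snd))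
  have d1 : ∀ u, fderiv 𝕜 m (b, a) (u, 0) = modelDeriv 𝕜 EP EG κ 1 u := by
    intro u
    have hs : κ ((chartAt EP (1 : P)).symm b) ∈ (chartAt EG (1 : G)).source := by
      rw [hPl, map_one]; exact mem_chart_source EG 1
    obtain ⟨D, hD, hDv⟩ := hasFDerivAt_hom_chart hκ' hP hs
    have h2 := HasFDerivAt.comp (g := m) (f := fun z => (z, a)) b hmd.hasFDerivAt
      (hasFDerivAt_prodMk_left b a)
    have h3 : (fun z => m (z, a)) = fun z => chartAt EG (1 : G)
        (κ ((chartAt EP (1 : P)).symm z)) := by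
      funext z
      simp only [hm, hHl, map_one, mul_one]
    simp only [Function.comp_def] at h2
    rw [h3] at h2
    have h4 := hDv u
    rw [inverse_mcChart_self, hPl, map_one, inverse_mcChart_self, leftTrans_one,
        leftTrans_one] at h4
    rw [hD.unique h2] at h4
    simpa using h4
  have d2 : ∀ w, fderiv 𝕜 m (b, a) (0, w) = modelDeriv 𝕜 EH EG ι 1 w := by
    intro w
    have hs : ι ((chartAt EH (1 : H)).symm a) ∈ (chartAt EG (1 : G)).source := by
      rw [hHl, map_one]; exact mem_chart_source EG 1
    obtain ⟨D, hD, hDv⟩ := hasFDerivAt_hom_chart hι' hH hs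
    have h2 := HasFDerivAt.comp (g := m) (f := fun z => (b, z)) a hmd.hasFDerivAt
      (hasFDerivAt_prodMk_right b a)
    have h3 : (fun z => m (b, z)) = fun z => chartAt EG (1 : G)
        (ι ((chartAt EH (1 : H)).symm z)) := by
      funext z
      simp only [hm, hPl, map_one, one_mul]
    simp only [Function.comp_def] at h2
    rw [h3] at h2
    have h4 := hDv w
    rw [inverse_mcChart_self, hHl, map_one, inverse_mcChart_self, leftTrans_one,
        leftTrans_one] at h4
    rw [hD.unique h2] at h4
    simpa using h4
  -- A kernel vector `(u, s)` with `s ≠ 0` would exhibit the image of `x` as that of `-s⁻¹ • u`,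
  -- which is excluded; if `s = 0`, injectivity of the derivative of `κ` gives `u = 0`.
  obtain ⟨W, hW, hWinj⟩ := exists_injOn_of_hasStrictFDerivAt hcd' (by
    rw [injective_iff_map_eq_zero]
    rintro ⟨u, s⟩ hus
    have h1 : modelDeriv 𝕜 EP EG κ 1 u + s • modelDeriv 𝕜 EH EG ι 1 x = 0 := by
      have h2 : ((u, s • x) : EP × EH) = (u, 0) + (0, s • x) := by simp
      have h3 : fderiv 𝕜 m (b, a) (u, s • x) = 0 := hus
      rwa [h2, map_add, d1, d2, map_smul] at h3
    have hs : s = 0 := by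
      by_contra hs
      refine hcon (-(s⁻¹ • u)) ?_
      rw [map_neg, map_smul, eq_neg_of_add_eq_zero_left h1, smul_neg, neg_neg, smul_smul,
        inv_mul_cancel₀ hs, one_smul]
    rw [hs, zero_smul, add_zero] at h1
    rw [hs, (injective_iff_map_eq_zero _).1 hκi u h1]
    rfl)
  obtain ⟨U, hU, T, hT, hUT⟩ := mem_nhds_prod_iff.1 hW
  have : IsTopologicalGroup P := topologicalGroup_of_lieGroup 𝓘(𝕜, EP) ∞
  have : TopologicalSpace.SeparableSpace P := separableSpace_of_connected_lieGroup 𝕜 (E := EP)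
  obtain ⟨U', hU'U, hU', hbU'⟩ := mem_nhds_iff.1 hU
  obtain ⟨T', hT'sub, hT', h0T'⟩ := mem_nhds_iff.1 (inter_mem hT hcφ)
  have hTp : ∀ t ∈ T', ∃ p, κ p = ι ((chartAt EH (1 : H)).symm (c t)) := fun t ht =>
    hker _ (hT'sub ht).2
  choose! p hp using hTp
  set V : Set P := (chartAt EP (1 : P)).source ∩ chartAt EP (1 : P) ⁻¹' U'
  have hV : IsOpen V := (chartAt EP (1 : P)).isOpen_inter_preimage hU'
  have h1V : (1 : P) ∈ V := ⟨mem_chart_source EP 1, hbU'⟩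
  -- Translates of `V` by distinct `p t` are disjoint. If `v * p t = v' * p t'`, applying `κ` gives
  -- `κ v * ι (c t) = κ v' * ι (c t')` in charts, and local injectivity forces `t = t'`. A separable
  -- space admits only countably many disjoint nonempty open sets.
  have hcount : T'.Countable := by
    refine Set.PairwiseDisjoint.countable_of_isOpen (s := fun t => (fun v => v * p t) '' V) ?_
      (fun t _ => (isOpenMap_mul_right (p t)) _ hV) (fun t _ => ⟨_, 1, h1V, rfl⟩)
    intro t ht t' ht' hne
    refine Set.disjoint_left.2 ?_
    rintro _ ⟨v, hv, rfl⟩ ⟨v', hv', h⟩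
    refine hne ?_
    have h1 := congr_arg κ h
    simp only [map_mul, hp t ht, hp t' ht'] at h1
    have h2 : (chartAt EP (1 : P) v, t) = (chartAt EP (1 : P) v', t') := by
      refine hWinj (hUT (Set.mk_mem_prod (hU'U hv.2) (hT'sub ht).1))
        (hUT (Set.mk_mem_prod (hU'U hv'.2) (hT'sub ht').1)) ?_
      simp only [hm, (chartAt EP (1 : P)).left_inv hv.1, (chartAt EP (1 : P)).left_inv hv'.1, h1]
    exact congr_arg Prod.snd h2
  -- A countable subset of the scalar field has dense complement, so it cannot contain the nonempty
  -- open set `T'`.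
  obtain ⟨t, ht, ht'⟩ := (hcount.dense_compl 𝕜).inter_open_nonempty T' hT' ⟨0, h0T'⟩
  exact ht' ht

end KernelOfQuotient

/-! ### Reducible subalgebras and their annihilators -/

section Orthogonal

set_option linter.unusedSectionVars false

variable {𝕜 : Type*} [RCLike 𝕜]
  {E : Type*} [NormedAddCommGroup E] [NormedSpace 𝕜 E] [FiniteDimensional 𝕜 E] [CompleteSpace E]
  {G : Type*} [Group G] [TopologicalSpace G] [ChartedSpace E G] [LieGroup 𝓘(𝕜, E) ∞ G]

/-- A Lie subalgebra as a subspace of the model space. -/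
def modelSub (𝔥 : LieSubalgebra 𝕜 (GroupLieAlgebra 𝓘(𝕜, E) G)) : Submodule 𝕜 E := 𝔥.toSubmodule

variable (B : InvariantPairing 𝕜 E G) (𝔥 : LieSubalgebra 𝕜 (GroupLieAlgebra 𝓘(𝕜, E) G))

/-- The annihilator of a Lie subalgebra as a subspace of the model space. -/
def modelPerp : Submodule 𝕜 E := perp B 𝔥

variable {B 𝔥}

theorem mem_modelPerp {y : E} : y ∈ modelPerp B 𝔥 ↔ ∀ x ∈ modelSub 𝔥, pairForm B x y = 0 :=
  Iff.rfl

/-- Nondegeneracy in finite dimension gives `𝔥^⊥⊥ = 𝔥`, so membership in `𝔥` can be tested against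
`𝔥^⊥`. -/
theorem mem_modelSub {x : E} : x ∈ modelSub 𝔥 ↔ ∀ y ∈ modelPerp B 𝔥, pairForm B x y = 0 := by
  have hfin : FiniteDimensional 𝕜 (GroupLieAlgebra 𝓘(𝕜, E) G) :=
    inferInstanceAs (FiniteDimensional 𝕜 E)
  have hrefl : B.form.IsRefl := fun x y h => (B.symm y x).trans h
  have h := LinearMap.BilinForm.orthogonal_orthogonal B.nondegenerate hrefl 𝔥.toSubmodule
  constructor
  · intro hx y hy
    exact hy x hx
  · intro hx
    have hx' : (x : GroupLieAlgebra 𝓘(𝕜, E) G) ∈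
        B.form.orthogonal (B.form.orthogonal 𝔥.toSubmodule) := fun y hy =>
      (B.symm y x).trans (hx y hy)
    rw [h] at hx'
    exact hx'

theorem lieBr_mem_modelSub {x y : E} (hx : x ∈ modelSub 𝔥) (hy : y ∈ modelSub 𝔥) :
    lieBr 𝕜 E G x y ∈ modelSub 𝔥 :=
  𝔥.lie_mem hx hy

theorem lieBr_mem_modelPerp (hred : IsReducible B 𝔥) {x y : E} (hx : x ∈ modelPerp B 𝔥)
    (hy : y ∈ modelPerp B 𝔥) : lieBr 𝕜 E G x y ∈ modelPerp B 𝔥 :=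
  hred x hx y hy

/-- This is where reducibility enters: for `z ∈ 𝔥^⊥`, invariance gives `([x, y], z) = (x, [y, z])`,
which vanishes because `[y, z] ∈ 𝔥^⊥`. -/
theorem lieBr_mem_modelSub_of_perp (hred : IsReducible B 𝔥) {x y : E} (hx : x ∈ modelSub 𝔥)
    (hy : y ∈ modelPerp B 𝔥) : lieBr 𝕜 E G x y ∈ modelSub 𝔥 := by
  refine (mem_modelSub (B := B)).2 fun z hz => ?_
  rw [pairForm_lieBr]
  exact lieBr_mem_modelPerp hred hy hz x hx

end Orthogonal

/-! ### The adjoint action of the integrating subgroup -/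

section Subgroup

set_option linter.unusedSectionVars false

variable {𝕜 : Type*} [RCLike 𝕜]
  {EG : Type*} [NormedAddCommGroup EG] [NormedSpace 𝕜 EG] [FiniteDimensional 𝕜 EG]
  [CompleteSpace EG]
  {G : Type*} [Group G] [TopologicalSpace G] [ChartedSpace EG G] [LieGroup 𝓘(𝕜, EG) ∞ G]
  {EH : Type*} [NormedAddCommGroup EH] [NormedSpace 𝕜 EH] [FiniteDimensional 𝕜 EH]
  [CompleteSpace EH]
  {H : Type*} [Group H] [TopologicalSpace H] [ChartedSpace EH H] [LieGroup 𝓘(𝕜, EH) ∞ H]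
  {B : InvariantPairing 𝕜 EG G} {𝔥 : LieSubalgebra 𝕜 (GroupLieAlgebra 𝓘(𝕜, EG) G)} {ι : H →* G}

theorem IsIntegratingSubgroup.mdifferentiable (hι : IsIntegratingSubgroup (EH := EH) ι 𝔥) :
    MDifferentiable 𝓘(𝕜, EH) 𝓘(𝕜, EG) ι :=
  hι.submanifold.smooth.mdifferentiable (by simp)

theorem IsIntegratingSubgroup.injective_modelDeriv (hι : IsIntegratingSubgroup (EH := EH) ι 𝔥)
    (h : H) : Function.Injective (modelDeriv 𝕜 EH EG ι h) :=
  hι.submanifold.immersion h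

theorem IsIntegratingSubgroup.mem_modelSub_iff (hι : IsIntegratingSubgroup (EH := EH) ι 𝔥)
    {x : EG} : x ∈ modelSub 𝔥 ↔ ∃ u, modelDeriv 𝕜 EH EG ι 1 u = x := by
  have h : modelSub 𝔥 = LinearMap.range (modelDeriv 𝕜 EH EG ι 1).toLinearMap :=
    hι.range_lieMap.symm
  rw [h]
  rfl

theorem IsIntegratingSubgroup.modelDeriv_mem (hι : IsIntegratingSubgroup (EH := EH) ι 𝔥)
    (u : EH) : modelDeriv 𝕜 EH EG ι 1 u ∈ modelSub 𝔥 :=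
  hι.mem_modelSub_iff.2 ⟨u, rfl⟩

theorem IsIntegratingSubgroup.adInv_mem_modelSub (hι : IsIntegratingSubgroup (EH := EH) ι 𝔥)
    (h : H) {x : EG} (hx : x ∈ modelSub 𝔥) : adInv 𝕜 EG (ι h) x ∈ modelSub 𝔥 := by
  obtain ⟨u, rfl⟩ := hι.mem_modelSub_iff.1 hx
  rw [← modelDeriv_hom_adInv hι.mdifferentiable]
  exact hι.modelDeriv_mem _

/-- The adjoint action of `H` preserves both `𝔥` and the pairing, hence also the annihilator. -/
theorem IsIntegratingSubgroup.adInv_mem_modelPerp (hι : IsIntegratingSubgroup (EH := EH) ι 𝔥)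
    (h : H) {y : EG} (hy : y ∈ modelPerp B 𝔥) : adInv 𝕜 EG (ι h) y ∈ modelPerp B 𝔥 := by
  refine mem_modelPerp.2 fun x hx => ?_
  have h1 := pairForm_adInv B (ι h) (adInv 𝕜 EG (ι h)⁻¹ x) y
  rw [adInv_adInv_inv] at h1
  rw [h1]
  have h2 := hι.adInv_mem_modelSub h⁻¹ hx
  rw [map_inv] at h2
  exact mem_modelPerp.1 hy _ h2

theorem IsIntegratingSubgroup.modelDeriv_adInv_comp (hι : IsIntegratingSubgroup (EH := EH) ι 𝔥)
    (ξ : EG) (h : H) (v : EH) :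
    modelDeriv 𝕜 EH EG (fun s => adInv 𝕜 EG (ι s) ξ) h v
      = -lieBr 𝕜 EG G (modelDeriv 𝕜 EH EG ι 1 (mcForm 𝕜 EH h v)) (adInv 𝕜 EG (ι h) ξ) := by
  rw [← modelDeriv_adInv_apply, ← modelDeriv_hom_leftTrans hι.mdifferentiable, leftTrans_mcForm]
  exact DFunLike.congr_fun (modelDeriv_comp (g := fun g : G => adInv 𝕜 EG g ξ)
    (mdifferentiable_adInv_apply ξ (ι h)) (hι.mdifferentiable h)) v

theorem IsIntegratingSubgroup.contMDiff_adInv_comp (hι : IsIntegratingSubgroup (EH := EH) ι 𝔥)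
    (ξ : EG) : ContMDiff 𝓘(𝕜, EH) 𝓘(𝕜, EG) ∞ (fun s => adInv 𝕜 EG (ι s) ξ) :=
  (contMDiff_adInv_apply ξ).comp hι.submanifold.smooth

/-- The subgroup acts trivially on the annihilator modulo the intersection. -/
theorem IsIntegratingSubgroup.sub_adInv_mem_modelSub (hι : IsIntegratingSubgroup (EH := EH) ι 𝔥)
    (hred : IsReducible B 𝔥) (h : H) {ξ : EG} (hξ : ξ ∈ modelPerp B 𝔥) :
    ξ - adInv 𝕜 EG (ι h) ξ ∈ modelSub 𝔥 := by
  refine (mem_modelSub (B := B)).2 fun η hη => ?_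
  have hconn := hι.connected
  have hd : MDifferentiable 𝓘(𝕜, EH) 𝓘(𝕜, EG) (fun s => adInv 𝕜 EG (ι s) ξ) :=
    (hι.contMDiff_adInv_comp ξ).mdifferentiable (by simp)
  -- Along `H`, the derivative of `(η, Ad_{s⁻¹} ξ)` is minus the pairing of `η` with a bracket from
  -- `[𝔥, 𝔥^⊥] ⊆ 𝔥`, hence zero. On the connected group `H` the function keeps its value at the
  -- identity.
  have key := eq_of_modelDeriv_eq_zero (𝕜 := 𝕜) (M := H)
    (f := fun s => pairForm B η (adInv 𝕜 EG (ι s) ξ))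
    (fun s => (pairForm B η).differentiableAt.mdifferentiableAt.comp s (hd s)) (fun s => by
      ext v
      have h1 := DFunLike.congr_fun (modelDeriv_comp (𝕜 := 𝕜) (x := s) (g := pairForm B η)
        (pairForm B η).differentiableAt.mdifferentiableAt (hd s)) v
      rw [modelDeriv_eq_fderiv, ContinuousLinearMap.fderiv, ContinuousLinearMap.comp_apply,
        hι.modelDeriv_adInv_comp, map_neg, pairForm_symm,
        mem_modelPerp.1 hη _ (lieBr_mem_modelSub_of_perp hred (hι.modelDeriv_mem _)
          (hι.adInv_mem_modelPerp s hξ)), neg_zero] at h1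
      exact h1) 1 h
  simp only [map_one, adInv_one, ContinuousLinearMap.id_apply] at key
  rw [pairForm_symm, map_sub, ← key, sub_self]

theorem IsIntegratingSubgroup.sub_adInv_mem_modelPerp (hι : IsIntegratingSubgroup (EH := EH) ι 𝔥)
    (h : H) {ξ : EG} (hξ : ξ ∈ modelPerp B 𝔥) :
    ξ - adInv 𝕜 EG (ι h) ξ ∈ modelPerp B 𝔥 :=
  sub_mem hξ (hι.adInv_mem_modelPerp h hξ)

end Subgroup

/-! ### The pairing on the quotient Lie algebra -/

section InducedPairing

set_option linter.unusedSectionVars false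

variable {𝕜 : Type*} [RCLike 𝕜]
  {EG : Type*} [NormedAddCommGroup EG] [NormedSpace 𝕜 EG] [FiniteDimensional 𝕜 EG]
  [CompleteSpace EG]
  {G : Type*} [Group G] [TopologicalSpace G] [ChartedSpace EG G] [LieGroup 𝓘(𝕜, EG) ∞ G]
  {EH : Type*} [NormedAddCommGroup EH] [NormedSpace 𝕜 EH] [FiniteDimensional 𝕜 EH]
  [CompleteSpace EH]
  {H : Type*} [Group H] [TopologicalSpace H] [ChartedSpace EH H] [LieGroup 𝓘(𝕜, EH) ∞ H]
  {EP : Type*} [NormedAddCommGroup EP] [NormedSpace 𝕜 EP] [FiniteDimensional 𝕜 EP]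
  [CompleteSpace EP]
  {P : Type*} [Group P] [TopologicalSpace P] [ChartedSpace EP P] [LieGroup 𝓘(𝕜, EP) ∞ P]
  {EQ : Type*} [NormedAddCommGroup EQ] [NormedSpace 𝕜 EQ] [FiniteDimensional 𝕜 EQ]
  [CompleteSpace EQ]
  {Q : Type*} [Group Q] [TopologicalSpace Q] [ChartedSpace EQ Q] [LieGroup 𝓘(𝕜, EQ) ∞ Q]
  {B : InvariantPairing 𝕜 EG G} {𝔥 : LieSubalgebra 𝕜 (GroupLieAlgebra 𝓘(𝕜, EG) G)}
  {ι : H →* G} {κ : P →* G} {φ : H →* Q}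

theorem IsQuotientLieGroup.mdifferentiable {N : Subgroup H}
    (hφ : IsQuotientLieGroup 𝕜 EH EQ φ N) : MDifferentiable 𝓘(𝕜, EH) 𝓘(𝕜, EQ) φ :=
  hφ.smooth.mdifferentiable (by simp)

theorem IsQuotientLieGroup.surjective_modelDeriv {N : Subgroup H}
    (hφ : IsQuotientLieGroup 𝕜 EH EQ φ N) (h : H) :
    Function.Surjective (modelDeriv 𝕜 EH EQ φ h) :=
  hφ.submersion h

/-- The kernel of the derivative of the quotient map is the intersection of the subalgebra with its
annihilator. -/
theorem modelDeriv_quotient_eq_zero_iff {hred : IsReducible B 𝔥}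
    (hι : IsIntegratingSubgroup (EH := EH) ι 𝔥)
    (hκ : IsIntegratingSubgroup (EH := EP) κ (perpLie B 𝔥 hred))
    (hφ : IsQuotientLieGroup 𝕜 EH EQ φ (κ.range.comap ι)) (x : EH) :
    modelDeriv 𝕜 EH EQ φ 1 x = 0 ↔ modelDeriv 𝕜 EH EG ι 1 x ∈ modelPerp B 𝔥 := by
  have hker : ∀ h, φ h = 1 ↔ ∃ p, κ p = ι h := fun h => by
    rw [← MonoidHom.mem_ker, hφ.ker_eq]
    rfl
  have hκr : ∀ y : EG, y ∈ modelPerp B 𝔥 ↔ ∃ u, modelDeriv 𝕜 EP EG κ 1 u = y := fun y =>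
    hκ.mem_modelSub_iff
  have := hκ.connected
  rw [hκr]
  -- Forward is the countability argument in `P`; backward is uniqueness of integral curves.
  constructor
  · exact exists_eq_of_modelDeriv_eq_zero hι.submanifold.smooth hκ.submanifold.smooth
      (hκ.injective_modelDeriv 1) hφ.smooth (hφ.surjective_modelDeriv 1) fun h => (hker h).1
  · rintro ⟨y, hy⟩
    exact modelDeriv_eq_zero_of_eq hι.mdifferentiable hκ.mdifferentiable hφ.mdifferentiable
      (fun h p e => (hker h).2 ⟨p, e.symm⟩) hy.symm

/-- The pairing induced on the Lie algebra of the quotient. -/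
theorem exists_inducedPairing {hred : IsReducible B 𝔥}
    (hι : IsIntegratingSubgroup (EH := EH) ι 𝔥)
    (hκ : IsIntegratingSubgroup (EH := EP) κ (perpLie B 𝔥 hred))
    (hφ : IsQuotientLieGroup 𝕜 EH EQ φ (κ.range.comap ι)) :
    ∃ Bq : InvariantPairing 𝕜 EQ Q, ∀ x y : EH,
      pairForm Bq (modelDeriv 𝕜 EH EQ φ 1 x) (modelDeriv 𝕜 EH EQ φ 1 y)
        = pairForm B (modelDeriv 𝕜 EH EG ι 1 x) (modelDeriv 𝕜 EH EG ι 1 y) := by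
  set l := modelDeriv 𝕜 EH EG ι 1
  set π := modelDeriv 𝕜 EH EQ φ 1
  have hsurj : Function.Surjective π := hφ.surjective_modelDeriv 1
  -- The form is defined through a linear section of the projection. The section is auxiliary, since
  -- changing a lift alters it by an element of `𝔥 ∩ 𝔥^⊥`, which is invisible to the pairing on `𝔥`.
  obtain ⟨s, hs⟩ := π.toLinearMap.exists_rightInverse_of_surjective
    (LinearMap.range_eq_top.2 hsurj)
  have hs' : ∀ u, π (s u) = u := fun u => LinearMap.congr_fun hs u
  let b : EQ →ₗ[𝕜] EQ →ₗ[𝕜] 𝕜 :=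
    (B.form : EG →ₗ[𝕜] EG →ₗ[𝕜] 𝕜).compl₁₂ (l.toLinearMap ∘ₗ s) (l.toLinearMap ∘ₗ s)
  have hb0 : ∀ u v, b u v = pairForm B (l (s u)) (l (s v)) := fun _ _ => rfl
  have hsub : ∀ x, l (s (π x)) - l x ∈ modelPerp B 𝔥 := fun x => by
    rw [← map_sub]
    refine (modelDeriv_quotient_eq_zero_iff hι hκ hφ _).1 ?_
    rw [map_sub]
    exact sub_eq_zero.2 (hs' _)
  have hb : ∀ x y, b (π x) (π y) = pairForm B (l x) (l y) := by
    intro x y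
    have h1 := hsub y _ (hι.modelDeriv_mem (s (π x)))
    have h2 := hsub x _ (hι.modelDeriv_mem y)
    change pairForm B (l (s (π x))) (l (s (π y)) - l y) = 0 at h1
    change pairForm B (l y) (l (s (π x)) - l x) = 0 at h2
    rw [map_sub, sub_eq_zero] at h1 h2
    rw [hb0, h1, pairForm_symm, h2, pairForm_symm]
  have hsymm : ∀ u v, b u v = b v u := fun u v => by rw [hb0, hb0, pairForm_symm]
  -- A lift of a null vector is orthogonal to all of `𝔥`, hence lies in `𝔥^⊥`, and is therefore
  -- killed by the projection.
  have hsep : ∀ u, (∀ v, b u v = 0) → u = 0 := by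
    intro u hu
    obtain ⟨x, rfl⟩ := hsurj u
    refine (modelDeriv_quotient_eq_zero_iff hι hκ hφ x).2 (mem_modelPerp.2 fun z hz => ?_)
    obtain ⟨y, rfl⟩ := hι.mem_modelSub_iff.1 hz
    rw [pairForm_symm]
    exact (hb x y).symm.trans (hu _)
  have hlie : ∀ u v w, b (lieBr 𝕜 EQ Q u v) w = b u (lieBr 𝕜 EQ Q v w) := by
    intro u v w
    obtain ⟨x, rfl⟩ := hsurj u
    obtain ⟨y, rfl⟩ := hsurj v
    obtain ⟨z, rfl⟩ := hsurj w
    rw [← modelDeriv_hom_lieBr hφ.mdifferentiable, ← modelDeriv_hom_lieBr hφ.mdifferentiable,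
      hb, hb, modelDeriv_hom_lieBr hι.mdifferentiable, modelDeriv_hom_lieBr hι.mdifferentiable,
      pairForm_lieBr]
  -- Every element of the quotient lifts to `H`, so invariance under its adjoint action comes from
  -- that of `G`.
  have hAd : ∀ (q : Q) (u v), b (adInv 𝕜 EQ q u) (adInv 𝕜 EQ q v) = b u v := by
    intro q u v
    obtain ⟨h, rfl⟩ := hφ.surjective q
    obtain ⟨x, rfl⟩ := hsurj u
    obtain ⟨y, rfl⟩ := hsurj v
    rw [← modelDeriv_hom_adInv hφ.mdifferentiable, ← modelDeriv_hom_adInv hφ.mdifferentiable,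
      hb, hb, modelDeriv_hom_adInv hι.mdifferentiable, modelDeriv_hom_adInv hι.mdifferentiable,
      pairForm_adInv]
  refine ⟨⟨b, hsymm, ⟨hsep, fun u hu => hsep u fun v => (hsymm u v).trans (hu v)⟩, hlie,
    fun q u v => ?_⟩, hb⟩
  have h := Ad_eq_adInv_inv (𝕜 := 𝕜) (E := EQ) q
  exact (congr_arg₂ (fun x y : EQ => b x y) (DFunLike.congr_fun h u)
    (DFunLike.congr_fun h v)).trans (hAd q⁻¹ u v)

end InducedPairing

/-! ### The subgroup as a generalized reduction level -/

section ReductionLevel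

set_option linter.unusedSectionVars false

variable {𝕜 : Type*} [RCLike 𝕜]
  {EG : Type*} [NormedAddCommGroup EG] [NormedSpace 𝕜 EG] [FiniteDimensional 𝕜 EG]
  [CompleteSpace EG]
  {G : Type*} [Group G] [TopologicalSpace G] [ChartedSpace EG G] [LieGroup 𝓘(𝕜, EG) ∞ G]
  {EH : Type*} [NormedAddCommGroup EH] [NormedSpace 𝕜 EH] [FiniteDimensional 𝕜 EH]
  [CompleteSpace EH]
  {H : Type*} [Group H] [TopologicalSpace H] [ChartedSpace EH H] [LieGroup 𝓘(𝕜, EH) ∞ H]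
  {EQ : Type*} [NormedAddCommGroup EQ] [NormedSpace 𝕜 EQ] [FiniteDimensional 𝕜 EQ]
  [CompleteSpace EQ]
  {Q : Type*} [Group Q] [TopologicalSpace Q] [ChartedSpace EQ Q] [LieGroup 𝓘(𝕜, EQ) ∞ Q]
  {B : InvariantPairing 𝕜 EG G} {Bq : InvariantPairing 𝕜 EQ Q}
  {𝔥 : LieSubalgebra 𝕜 (GroupLieAlgebra 𝓘(𝕜, EG) G)}
  {ι : H →* G} {φ : H →* Q} {N : Subgroup H}

theorem modelDeriv_hom_eq_zero_iff {f : H →* Q}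
    (hf : MDifferentiable 𝓘(𝕜, EH) 𝓘(𝕜, EQ) f) (h : H) (u : EH) :
    modelDeriv 𝕜 EH EQ f h u = 0 ↔ modelDeriv 𝕜 EH EQ f 1 (mcForm 𝕜 EH h u) = 0 := by
  rw [← mcForm_modelDeriv_hom hf]
  refine ⟨fun e => by rw [e, map_zero], fun e => ?_⟩
  rw [← leftTrans_mcForm (𝕜 := 𝕜) (f h) (modelDeriv 𝕜 EH EQ f h u), e, map_zero]

/-- With `A = adInv` at `ι h`, being tangent to the fibres of `φ` puts `ξ - Aξ` in `𝔥^⊥`, and a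
covector vanishing on `TH` puts `½(ξ + Aξ)` there; together they give `ξ ∈ 𝔥^⊥`. Conversely, for `ξ
∈ 𝔥^⊥` the vector `ξ - Aξ` lies in `𝔥 ∩ 𝔥^⊥`, so it is tangent to `H` and vertical. -/
theorem mem_stabilizer_iff (hι : IsIntegratingSubgroup (EH := EH) ι 𝔥) (hred : IsReducible B 𝔥)
    (hφ : IsQuotientLieGroup 𝕜 EH EQ φ N)
    (hker : ∀ x, modelDeriv 𝕜 EH EQ φ 1 x = 0 ↔ modelDeriv 𝕜 EH EG ι 1 x ∈ modelPerp B 𝔥)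
    (h : H) (p : GenTangent 𝕜 EG (ι h)) :
    p ∈ stabilizer (EZ := EQ) (cartanDirac B) ι (0 : FormField 𝕜 EH H 2) φ h ↔
      ∃ ξ ∈ modelPerp B 𝔥, cartanDiracMap B (ι h) ξ = p := by
  have hflat : ∀ u : EH, flat ((0 : FormField 𝕜 EH H 2) h) u = 0 := fun u => by
    refine ContinuousLinearMap.ext fun w => ?_
    rfl
  constructor
  · rintro ⟨⟨ξ', rfl⟩, u, h1, h2, h3⟩
    obtain ⟨ξ, rfl⟩ : ∃ ξ : EG, ξ = ξ' := ⟨ξ', rfl⟩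
    refine ⟨ξ, ?_, rfl⟩
    have e1 : modelDeriv 𝕜 EH EG ι 1 (mcForm 𝕜 EH h u) = ξ - adInv 𝕜 EG (ι h) ξ :=
      (mcForm_modelDeriv_hom hι.mdifferentiable h u).symm.trans
        ((congr_arg (mcForm 𝕜 EG (ι h)) h1).trans (mcForm_fst_cartanDiracMap B (ι h) ξ))
    have m1 : ξ - adInv 𝕜 EG (ι h) ξ ∈ modelPerp B 𝔥 := by
      rw [← e1]
      exact (hker _).1 ((modelDeriv_hom_eq_zero_iff hφ.mdifferentiable h u).1 h2)
    have m2 : (1 / 2 : 𝕜) • (ξ + adInv 𝕜 EG (ι h) ξ) ∈ modelPerp B 𝔥 := by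
      refine mem_modelPerp.2 fun z hz => ?_
      obtain ⟨w, rfl⟩ := hι.mem_modelSub_iff.1 hz
      have h4 : (cartanDiracMap B (ι h) ξ).2 (modelDeriv 𝕜 EH EG ι h (leftTrans 𝕜 EH h w)) = 0 :=
        DFunLike.congr_fun (h3.trans (hflat u)) (leftTrans 𝕜 EH h w)
      have h5 := (snd_cartanDiracMap B (ι h) ξ _).symm.trans h4
      rwa [mcForm_modelDeriv_hom hι.mdifferentiable, mcForm_leftTrans, pairForm_symm] at h5
    have e2 : ξ = (1 / 2 : 𝕜) • (ξ + adInv 𝕜 EG (ι h) ξ)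
        + (1 / 2 : 𝕜) • (ξ - adInv 𝕜 EG (ι h) ξ) := by module
    rw [e2]
    exact add_mem m2 (Submodule.smul_mem _ _ m1)
  · rintro ⟨ξ, hξ, rfl⟩
    obtain ⟨w, hw⟩ := hι.mem_modelSub_iff.1 (hι.sub_adInv_mem_modelSub hred h hξ)
    refine ⟨LinearMap.mem_range_self _ _, leftTrans 𝕜 EH h w, ?_, ?_, ?_⟩
    · refine (modelDeriv_hom_leftTrans hι.mdifferentiable h w).trans ?_
      rw [hw]
      exact (fst_cartanDiracMap B (ι h) ξ).symm
    · refine (modelDeriv_hom_eq_zero_iff hφ.mdifferentiable h _).2 ?_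
      rw [mcForm_leftTrans, hker, hw]
      exact hι.sub_adInv_mem_modelPerp h hξ
    · refine Eq.trans ?_ (hflat _).symm
      refine ContinuousLinearMap.ext fun (v : EH) => ?_
      refine (snd_cartanDiracMap B (ι h) ξ (modelDeriv 𝕜 EH EG ι h v)).trans ?_
      rw [mcForm_modelDeriv_hom hι.mdifferentiable, pairForm_symm]
      exact mem_modelPerp.1 (Submodule.smul_mem _ _ (add_mem hξ (hι.adInv_mem_modelPerp h hξ))) _
        (hι.modelDeriv_mem _)

theorem stabilizer_eq_map (hι : IsIntegratingSubgroup (EH := EH) ι 𝔥) (hred : IsReducible B 𝔥)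
    (hφ : IsQuotientLieGroup 𝕜 EH EQ φ N)
    (hker : ∀ x, modelDeriv 𝕜 EH EQ φ 1 x = 0 ↔ modelDeriv 𝕜 EH EG ι 1 x ∈ modelPerp B 𝔥) (h : H) :
    stabilizer (EZ := EQ) (cartanDirac B) ι (0 : FormField 𝕜 EH H 2) φ h
      = (perp B 𝔥).map (cartanDiracMap B (ι h)) := by
  ext p
  exact mem_stabilizer_iff hι hred hφ hker h p

theorem mem_pushforward_iff (h : H) (p : GenTangent 𝕜 EQ (φ h)) :
    p ∈ pushforward (mfderiv 𝓘(𝕜, EH) 𝓘(𝕜, EQ) φ h)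
      (gauge (-(0 : FormField 𝕜 EH H 2) h)
        (pullback (mfderiv 𝓘(𝕜, EH) 𝓘(𝕜, EG) ι h) (cartanDirac B (ι h)))) ↔
    ∃ (v : EH) (α : Cotangent 𝕜 EG (ι h)), modelDeriv 𝕜 EH EQ φ h v = p.1 ∧
      (∀ u : EH, p.2 (modelDeriv 𝕜 EH EQ φ h u) = α (modelDeriv 𝕜 EH EG ι h u)) ∧
      ((modelDeriv 𝕜 EH EG ι h v, α) : GenTangent 𝕜 EG (ι h)) ∈ cartanDirac B (ι h) := by
  have hflat : ∀ u : TangentSpace 𝓘(𝕜, EH) h, flat (-(0 : FormField 𝕜 EH H 2) h) u = 0 := by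
    intro u
    refine ContinuousLinearMap.ext fun w => ?_
    exact neg_zero (G := 𝕜)
  constructor
  · rintro ⟨v, h1, α, h2, h3⟩
    refine ⟨v, α, h1, fun u => ?_, h3⟩
    have h4 : p.2.comp (mfderiv 𝓘(𝕜, EH) 𝓘(𝕜, EQ) φ h)
        - flat (-(0 : FormField 𝕜 EH H 2) h) v = _ := h2
    rw [hflat, sub_zero] at h4
    exact DFunLike.congr_fun h4 u
  · rintro ⟨v, α, h1, h2, h3⟩
    refine ⟨v, h1, α, ?_, h3⟩
    change p.2.comp (mfderiv 𝓘(𝕜, EH) 𝓘(𝕜, EQ) φ h)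
        - flat (-(0 : FormField 𝕜 EH H 2) h) v = _
    exact ((congr_arg _ (hflat v)).trans (sub_zero _)).trans (ContinuousLinearMap.ext h2)

/-- Lifting a parameter from the quotient to `𝔥` and including it in `𝔤` gives an element of `L_G`
over it, because homomorphisms respect translations and adjoint actions. Equality then costs no
dimension count: pairings of pushed-forward elements are computed in `G`, where they vanish, and the
target is Lagrangian. -/
theorem pushforward_eq_cartanDirac (hι : IsIntegratingSubgroup (EH := EH) ι 𝔥)
    (hφ : IsQuotientLieGroup 𝕜 EH EQ φ N)
    (hBq : ∀ x y : EH, pairForm Bq (modelDeriv 𝕜 EH EQ φ 1 x) (modelDeriv 𝕜 EH EQ φ 1 y)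
        = pairForm B (modelDeriv 𝕜 EH EG ι 1 x) (modelDeriv 𝕜 EH EG ι 1 y)) (h : H) :
    pushforward (mfderiv 𝓘(𝕜, EH) 𝓘(𝕜, EQ) φ h)
      (gauge (-(0 : FormField 𝕜 EH H 2) h)
        (pullback (mfderiv 𝓘(𝕜, EH) 𝓘(𝕜, EG) ι h) (cartanDirac B (ι h))))
      = cartanDirac Bq (φ h) := by
  have hι' := hι.mdifferentiable
  have hφ' := hφ.mdifferentiable
  have hle : cartanDirac Bq (φ h) ≤ pushforward (mfderiv 𝓘(𝕜, EH) 𝓘(𝕜, EQ) φ h)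
      (gauge (-(0 : FormField 𝕜 EH H 2) h)
        (pullback (mfderiv 𝓘(𝕜, EH) 𝓘(𝕜, EG) ι h) (cartanDirac B (ι h)))) := by
    have key : ∀ x : EH, cartanDiracMap Bq (φ h) (modelDeriv 𝕜 EH EQ φ 1 x) ∈
        pushforward (mfderiv 𝓘(𝕜, EH) 𝓘(𝕜, EQ) φ h)
      (gauge (-(0 : FormField 𝕜 EH H 2) h)
        (pullback (mfderiv 𝓘(𝕜, EH) 𝓘(𝕜, EG) ι h) (cartanDirac B (ι h)))) := by
      intro x
      refine (mem_pushforward_iff h _).2 ⟨leftTrans 𝕜 EH h (x - adInv 𝕜 EH h x),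
        (cartanDiracMap B (ι h) (modelDeriv 𝕜 EH EG ι 1 x)).2, ?_, fun u => ?_, ?_⟩
      · refine Eq.trans ?_ (fst_cartanDiracMap Bq (φ h) _).symm
        rw [modelDeriv_hom_leftTrans hφ', map_sub, modelDeriv_hom_adInv hφ']
      · refine (snd_cartanDiracMap Bq (φ h) _ _).trans
          (Eq.trans ?_ (snd_cartanDiracMap B (ι h) _ _).symm)
        rw [mcForm_modelDeriv_hom hι', mcForm_modelDeriv_hom hφ', ← modelDeriv_hom_adInv hι',
          ← modelDeriv_hom_adInv hφ', ← map_add, ← map_add, ← map_smul, ← map_smul, hBq]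
      · refine ⟨modelDeriv 𝕜 EH EG ι 1 x, Prod.ext ?_ rfl⟩
        refine (fst_cartanDiracMap B (ι h) _).trans ?_
        refine Eq.trans ?_ (modelDeriv_hom_leftTrans hι' h _).symm
        rw [map_sub (modelDeriv 𝕜 EH EG ι 1), modelDeriv_hom_adInv hι']
    rintro _ ⟨u, rfl⟩
    obtain ⟨x, hx⟩ := hφ.surjective_modelDeriv 1 u
    rw [← hx]
    exact key x
  refine le_antisymm (fun p hp => ?_) hle
  refine (isLagrangian_cartanDirac Bq (φ h) p).2 fun q hq => ?_
  obtain ⟨v, α, h1, h2, h3⟩ := (mem_pushforward_iff h p).1 hp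
  obtain ⟨w, β, k1, k2, k3⟩ := (mem_pushforward_iff h q).1 (hle hq)
  have h4 := (isLagrangian_cartanDirac B (ι h) _).1 h3 _ k3
  have h5 : p.2 q.1 + q.2 p.1 = 0 := by
    rw [← h1, ← k1]
    exact (congr_arg₂ (· + ·) (h2 w) (k2 v)).trans h4
  exact h5

theorem isGeneralizedReductionLevel (hι : IsIntegratingSubgroup (EH := EH) ι 𝔥)
    (hred : IsReducible B 𝔥) (hφ : IsQuotientLieGroup 𝕜 EH EQ φ N)
    (hker : ∀ x, modelDeriv 𝕜 EH EQ φ 1 x = 0 ↔ modelDeriv 𝕜 EH EG ι 1 x ∈ modelPerp B 𝔥)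
    (hBq : ∀ x y : EH, pairForm Bq (modelDeriv 𝕜 EH EQ φ 1 x) (modelDeriv 𝕜 EH EQ φ 1 y)
        = pairForm B (modelDeriv 𝕜 EH EG ι 1 x) (modelDeriv 𝕜 EH EG ι 1 y)) :
    IsGeneralizedReductionLevel (-cartanForm B) (cartanDirac B) ι (0 : FormField 𝕜 EH H 2) φ
      (-cartanForm Bq) (cartanDirac Bq) where
  dirac_source := isDirac_cartanDirac B
  dirac_target := isDirac_cartanDirac Bq
  submanifold := hι.submanifold
  smooth_form := fun x₀ => by
    have h : chartForm (0 : FormField 𝕜 EH H 2) x₀ = fun _ => 0 := by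
      funext y
      ext v
      rfl
    rw [h]
    exact contDiffOn_const
  smooth_map := hφ.smooth
  constant_rank_map := ⟨Module.finrank 𝕜 EQ, fun h => by
    have h1 : LinearMap.range (modelDeriv 𝕜 EH EQ φ h).toLinearMap = ⊤ :=
      LinearMap.range_eq_top.2 (hφ.surjective_modelDeriv h)
    have h2 : Module.finrank 𝕜 (LinearMap.range (modelDeriv 𝕜 EH EQ φ h).toLinearMap)
        = Module.finrank 𝕜 EQ := by rw [h1, finrank_top]
    exact h2⟩
  push := pushforward_eq_cartanDirac hι hφ hBq
  constant_rank := ⟨Module.finrank 𝕜 (perp B 𝔥), fun h => by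
    rw [stabilizer_eq_map hι hred hφ hker]
    exact (Submodule.equivMapOfInjective _ (cartanDiracMap_injective B (ι h))
      (perp B 𝔥)).finrank_eq.symm⟩
  -- The trivialized tangent part lies in `𝔥^⊥`, and it is paired with a bracket of two elements of
  -- `𝔥`, which stays in `𝔥`.
  kernel := fun h u α hu a b => by
    obtain ⟨-, u', h1, h2, -⟩ := hu
    obtain rfl : u' = u := hι.submanifold.immersion h h1
    have m1 := (hker _).1 ((modelDeriv_hom_eq_zero_iff hφ.mdifferentiable h u').1 h2)
    have h3 : ∀ u a b : EH, modelDeriv 𝕜 EH EG ι 1 (mcForm 𝕜 EH h u) ∈ modelPerp B 𝔥 →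
        triForm B (mcForm 𝕜 EG (ι h) (modelDeriv 𝕜 EH EG ι h u))
          (mcForm 𝕜 EG (ι h) (modelDeriv 𝕜 EH EG ι h a))
          (mcForm 𝕜 EG (ι h) (modelDeriv 𝕜 EH EG ι h b)) = 0 := by
      intro u a b m1
      rw [mcForm_modelDeriv_hom hι.mdifferentiable, mcForm_modelDeriv_hom hι.mdifferentiable,
        mcForm_modelDeriv_hom hι.mdifferentiable, triForm, pairForm_symm]
      exact mem_modelPerp.1 m1 _ (lieBr_mem_modelSub (hι.modelDeriv_mem _) (hι.modelDeriv_mem _))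
    rw [extDerivForm_zero, add_zero]
    have h4 : ((-cartanForm B) (ι h)).compContinuousLinearMap
        (mfderiv 𝓘(𝕜, EH) 𝓘(𝕜, EG) ι h) ![u', a, b] = -((1 / 2 : 𝕜) *
        triForm B (mcForm 𝕜 EG (ι h) (modelDeriv 𝕜 EH EG ι h u'))
        (mcForm 𝕜 EG (ι h) (modelDeriv 𝕜 EH EG ι h a))
        (mcForm 𝕜 EG (ι h) (modelDeriv 𝕜 EH EG ι h b))) := rfl
    rw [h4]
    exact neg_eq_zero.2 (mul_eq_zero_of_right _ (h3 u' a b m1))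

end ReductionLevel

/-! ### The conjugation action and the stabilizer subalgebroid -/

section ConjugationAction

set_option linter.unusedSectionVars false

variable {𝕜 : Type*} [RCLike 𝕜]
  {EG : Type*} [NormedAddCommGroup EG] [NormedSpace 𝕜 EG] [FiniteDimensional 𝕜 EG]
  [CompleteSpace EG]
  {G : Type*} [Group G] [TopologicalSpace G] [ChartedSpace EG G] [LieGroup 𝓘(𝕜, EG) ∞ G]
  {EH : Type*} [NormedAddCommGroup EH] [NormedSpace 𝕜 EH] [FiniteDimensional 𝕜 EH]
  [CompleteSpace EH]
  {H : Type*} [Group H] [TopologicalSpace H] [ChartedSpace EH H] [LieGroup 𝓘(𝕜, EH) ∞ H]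
  {EQ : Type*} [NormedAddCommGroup EQ] [NormedSpace 𝕜 EQ] [FiniteDimensional 𝕜 EQ]
  [CompleteSpace EQ]
  {Q : Type*} [Group Q] [TopologicalSpace Q] [ChartedSpace EQ Q] [LieGroup 𝓘(𝕜, EQ) ∞ Q]
  {B : InvariantPairing 𝕜 EG G}
  {𝔥 : LieSubalgebra 𝕜 (GroupLieAlgebra 𝓘(𝕜, EG) G)}
  {ι : H →* G} {φ : H →* Q} {N : Subgroup H}

/-- The vector field `ξ^L - ξ^R` on a subgroup, where `r` is a left inverse of the inclusion of Lie
algebras. -/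
def conjField (𝕜 : Type*) [RCLike 𝕜] {EG : Type*} [NormedAddCommGroup EG] [NormedSpace 𝕜 EG]
    {G : Type*} [Group G] [TopologicalSpace G] [ChartedSpace EG G]
    {EH : Type*} [NormedAddCommGroup EH] [NormedSpace 𝕜 EH]
    {H : Type*} [Group H] [TopologicalSpace H] [ChartedSpace EH H]
    (ι : H →* G) (r : EG →L[𝕜] EH) (h : H) : EG →L[𝕜] EH :=
  (leftTrans 𝕜 EH h).comp (r.comp (ContinuousLinearMap.id 𝕜 EG - adInv 𝕜 EG (ι h)))

theorem conjField_apply (r : EG →L[𝕜] EH) (h : H) (ξ : EG) :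
    conjField 𝕜 ι r h ξ = leftTrans 𝕜 EH h (r (ξ - adInv 𝕜 EG (ι h) ξ)) := rfl

theorem mcForm_conjField (r : EG →L[𝕜] EH) (h : H) (ξ : EG) :
    mcForm 𝕜 EH h (conjField 𝕜 ι r h ξ) = r (ξ - adInv 𝕜 EG (ι h) ξ) := by
  rw [conjField_apply, mcForm_leftTrans]

variable {r : EG →L[𝕜] EH}

theorem modelDeriv_one_leftInverse (hι : IsIntegratingSubgroup (EH := EH) ι 𝔥)
    (hr : ∀ u, r (modelDeriv 𝕜 EH EG ι 1 u) = u) {x : EG} (hx : x ∈ modelSub 𝔥) :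
    modelDeriv 𝕜 EH EG ι 1 (r x) = x := by
  obtain ⟨u, rfl⟩ := hι.mem_modelSub_iff.1 hx
  rw [hr]

theorem modelDeriv_conjField (hι : IsIntegratingSubgroup (EH := EH) ι 𝔥)
    (hr : ∀ u, r (modelDeriv 𝕜 EH EG ι 1 u) = u) (hred : IsReducible B 𝔥) (h : H) {ξ : EG}
    (hξ : ξ ∈ modelPerp B 𝔥) :
    modelDeriv 𝕜 EH EG ι h (conjField 𝕜 ι r h ξ)
      = leftTrans 𝕜 EG (ι h) (ξ - adInv 𝕜 EG (ι h) ξ) := by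
  rw [conjField_apply, modelDeriv_hom_leftTrans hι.mdifferentiable,
    modelDeriv_one_leftInverse hι hr (hι.sub_adInv_mem_modelSub hred h hξ)]

theorem contMDiff_mcForm_conjField (hι : IsIntegratingSubgroup (EH := EH) ι 𝔥) (ξ : EG) :
    ContMDiff 𝓘(𝕜, EH) 𝓘(𝕜, EH) ∞ (fun s => mcForm 𝕜 EH s (conjField 𝕜 ι r s ξ)) := by
  simp only [mcForm_conjField]
  exact r.contMDiff.comp (contMDiff_const.sub (hι.contMDiff_adInv_comp ξ))

theorem modelDeriv_mcForm_conjField (hι : IsIntegratingSubgroup (EH := EH) ι 𝔥) (ξ : EG) (h : H)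
    (v : EH) :
    modelDeriv 𝕜 EH EH (fun s => mcForm 𝕜 EH s (conjField 𝕜 ι r s ξ)) h v
      = r (lieBr 𝕜 EG G (modelDeriv 𝕜 EH EG ι 1 (mcForm 𝕜 EH h v)) (adInv 𝕜 EG (ι h) ξ)) := by
  simp only [mcForm_conjField]
  have hd : MDifferentiableAt 𝓘(𝕜, EH) 𝓘(𝕜, EG) (fun s => adInv 𝕜 EG (ι s) ξ) h :=
    (hι.contMDiff_adInv_comp ξ).mdifferentiableAt (by simp)
  have hd' : MDifferentiableAt 𝓘(𝕜, EH) 𝓘(𝕜, EG) (fun s => ξ - adInv 𝕜 EG (ι s) ξ) h :=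
    mdifferentiableAt_const.sub hd
  have h1 := DFunLike.congr_fun (modelDeriv_comp (𝕜 := 𝕜) (x := h) (g := r)
    r.differentiableAt.mdifferentiableAt hd') v
  rw [modelDeriv_eq_fderiv, ContinuousLinearMap.fderiv, ContinuousLinearMap.comp_apply] at h1
  have h2 : modelDeriv 𝕜 EH EG (fun s => ξ - adInv 𝕜 EG (ι s) ξ) h v
      = modelDeriv 𝕜 EH EG (fun _ : H => ξ) h v
        - modelDeriv 𝕜 EH EG (fun s => adInv 𝕜 EG (ι s) ξ) h v :=
    DFunLike.congr_fun (mfderiv_sub mdifferentiableAt_const hd) v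
  rw [h1, h2, modelDeriv_const, hι.modelDeriv_adInv_comp, zero_apply, zero_sub, neg_neg]

/-- The bracket is computed in `𝔤`, into which `𝔥` embeds. Every vector to which `r` is applied lies
in `𝔥`, by reducibility, so the choice of left inverse plays no role; the terms then combine because
`adInv` preserves brackets. -/
theorem modelBracket_conjField (hι : IsIntegratingSubgroup (EH := EH) ι 𝔥)
    (hr : ∀ u, r (modelDeriv 𝕜 EH EG ι 1 u) = u) (hred : IsReducible B 𝔥) (h : H) {ξ ζ : EG}
    (hξ : ξ ∈ modelPerp B 𝔥) (hζ : ζ ∈ modelPerp B 𝔥) :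
    modelBracket 𝕜 EH (fun s => conjField 𝕜 ι r s ξ) (fun s => conjField 𝕜 ι r s ζ) h
      = conjField 𝕜 ι r h (lieBr 𝕜 EG G ξ ζ) := by
  have hd : ∀ ξ, MDifferentiableAt 𝓘(𝕜, EH) 𝓘(𝕜, EH)
      (fun s => mcForm 𝕜 EH s (conjField 𝕜 ι r s ξ)) h := fun ξ =>
    (contMDiff_mcForm_conjField hι ξ).mdifferentiableAt (by simp)
  have h1 := mcForm_modelBracket (hd ξ) (hd ζ)
  rw [modelDeriv_mcForm_conjField hι, modelDeriv_mcForm_conjField hι, mcForm_conjField,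
    mcForm_conjField, modelDeriv_one_leftInverse hι hr (hι.sub_adInv_mem_modelSub hred h hξ),
    modelDeriv_one_leftInverse hι hr (hι.sub_adInv_mem_modelSub hred h hζ)] at h1
  have h2 := congr_arg (modelDeriv 𝕜 EH EG ι 1) h1
  rw [map_sub, map_add, modelDeriv_hom_lieBr hι.mdifferentiable,
    modelDeriv_one_leftInverse hι hr (hι.sub_adInv_mem_modelSub hred h hξ),
    modelDeriv_one_leftInverse hι hr (hι.sub_adInv_mem_modelSub hred h hζ),
    modelDeriv_one_leftInverse hι hr (lieBr_mem_modelSub_of_perp hred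
      (hι.sub_adInv_mem_modelSub hred h hξ) (hι.adInv_mem_modelPerp h hζ)),
    modelDeriv_one_leftInverse hι hr (lieBr_mem_modelSub_of_perp hred
      (hι.sub_adInv_mem_modelSub hred h hζ) (hι.adInv_mem_modelPerp h hξ))] at h2
  have h3 : modelDeriv 𝕜 EH EG ι 1 (mcForm 𝕜 EH h (modelBracket 𝕜 EH
      (fun s => conjField 𝕜 ι r s ξ) (fun s => conjField 𝕜 ι r s ζ) h))
      = lieBr 𝕜 EG G ξ ζ - adInv 𝕜 EG (ι h) (lieBr 𝕜 EG G ξ ζ) := by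
    rw [h2, adInv_lieBr]
    simp only [map_sub, sub_apply]
    rw [lieBr_skew ζ (adInv 𝕜 EG (ι h) ξ),
      lieBr_skew (adInv 𝕜 EG (ι h) ζ) (adInv 𝕜 EG (ι h) ξ)]
    abel
  -- Applying `r` undoes the embedding and returns to the Lie algebra of `H`.
  have h4 := congr_arg r h3
  rw [hr] at h4
  rw [← leftTrans_mcForm (𝕜 := 𝕜) h (modelBracket 𝕜 EH _ _ h), h4, conjField_apply]

/-- The action of the annihilator on the subgroup. -/
def conjAction (hred : IsReducible B 𝔥) (ι : H →* G) (r : EG →L[𝕜] EH) (h : H) :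
    perpLie B 𝔥 hred →ₗ[𝕜] TangentSpace 𝓘(𝕜, EH) h :=
  ((conjField 𝕜 ι r h).toLinearMap : GroupLieAlgebra 𝓘(𝕜, EG) G →ₗ[𝕜] TangentSpace 𝓘(𝕜, EH) h) ∘ₗ
    (perpLie B 𝔥 hred).toSubmodule.subtype

theorem isLieAlgebraAction_conjAction (hι : IsIntegratingSubgroup (EH := EH) ι 𝔥)
    (hr : ∀ u, r (modelDeriv 𝕜 EH EG ι 1 u) = u) (hred : IsReducible B 𝔥) :
    IsLieAlgebraAction (perpLie B 𝔥 hred) (conjAction hred ι r) where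
  smooth := fun ξ h => contMDiffAt_vectorField_iff_mcForm.2
    (contMDiff_mcForm_conjField hι ((ξ : GroupLieAlgebra 𝓘(𝕜, EG) G) : EG) h)
  map_lie := fun ξ ζ h => modelBracket_conjField hι hr hred h ξ.2 ζ.2

theorem mfderiv_conjAction (hι : IsIntegratingSubgroup (EH := EH) ι 𝔥)
    (hr : ∀ u, r (modelDeriv 𝕜 EH EG ι 1 u) = u) (hred : IsReducible B 𝔥) (h : H)
    (ξ : perpLie B 𝔥 hred) :
    mfderiv 𝓘(𝕜, EH) 𝓘(𝕜, EG) ι h (conjAction hred ι r h ξ)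
      = leftVec 𝕜 EG (ι h) ξ - rightVec 𝕜 EG (ι h) ξ := by
  exact (modelDeriv_conjField hι hr hred h ξ.2).trans (fst_cartanDiracMap B (ι h) _).symm

/-- The derivative of a function with values in a closed subspace. -/
theorem modelDeriv_mem_modelPerp {f : H → EG} {h : H}
    (hd : MDifferentiableAt 𝓘(𝕜, EH) 𝓘(𝕜, EG) f h) (hf : ∀ s, f s ∈ modelPerp B 𝔥) (v : EH) :
    modelDeriv 𝕜 EH EG f h v ∈ modelPerp B 𝔥 := by
  refine mem_modelPerp.2 fun x hx => ?_
  have h1 := DFunLike.congr_fun (modelDeriv_comp (𝕜 := 𝕜) (x := h) (g := pairForm B x)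
    (pairForm B x).differentiableAt.mdifferentiableAt hd) v
  rw [modelDeriv_eq_fderiv, ContinuousLinearMap.fderiv, ContinuousLinearMap.comp_apply] at h1
  have h2 : (fun s => pairForm B x (f s)) = fun _ => 0 := funext fun s =>
    mem_modelPerp.1 (hf s) x hx
  rw [← h1, h2, modelDeriv_const, zero_apply]

theorem isActionAlgebroidIso_conjAction (hι : IsIntegratingSubgroup (EH := EH) ι 𝔥)
    (hr : ∀ u, r (modelDeriv 𝕜 EH EG ι 1 u) = u) (hred : IsReducible B 𝔥)
    (hφ : IsQuotientLieGroup 𝕜 EH EQ φ N)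
    (hker : ∀ x, modelDeriv 𝕜 EH EQ φ 1 x = 0 ↔ modelDeriv 𝕜 EH EG ι 1 x ∈ modelPerp B 𝔥) :
    IsActionAlgebroidIso (-cartanForm B) (cartanDirac B) ι
      (stabilizer (EZ := EQ) (cartanDirac B) ι (0 : FormField 𝕜 EH H 2) φ)
      (perpLie B 𝔥 hred) (conjAction hred ι r)
      (fun h => cartanDiracMap B (ι h) ∘ₗ (perpLie B 𝔥 hred).toSubmodule.subtype) where
  injective := fun h => (cartanDiracMap_injective B (ι h)).comp Subtype.val_injective
  range_eq := fun h => by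
    rw [stabilizer_eq_map hι hred hφ hker, LinearMap.range_comp, Submodule.range_subtype]
    rfl
  smooth := fun ξ s₀ => ⟨Set.univ, Set.univ,
    fun x => cartanDiracMap B x (ξ : GroupLieAlgebra 𝓘(𝕜, EG) G), isOpen_univ, isOpen_univ,
    trivial, Set.mapsTo_univ _ _, isSmoothSectionOn_cartanDiracMap B _ isOpen_univ,
    fun x _ => LinearMap.mem_range_self _ _, fun s _ => rfl⟩
  anchor := fun h ξ => (mfderiv_conjAction hι hr hred h ξ).symm
  bracket := by
    intro U V hU hV hUV c₁ c₂ s1 s2 m1 m2 f₁ f₂ hf1 hf2 e1 e2 s hs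
    have d1 : MDifferentiableAt 𝓘(𝕜, EH) 𝓘(𝕜, EG) (toModel f₁) s :=
      (hf1.contMDiffAt (hV.mem_nhds hs)).mdifferentiableAt (by simp)
    have d2 : MDifferentiableAt 𝓘(𝕜, EH) 𝓘(𝕜, EG) (toModel f₂) s :=
      (hf2.contMDiffAt (hV.mem_nhds hs)).mdifferentiableAt (by simp)
    -- The parameter of the section `c` of `L_G` restricts to `f` along `H`, so its derivatives in
    -- directions tangent to `H` are those of `f`. The anchors of both sections are tangent to `H`,
    -- and thus the bracket does not depend on how `f₁` and `f₂` are extended to `G`.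
    have hpar : ∀ {c : ∀ x : G, GenTangent 𝕜 EG x} {f : H → perpLie B 𝔥 hred},
        IsSmoothSectionOn c U →
        (∀ t ∈ V, c (ι t) = cartanDiracMap B (ι t) (f t : GroupLieAlgebra 𝓘(𝕜, EG) G)) →
        (∀ t ∈ V, cartanParam B (ι t) (c (ι t)) = toModel f t) ∧ ∀ v : EH,
          modelDeriv 𝕜 EG EG (fun x => cartanParam B x (c x)) (ι s) (modelDeriv 𝕜 EH EG ι s v)
            = modelDeriv 𝕜 EH EG (toModel f) s v := by
      intro c f hc he
      have k1 : ∀ t ∈ V, cartanParam B (ι t) (c (ι t)) = toModel f t := fun t ht => by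
        rw [he t ht]
        exact cartanParam_cartanDiracMap B (ι t) (toModel f t)
      refine ⟨k1, fun v => ?_⟩
      have k2 := modelDeriv_comp (𝕜 := 𝕜) (x := s) (g := fun x => cartanParam B x (c x))
        ((contMDiffAt_cartanParam B hU hc (hUV hs)).mdifferentiableAt (by simp))
        (hι.mdifferentiable s)
      have k3 : (fun t => cartanParam B (ι t) (c (ι t))) =ᶠ[𝓝 s] toModel f := by
        filter_upwards [hV.mem_nhds hs] with t ht using k1 t ht
      rw [modelDeriv_congr k3] at k2
      exact (DFunLike.congr_fun k2 v).symm
    obtain ⟨p1, q1⟩ := hpar s1 e1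
    obtain ⟨p2, q2⟩ := hpar s2 e2
    have a1 : ((c₁ (ι s)).1 : EG) = modelDeriv 𝕜 EH EG ι s (conjAction hred ι r s (f₁ s)) :=
      (congr_arg Prod.fst (e1 s hs)).trans (mfderiv_conjAction hι hr hred s (f₁ s)).symm
    have a2 : ((c₂ (ι s)).1 : EG) = modelDeriv 𝕜 EH EG ι s (conjAction hred ι r s (f₂ s)) :=
      (congr_arg Prod.fst (e2 s hs)).trans (mfderiv_conjAction hι hr hred s (f₂ s)).symm
    have key := dorfman_eq_cartanDiracMap B hU s1 s2 m1 m2 (hUV hs)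
    have hval : lieBr 𝕜 EG G (cartanParam B (ι s) (c₁ (ι s))) (cartanParam B (ι s) (c₂ (ι s)))
        + modelDeriv 𝕜 EG EG (fun x => cartanParam B x (c₂ x)) (ι s) (c₁ (ι s)).1
        - modelDeriv 𝕜 EG EG (fun x => cartanParam B x (c₁ x)) (ι s) (c₂ (ι s)).1
        = lieBr 𝕜 EG G (toModel f₁ s) (toModel f₂ s)
          + modelDeriv 𝕜 EH EG (toModel f₂) s (conjAction hred ι r s (f₁ s))
          - modelDeriv 𝕜 EH EG (toModel f₁) s (conjAction hred ι r s (f₂ s)) := by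
      rw [p1 s hs, p2 s hs]
      exact congr_arg₂ (fun x y : EG => lieBr 𝕜 EG G (toModel f₁ s) (toModel f₂ s) + x - y)
        ((congr_arg _ a1).trans (q2 _)) ((congr_arg _ a2).trans (q1 _))
    -- The result must be a parameter in `𝔥^⊥`: the bracket is by reducibility, and derivatives of
    -- functions valued in a linear subspace of finite dimension stay in it.
    have hmem : lieBr 𝕜 EG G (toModel f₁ s) (toModel f₂ s)
          + modelDeriv 𝕜 EH EG (toModel f₂) s (conjAction hred ι r s (f₁ s))
          - modelDeriv 𝕜 EH EG (toModel f₁) s (conjAction hred ι r s (f₂ s)) ∈ modelPerp B 𝔥 :=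
      sub_mem (add_mem (lieBr_mem_modelPerp hred (f₁ s).2 (f₂ s).2)
        (modelDeriv_mem_modelPerp d2 (fun t => (f₂ t).2) _))
        (modelDeriv_mem_modelPerp d1 (fun t => (f₁ t).2) _)
    exact ⟨⟨_, hmem⟩, rfl, key.trans (congr_arg (cartanDiracMap B (ι s)) hval)⟩

end ConjugationAction

end CartanDirac

end

/-! ### Assembly of the reduction theorem -/

theorem proposition4 {𝕜 : Type*} [RCLike 𝕜]
    {EG : Type*} [NormedAddCommGroup EG] [NormedSpace 𝕜 EG] [FiniteDimensional 𝕜 EG]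
    [CompleteSpace EG]
    {G : Type*} [Group G] [TopologicalSpace G] [ChartedSpace EG G] [LieGroup 𝓘(𝕜, EG) ∞ G]
    {EH : Type*} [NormedAddCommGroup EH] [NormedSpace 𝕜 EH] [FiniteDimensional 𝕜 EH]
    [CompleteSpace EH]
    {H : Type*} [Group H] [TopologicalSpace H] [ChartedSpace EH H] [LieGroup 𝓘(𝕜, EH) ∞ H]
    {EP : Type*} [NormedAddCommGroup EP] [NormedSpace 𝕜 EP] [FiniteDimensional 𝕜 EP]
    [CompleteSpace EP]
    {P : Type*} [Group P] [TopologicalSpace P] [ChartedSpace EP P] [LieGroup 𝓘(𝕜, EP) ∞ P]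
    {EQ : Type*} [NormedAddCommGroup EQ] [NormedSpace 𝕜 EQ] [FiniteDimensional 𝕜 EQ]
    [CompleteSpace EQ]
    {Q : Type*} [Group Q] [TopologicalSpace Q] [ChartedSpace EQ Q] [LieGroup 𝓘(𝕜, EQ) ∞ Q]
    -- the invariant pairing on the Lie algebra of `G` and the reducible subalgebra
    (B : CartanDirac.InvariantPairing 𝕜 EG G)
    (𝔥 : LieSubalgebra 𝕜 (GroupLieAlgebra 𝓘(𝕜, EG) G))
    (hred : CartanDirac.IsReducible B 𝔥)
    -- the connected subgroups `H` and `H^⊥` (here `P`) integrating `𝔥` and `𝔥^⊥`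
    (ι : H →* G) (hι : CartanDirac.IsIntegratingSubgroup (EH := EH) ι 𝔥)
    (κ : P →* G)
    (hκ : CartanDirac.IsIntegratingSubgroup (EH := EP) κ (CartanDirac.perpLie B 𝔥 hred))
    -- the quotient Lie group `H / (H ∩ H^⊥)` (here `Q`)
    (φ : H →* Q) (hφ : CartanDirac.IsQuotientLieGroup 𝕜 EH EQ φ (κ.range.comap ι)) :
    -- the induced pairing on the Lie algebra of the quotient
    ∃ Bq : CartanDirac.InvariantPairing 𝕜 EQ Q,
      (∀ x y : GroupLieAlgebra 𝓘(𝕜, EH) H,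
        Bq.form (CartanDirac.lieMap 𝕜 EQ φ x) (CartanDirac.lieMap 𝕜 EQ φ y)
          = B.form (CartanDirac.lieMap 𝕜 EG ι x) (CartanDirac.lieMap 𝕜 EG ι y)) ∧
      DiracGeometry.IsGeneralizedReductionLevel
        (-CartanDirac.cartanForm B) (CartanDirac.cartanDirac B)
        ι (0 : DiracGeometry.FormField 𝕜 EH H 2) φ
        (-CartanDirac.cartanForm Bq) (CartanDirac.cartanDirac Bq) ∧
      -- the stabilizer subalgebroid is the action Lie algebroid for the conjugation action
      ∃ ρ : ∀ h : H, CartanDirac.perpLie B 𝔥 hred →ₗ[𝕜] TangentSpace 𝓘(𝕜, EH) h,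
        CartanDirac.IsLieAlgebraAction (CartanDirac.perpLie B 𝔥 hred) ρ ∧
        (∀ h ξ, mfderiv 𝓘(𝕜, EH) 𝓘(𝕜, EG) ι h (ρ h ξ)
          = CartanDirac.leftVec 𝕜 EG (ι h) ξ - CartanDirac.rightVec 𝕜 EG (ι h) ξ) ∧
        CartanDirac.IsActionAlgebroidIso (-CartanDirac.cartanForm B) (CartanDirac.cartanDirac B) ι
          (DiracGeometry.stabilizer (EZ := EQ) (CartanDirac.cartanDirac B) ι
            (0 : DiracGeometry.FormField 𝕜 EH H 2) φ)
          (CartanDirac.perpLie B 𝔥 hred) ρ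
          (fun h => CartanDirac.cartanDiracMap B (ι h) ∘ₗ
            (CartanDirac.perpLie B 𝔥 hred).toSubmodule.subtype) := by
  obtain ⟨Bq, hBq⟩ := CartanDirac.exists_inducedPairing hι hκ hφ
  -- A left inverse of the inclusion of Lie algebras turns the conjugation fields of `G` into
  -- explicit fields on `H`.
  obtain ⟨r, hr⟩ := (CartanDirac.modelDeriv 𝕜 EH EG ι 1).toLinearMap.exists_leftInverse_of_injective
    (LinearMap.ker_eq_bot.2 (hι.injective_modelDeriv 1))
  have hr' : ∀ u, LinearMap.toContinuousLinearMap r (CartanDirac.modelDeriv 𝕜 EH EG ι 1 u) = u :=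
    fun u => LinearMap.congr_fun hr u
  have hker := CartanDirac.modelDeriv_quotient_eq_zero_iff hι hκ hφ
  exact ⟨Bq, hBq, CartanDirac.isGeneralizedReductionLevel hι hred hφ hker hBq,
    CartanDirac.conjAction hred ι (LinearMap.toContinuousLinearMap r),
    CartanDirac.isLieAlgebraAction_conjAction hι hr' hred,
    CartanDirac.mfderiv_conjAction hι hr' hred,
    CartanDirac.isActionAlgebroidIso_conjAction hι hr' hred hφ hker⟩
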